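/- **Setting.** Let $1<\alpha\le 2$, $|\theta|\le\min\{\alpha,2-\alpha\}$, $1<\mu\le 2$, $0\le\nu\le 1$, $k\in\mathbb R$, and put $\beta=(1-\nu)(2-\mu)\in[0,1)$, $\gamma=\nu(2-\mu)$ and $$\hat f(\kappa)=\int_{\mathbb R}f(x)e^{i\kappa x}\,dx,\qquad \psi_\alpha^\theta(\kappa)=|\kappa|^\alpha e^{i\,\mathrm{sign}(\kappa)\theta\pi/2},\qquad E_{a,b}(z)=\sum_{n\ge0}\frac{z^n}{\Gamma(an+b)}.$$ The Fourier transform of a function that need not be integrable is taken in the sense of tempered distributions. The Riesz–Feller derivative ${}_xD^\alpha_\theta$ is the operator with Fourier symbol $-\psi_\alpha^\theta$. Let ${}_yI^\rho_{0+}u(y)=\frac1{\Gamma(\rho)}\int_0^y(y-t)^{\rho-1}u(t)\,dt$ (the identity for $\rho=0$) and ${}_yD^{\mu,\nu}_{0+}u={}_yI^{\gamma}_{0+}\frac{d^2}{dy^2}\,{}_yI^{\beta}_{0+}u$. For $\omega\in\mathbb C$ let $({}_y\mathcal E^{\omega;1}_{0+;\mu,\mu}u)(y)=\int_0^y(y-\xi)^{\mu-1}E_{\mu,\mu}(\omega(y-\xi)^\mu)u(\xi)\,d\xi$.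 Let $f,g\in L^1(\mathbb R)$ and let $\Phi$ be integrable on $\mathbb R\times(0,Y)$ for every $Y>0$, with $\Phi(\cdot,y)\in L^1(\mathbb R)$ for every $y>0$; $\hat\Phi(\kappa,y)$ is the Fourier transform in $x$. Consider $${}_xD^\alpha_\theta N(x,y)+{}_yD^{\mu,\nu}_{0+}N(x,y)+k^2N(x,y)=\Phi(x,y),\qquad x\in\mathbb R,\ y>0,$$ $$({}_yI^{\beta}_{0+}N)(x,0+)=f(x),\qquad \Big(\tfrac{d}{dy}\,{}_yI^{\beta}_{0+}N\Big)(x,0+)=g(x),\qquad \lim_{x\to\pm\infty}N(x,y)=0.$$ A *solution* is a complex-valued function $N$, continuous on $\mathbb R\times(0,\infty)$ and bounded on $\mathbb R\times[a,b]$ for all $0<a<b$, with the following properties. For every $y>0$ it has a Fourier transform $\hat N(\cdot,y)\in L^1(\mathbb R)$, and $\hat N$ is integrable on $\mathbb R\times(0,Y)$ for every $Y>0$. For a.e. $x$, ${}_yI^\beta_{0+}N(x,\cdot)$ is twice differentiable on $(0,\infty)$, and for every $Y>0$ the second derivative, divided by some power of $1+|x|$, is integrable on $\mathbb R\times(0,Y)$.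 For every $y>0$ the function $N(\cdot,y)$ has a Riesz–Feller derivative that is a function integrable against some power of $(1+|x|)^{-1}$. The equation holds for every $y>0$ and a.e. $x$, the two conditions at $y=0+$ hold for a.e. $x$, and the last condition holds for every $y>0$. **Theorem 2.** (1) Every solution $N$ of this problem satisfies, for all $x\in\mathbb R$ and $y>0$, $$N(x,y)=\frac1{2\pi}\int_{\mathbb R}\Big[y^{-\beta}E_{\mu,1-\beta}\big(y^\mu(\psi_\alpha^\theta(\kappa)-k^2)\big)\hat f(\kappa)+y^{1-\beta}E_{\mu,2-\beta}\big(y^\mu(\psi_\alpha^\theta(\kappa)-k^2)\big)\hat g(\kappa)+\big({}_y\mathcal E^{\psi_\alpha^\theta(\kappa)-k^2;1}_{0+;\mu,\mu}\hat\Phi\big)(\kappa,y)\Big]e^{-i\kappa x}\,d\kappa,$$ the integral being absolutely convergent; hence, whenever the three integrals below converge absolutely at the given $y$, $$N(x,y)=\frac{y^{-\beta}}{2\pi}\int_{\mathbb R}E_{\mu,1-\beta}\big(y^\mu(\psi_\alpha^\theta(\kappa)-k^2)\big)\hat f(\kappa)e^{-i\kappa x}d\kappa+\frac{y^{1-\beta}}{2\pi}\int_{\mathbb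 R}E_{\mu,2-\beta}\big(y^\mu(\psi_\alpha^\theta(\kappa)-k^2)\big)\hat g(\kappa)e^{-i\kappa x}d\kappa+\frac1{2\pi}\int_{\mathbb R}\big({}_y\mathcal E^{\psi_\alpha^\theta(\kappa)-k^2;1}_{0+;\mu,\mu}\hat\Phi\big)(\kappa,y)e^{-i\kappa x}d\kappa.\qquad(*)$$ In particular there is at most one solution. (2) Conversely, suppose that $e^{c|\kappa|^{\alpha/\mu}}\hat f(\kappa)$ and $e^{c|\kappa|^{\alpha/\mu}}\hat g(\kappa)$ are integrable for every $c>0$, and that $\hat\Phi(\kappa,\cdot)={}_yI^{\gamma}_{0+}\chi(\kappa,\cdot)$ on $(0,\infty)$ for a measurable $\chi$ such that $\chi(\kappa,\cdot)$ is continuous on $(0,\infty)$ for every $\kappa$ and, for all $c,Y>0$, $|\chi(\kappa,y)|\le A(\kappa)y^{-\delta}$ for all $\kappa\in\mathbb R$, $0<y\le Y$, with some $\delta<1$ and some $A$ for which $e^{c|\kappa|^{\alpha/\mu}}A(\kappa)$ is integrable. Then the three integrals in $(*)$ converge absolutely for every $y>0$, and the function $N$ defined by $(*)$ is a solution. -/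

import Mathlib

open MeasureTheory Set Filter Topology

noncomputable section

namespace FracHelmholtz

/-! ### Fourier transform and the Riesz–Feller derivative -/

/-- The Fourier transform `∫ f(x) e^{iκx} dx`, as an absolutely convergent integral. -/
def fourierT (f : ℝ → ℂ) (κ : ℝ) : ℂ :=
  ∫ x : ℝ, f x * Complex.exp (Complex.I * ((κ * x : ℝ) : ℂ))

/-- The inverse Fourier transform `(1/2π) ∫ h(κ) e^{-iκx} dκ`. -/
def invFourierT (h : ℝ → ℂ) (x : ℝ) : ℂ :=
  (1 / (2 * (Real.pi : ℂ))) * ∫ κ : ℝ, h κ * Complex.exp (-Complex.I * ((κ * x : ℝ) : ℂ))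

/-- `f` is integrable against some polynomially decaying weight, so that it defines a tempered
distribution. -/
def IsTempered (f : ℝ → ℂ) : Prop :=
  ∃ m : ℕ, Integrable (fun x : ℝ => (((1 + |x|) ^ m)⁻¹ : ℝ) • f x)

/-- The function `h` is the Fourier transform of the function `f` in the sense of tempered
distributions: `∫ f(x) φ^(x) dx = ∫ h(κ) φ(κ) dκ` for every Schwartz function `φ`, where `φ^` is the
(integral) Fourier transform of `φ`.  For integrable `f` this holds with `h = fourierT f`. It
determines `h` from `f`, and `f` from `h`, up to null sets. -/
structure HasFourierT (f h : ℝ → ℂ) : Prop where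
  tempered_left : IsTempered f
  tempered_right : IsTempered h
  pairing : ∀ φ : SchwartzMap ℝ ℂ, ∫ x : ℝ, f x * fourierT (fun t => φ t) x = ∫ κ : ℝ, h κ * φ κ

/-- The symbol `ψ(κ) = |κ|^α exp(i sign(κ) θ π / 2)`. -/
def psi (α θ κ : ℝ) : ℂ :=
  ((|κ| ^ α : ℝ) : ℂ) * Complex.exp (Complex.I * ((Real.sign κ * (θ * Real.pi / 2) : ℝ) : ℂ))

/-- `h` is the Riesz–Feller derivative of order `α` and skewness `θ` of `f`: on the Fourier side it
is multiplication by `-ψ`. -/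
def IsRieszFellerDeriv (α θ : ℝ) (f h : ℝ → ℂ) : Prop :=
  ∃ fh : ℝ → ℂ, HasFourierT f fh ∧ HasFourierT h (fun κ => -psi α θ κ * fh κ)

/-! ### Riemann–Liouville integral and Hilfer derivative (base point `0`) -/

/-- The Riemann–Liouville fractional integral of order `ρ ≥ 0`; the identity for `ρ = 0`. -/
def rlIntegral (ρ : ℝ) (u : ℝ → ℂ) (y : ℝ) : ℂ :=
  if ρ = 0 then u y
  else ((Real.Gamma ρ)⁻¹ : ℂ) * ∫ t in (0 : ℝ)..y, (((y - t) ^ (ρ - 1) : ℝ) : ℂ) * u t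

/-- The Hilfer (generalized Riemann–Liouville) derivative of order `μ` and type `ν`, where
`n - 1 < μ ≤ n`, that is `n = ⌈μ⌉`. -/
def hilferDeriv (μ ν : ℝ) (u : ℝ → ℂ) (y : ℝ) : ℂ :=
  rlIntegral (ν * ((⌈μ⌉₊ : ℝ) - μ))
    (iteratedDeriv ⌈μ⌉₊ (rlIntegral ((1 - ν) * ((⌈μ⌉₊ : ℝ) - μ)) u)) y

/-! ### Mittag-Leffler functions and the Prabhakar integral operator -/

/-- The two parameter Mittag-Leffler function `E_{a,b}`. -/
def mittagLeffler (a b : ℝ) (z : ℂ) : ℂ :=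
  ∑' n : ℕ, z ^ n / (Real.Gamma (a * n + b) : ℂ)

/-- The three parameter (Prabhakar) Mittag-Leffler function `E_{a,b}^c`. -/
def prabhakarML (a b c : ℝ) (z : ℂ) : ℂ :=
  ∑' n : ℕ, (((ascPochhammer ℝ n).eval c / Real.Gamma (a * n + b) : ℝ) : ℂ) *
    (z ^ n / (Nat.factorial n : ℂ))

/-- The Prabhakar integral operator with kernel `t^{b-1} E_{a,b}^c(ω t^a)`. -/
def prabhakarOp (a b c : ℝ) (ω : ℂ) (u : ℝ → ℂ) (y : ℝ) : ℂ :=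
  ∫ ξ in (0 : ℝ)..y, (((y - ξ) ^ (b - 1) : ℝ) : ℂ) *
    prabhakarML a b c (ω * (((y - ξ) ^ a : ℝ) : ℂ)) * u ξ

/-! ### The boundary value problem -/

/-- `N` is a (Fourier transformable, classical in `y`) solution on `ℝ × (0, ∞)` of
`ₓD^α_θ N + ᵧD^{μ,ν}_{0+} N + k² N = Φ` with boundary data `f`, `g` at `y = 0+` and vanishing as
`x → ± ∞`.  As `f`, `g` and `Φ(·, y)` are integrable functions of `x`, pointwise relations with
them are understood for almost every `x`. -/
structure IsSolution (α θ μ ν k : ℝ) (f g : ℝ → ℂ) (Φ N : ℝ → ℝ → ℂ) : Prop where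
  /-- `N` is continuous for `y > 0`. -/
  continuousOn : ContinuousOn (fun p : ℝ × ℝ => N p.1 p.2) (univ ×ˢ Ioi 0)
  /-- `N` is bounded in `x`, locally uniformly in `y > 0`. -/
  bounded : ∀ a b : ℝ, 0 < a → ∃ C : ℝ, ∀ x : ℝ, ∀ y ∈ Icc a b, ‖N x y‖ ≤ C
  /-- `N` has a Fourier transform in `x` which is integrable in `κ`, and in `(κ, y)` on strips. -/
  fourier : ∃ Nh : ℝ → ℝ → ℂ,
    (∀ y : ℝ, 0 < y → HasFourierT (fun x => N x y) (fun κ => Nh κ y) ∧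
      Integrable (fun κ => Nh κ y)) ∧
    ∀ Y : ℝ, 0 < Y → IntegrableOn (fun p : ℝ × ℝ => Nh p.1 p.2) (univ ×ˢ Ioo 0 Y)
  /-- The fractional integral of `N` in `y`, which the Hilfer derivative differentiates twice, is
  twice differentiable. -/
  differentiable : ∀ᵐ x : ℝ, ∀ y : ℝ, 0 < y →
    DifferentiableAt ℝ (rlIntegral ((1 - ν) * (2 - μ)) (N x)) y ∧
    DifferentiableAt ℝ (deriv (rlIntegral ((1 - ν) * (2 - μ)) (N x))) y
  /-- Its second derivative is integrable on strips against a polynomially decaying weight. -/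
  integrable_deriv : ∀ Y : ℝ, 0 < Y → ∃ m : ℕ, IntegrableOn
    (fun p : ℝ × ℝ => (((1 + |p.1|) ^ m)⁻¹ : ℝ) •
      iteratedDeriv 2 (rlIntegral ((1 - ν) * (2 - μ)) (N p.1)) p.2) (univ ×ˢ Ioo 0 Y)
  /-- The equation; `R` is the Riesz–Feller derivative of `N` in `x`. -/
  equation : ∃ R : ℝ → ℝ → ℂ,
    (∀ y : ℝ, 0 < y → IsRieszFellerDeriv α θ (fun x => N x y) (fun x => R x y)) ∧
    ∀ y : ℝ, 0 < y → ∀ᵐ x : ℝ,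
      R x y + hilferDeriv μ ν (N x) y + (k : ℂ) ^ 2 * N x y = Φ x y
  /-- The first boundary condition at `y = 0+`. -/
  boundary_f : ∀ᵐ x : ℝ,
    Tendsto (rlIntegral ((1 - ν) * (2 - μ)) (N x)) (𝓝[>] 0) (𝓝 (f x))
  /-- The second boundary condition at `y = 0+`. -/
  boundary_g : ∀ᵐ x : ℝ,
    Tendsto (deriv (rlIntegral ((1 - ν) * (2 - μ)) (N x))) (𝓝[>] 0) (𝓝 (g x))
  /-- `N` vanishes as `x → +∞`. -/
  tendsto_atTop : ∀ y : ℝ, 0 < y → Tendsto (fun x => N x y) atTop (𝓝 0)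
  /-- `N` vanishes as `x → -∞`. -/
  tendsto_atBot : ∀ y : ℝ, 0 < y → Tendsto (fun x => N x y) atBot (𝓝 0)

/-! ### The solution formula -/

/-- Integrand of the term with `f`, without the exponential:
`E_{μ,1-(1-ν)(2-μ)}(y^μ (ψ(κ) - k²)) f^(κ)`. -/
def termF (α θ μ ν k : ℝ) (f : ℝ → ℂ) (y κ : ℝ) : ℂ :=
  mittagLeffler μ (1 - (1 - ν) * (2 - μ)) (((y ^ μ : ℝ) : ℂ) * (psi α θ κ - (k : ℂ) ^ 2)) *
    fourierT f κ

/-- Integrand of the term with `g`, without the exponential: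
`E_{μ,2-(1-ν)(2-μ)}(y^μ (ψ(κ) - k²)) g^(κ)`. -/
def termG (α θ μ ν k : ℝ) (g : ℝ → ℂ) (y κ : ℝ) : ℂ :=
  mittagLeffler μ (2 - (1 - ν) * (2 - μ)) (((y ^ μ : ℝ) : ℂ) * (psi α θ κ - (k : ℂ) ^ 2)) *
    fourierT g κ

/-- Integrand of the source term, without the exponential: the Prabhakar operator with
`a = b = μ`, `c = 1`, `ω = ψ(κ) - k²` applied to `Φ^(κ, ·)`. -/
def termPhi (α θ μ k : ℝ) (Φ : ℝ → ℝ → ℂ) (y κ : ℝ) : ℂ :=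
  prabhakarOp μ μ 1 (psi α θ κ - (k : ℂ) ^ 2) (fun ξ => fourierT (fun x => Φ x ξ) κ) y

/-- The Fourier–Mittag-Leffler–Prabhakar representation, with three separate integrals. -/
def solutionFormula (α θ μ ν k : ℝ) (f g : ℝ → ℂ) (Φ : ℝ → ℝ → ℂ) (x y : ℝ) : ℂ :=
  ((y ^ (-((1 - ν) * (2 - μ))) : ℝ) : ℂ) * invFourierT (termF α θ μ ν k f y) x +
  ((y ^ (1 - (1 - ν) * (2 - μ)) : ℝ) : ℂ) * invFourierT (termG α θ μ ν k g y) x +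
  invFourierT (termPhi α θ μ k Φ y) x

/-- The inverse Fourier transform of the sum of the three terms. -/
def solutionFormulaSum (α θ μ ν k : ℝ) (f g : ℝ → ℂ) (Φ : ℝ → ℝ → ℂ) (x y : ℝ) : ℂ :=
  invFourierT (fun κ =>
    ((y ^ (-((1 - ν) * (2 - μ))) : ℝ) : ℂ) * termF α θ μ ν k f y κ +
    ((y ^ (1 - (1 - ν) * (2 - μ)) : ℝ) : ℂ) * termG α θ μ ν k g y κ +
    termPhi α θ μ k Φ y κ) x

/-- The data whose Fourier transforms decay faster than every `exp(-c |κ|^{α/μ})`, as the growth of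
the Mittag-Leffler functions requires; and `Φ^(κ, ·)` is a Riemann–Liouville integral of order
`ν(2-μ)` of a function `χ(κ, ·)` continuous on `(0, ∞)` with the same decay in `κ` and at most an
integrable power singularity at `y = 0` (`χ = Φ^` when this order is `0`). -/
structure AdmissibleData (α μ ν : ℝ) (f g : ℝ → ℂ) (Φ : ℝ → ℝ → ℂ) : Prop where
  decay_f : ∀ c : ℝ, 0 < c →
    Integrable (fun κ : ℝ => (Real.exp (c * |κ| ^ (α / μ)) : ℂ) * fourierT f κ)
  decay_g : ∀ c : ℝ, 0 < c →
    Integrable (fun κ : ℝ => (Real.exp (c * |κ| ^ (α / μ)) : ℂ) * fourierT g κ)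
  source : ∃ χ : ℝ → ℝ → ℂ,
    Measurable (fun p : ℝ × ℝ => χ p.1 p.2) ∧
    (∀ κ : ℝ, ContinuousOn (χ κ) (Ioi 0)) ∧
    (∀ κ y : ℝ, 0 < y → fourierT (fun x => Φ x y) κ = rlIntegral (ν * (2 - μ)) (χ κ) y) ∧
    ∀ c Y : ℝ, 0 < c → 0 < Y → ∃ (A : ℝ → ℝ) (δ : ℝ), δ < 1 ∧
      Integrable (fun κ : ℝ => Real.exp (c * |κ| ^ (α / μ)) * A κ) ∧
      ∀ κ : ℝ, ∀ y ∈ Ioc 0 Y, ‖χ κ y‖ ≤ A κ * y ^ (-δ)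

end FracHelmholtz

end

open FracHelmholtz

/-!
Transforming in `x` turns the problem into one fractional equation per frequency. With
`β = (1-ν)(2-μ)`, `γ = ν(2-μ)` and `ω = ψ(κ) - k²`, the transform `n = N^(κ, ·)` satisfies
`I^γ (d/dy)² I^β n = Φ^ + ω n`. Applying `I^{1+μ}` and using the two initial values gives the
Volterra equation `I^1 n = f^ t^{1-β}/Γ(2-β) + g^ t^{2-β}/Γ(3-β) + I^{1+μ}(Φ^ + ω n)`, in which no
derivative is left. Up to null sets its only locally integrable solution is
`f^ e_{1-β} + g^ e_{2-β} + e_μ * Φ^` with `e_b(t) = t^{b-1} E_{μ,b}(ω t^μ)`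
(`rlIntegral_one_volterraSol`, `rlIntegral_one_eq_volterraSol`): existence is the termwise identity
`I^a e_b = e_{a+b}` (`powKer_conv_mlKer`), uniqueness is Grönwall's inequality.

**Uniqueness.** The hypotheses on a solution hold for almost every `x` and its transforms are
distributional, so the equation is first paired with a Schwartz function of `x`. Fubini's theorem
moves the fractional integrals out of the pairing, and comparing pairings yields the Volterra
equation for almost every `κ` and every `y` (`IsSolution.pairing_equation`,
`IsSolution.volterra_equation`). This identifies `N^(κ, ·)` up to null sets in `y`. Both sides,
paired with a compactly supported Schwartz function, are continuous in `y > 0`, which gives the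
identity for every `y` (`IsSolution.fourier_eq_volterraSol`); the inversion formula for the
continuous function `N(·, y)` concludes (`IsSolution.eq_solutionFormulaSum`).

**Existence.** The estimate `|E_{μ,b}(z)| ≤ C exp(4 |z|^{1/μ})` (`norm_mittagLeffler_le`) shows
that for rapidly decaying data the functions of `(κ, y)` involved are bounded by an integrable
function of `κ` times an integrable power of `y` on each `(0, Y]` (`Dominated`). Such families may
be inverse-transformed and fractionally integrated in either order. As `Φ^ = I^γ χ`, the transform
of the formula is `S = f^ e_{1-β} + g^ e_{2-β} + e_{2-β} * χ`, and `I^β S = f^ + y g^ + I^2 P` with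
`P = χ + ω (f^ e_{μ-1} + g^ e_μ + e_μ * χ)`. Hence `I^β N` is a first-degree polynomial in `y` plus
a twofold integral of a continuous function, which gives its regularity and initial values, and
`I^γ P = Φ^ + ω S` is the equation.
-/

open scoped FourierTransform SchwartzMap

/-- Causal convolution `∫_0^y k(y - t) u(t) dt`; it vanishes for `y ≤ 0`. -/
noncomputable def causalConv (k u : ℝ → ℂ) (y : ℝ) : ℂ :=
  ∫ t in Ioc 0 y, k (y - t) * u t

/-- The kernel `t^{a-1} / Γ(a)` of the Riemann–Liouville integral of order `a`. -/
noncomputable def powKer (a t : ℝ) : ℂ := ((t ^ (a - 1) / Real.Gamma a : ℝ) : ℂ)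

theorem measurable_powKer (a : ℝ) : Measurable (powKer a) := by
  unfold powKer; fun_prop

theorem norm_powKer {a t : ℝ} (ha : 0 < a) (ht : 0 ≤ t) :
    ‖powKer a t‖ = (Real.Gamma a)⁻¹ * t ^ (a - 1) := by
  have := Real.Gamma_pos_of_pos ha
  rw [powKer, Complex.norm_real, Real.norm_of_nonneg (by positivity)]
  ring

/-! ### Beta integrals -/

theorem integral_beta_zero {a b y : ℝ} (ha : 0 < a) (hb : 0 < b) (hy : 0 < y) :
    ∫ t in (0 : ℝ)..y, (y - t) ^ (a - 1) * t ^ (b - 1) =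
      y ^ (a + b - 1) * (Real.Gamma a * Real.Gamma b / Real.Gamma (a + b)) := by
  have h := Complex.betaIntegral_scaled (b : ℂ) (a : ℂ) hy
  have h2 := Complex.Gamma_mul_Gamma_eq_betaIntegral (s := (b : ℂ)) (t := (a : ℂ))
    (by simpa using hb) (by simpa using ha)
  have hne : Complex.Gamma ((b : ℂ) + a) ≠ 0 := by
    apply Complex.Gamma_ne_zero_of_re_pos; simp; linarith
  have h3 : Complex.betaIntegral b a = ((Real.Gamma a * Real.Gamma b / Real.Gamma (a + b) : ℝ) : ℂ) := by
    push_cast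
    rw [← Complex.Gamma_ofReal, ← Complex.Gamma_ofReal, ← Complex.Gamma_ofReal]
    push_cast
    rw [mul_comm (Complex.Gamma a), h2, add_comm (a : ℂ)]
    field_simp
  rw [h3] at h
  have h4 : ((y : ℂ) ^ ((b : ℂ) + a - 1)) = ((y ^ (a + b - 1) : ℝ) : ℂ) := by
    rw [Complex.ofReal_cpow hy.le]; push_cast; ring_nf
  rw [h4] at h
  have h5 : ∫ x in (0 : ℝ)..y, (x : ℂ) ^ ((b : ℂ) - 1) * ((y : ℂ) - x) ^ ((a : ℂ) - 1) =
      ((∫ t in (0 : ℝ)..y, (y - t) ^ (a - 1) * t ^ (b - 1) : ℝ) : ℂ) := by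
    rw [← intervalIntegral.integral_ofReal]
    apply intervalIntegral.integral_congr
    intro x hx
    rw [uIcc_of_le hy.le] at hx
    simp only
    rw [Complex.ofReal_mul, Complex.ofReal_cpow hx.1, Complex.ofReal_cpow (sub_nonneg.2 hx.2)]
    push_cast; ring
  rw [h5] at h
  exact_mod_cast h

theorem integral_beta {a b s y : ℝ} (ha : 0 < a) (hb : 0 < b) (hy : s < y) :
    ∫ t in Ioc s y, (y - t) ^ (a - 1) * (t - s) ^ (b - 1) =
      (y - s) ^ (a + b - 1) * (Real.Gamma a * Real.Gamma b / Real.Gamma (a + b)) := by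
  rw [← integral_beta_zero ha hb (sub_pos.2 hy), ← intervalIntegral.integral_of_le hy.le]
  have := intervalIntegral.integral_comp_sub_right (a := s) (b := y)
    (fun t => (y - s - t) ^ (a - 1) * t ^ (b - 1)) s
  rw [sub_self] at this
  rw [← this]
  congr 1; ext t; ring_nf

/-- The beta integrand is integrable because its integral is not `0`. -/
theorem integrableOn_beta {a b s y : ℝ} (ha : 0 < a) (hb : 0 < b) :
    IntegrableOn (fun t => (y - t) ^ (a - 1) * (t - s) ^ (b - 1)) (Ioc s y) := by
  rcases le_or_gt y s with h | h
  · simp [Ioc_eq_empty_of_le h]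
  by_contra hc
  have h1 := integral_undef hc
  rw [integral_beta ha hb h] at h1
  have := Real.Gamma_pos_of_pos ha
  have := Real.Gamma_pos_of_pos hb
  have := Real.Gamma_pos_of_pos (add_pos ha hb)
  have : 0 < (y - s) ^ (a + b - 1) := Real.rpow_pos_of_pos (sub_pos.2 h) _
  exact absurd h1 (by positivity)

/-! ### Causal convolution -/

theorem causalConv_congr {k k' u u' : ℝ → ℂ} {y : ℝ} (hk : ∀ t ∈ Ioo 0 y, k t = k' t)
    (hu : ∀ᵐ t, t ∈ Ioo 0 y → u t = u' t) : causalConv k u y = causalConv k' u' y := by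
  unfold causalConv
  rw [integral_Ioc_eq_integral_Ioo, integral_Ioc_eq_integral_Ioo]
  apply setIntegral_congr_ae measurableSet_Ioo
  filter_upwards [hu] with t ht hty
  rw [ht hty, hk (y - t) ⟨by linarith [hty.2], by linarith [hty.1]⟩]

theorem causalConv_of_nonpos (k u : ℝ → ℂ) {y : ℝ} (hy : y ≤ 0) : causalConv k u y = 0 := by
  simp [causalConv, Ioc_eq_empty_of_le hy]

theorem causalConv_comm (k u : ℝ → ℂ) (y : ℝ) : causalConv k u y = causalConv u k y := by
  rcases le_or_gt y 0 with h | h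
  · simp [causalConv_of_nonpos, h]
  unfold causalConv
  rw [← intervalIntegral.integral_of_le h.le, ← intervalIntegral.integral_of_le h.le]
  have := intervalIntegral.integral_comp_sub_left (a := 0) (b := y) (fun t => u (y - t) * k t) y
  simp only [sub_self, sub_zero, sub_sub_cancel] at this
  rw [← this]
  congr 1; ext t; ring

/-- Associativity of causal convolution. The power bounds on the two kernels reduce the absolute
convergence of the double integral to a beta integral. -/
theorem causalConv_assoc {k₁ k₂ u : ℝ → ℂ} {a b C₁ C₂ y : ℝ} (ha : 0 < a) (hb : 0 < b)
    (hk₁m : Measurable k₁) (hk₂m : Measurable k₂)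
    (hk₁ : ∀ t ∈ Ioc 0 y, ‖k₁ t‖ ≤ C₁ * t ^ (a - 1))
    (hk₂ : ∀ t ∈ Ioc 0 y, ‖k₂ t‖ ≤ C₂ * t ^ (b - 1))
    (hum : AEStronglyMeasurable u (volume.restrict (Ioc 0 y)))
    (hu : IntegrableOn (fun s => (y - s) ^ (a + b - 1) * ‖u s‖) (Ioc 0 y)) :
    causalConv k₁ (causalConv k₂ u) y = causalConv (causalConv k₁ k₂) u y := by
  set m := volume.restrict (Ioc (0 : ℝ) y) with hm
  set F : ℝ → ℝ → ℂ := fun t s => if s < t then k₁ (y - t) * k₂ (t - s) * u s else 0 with hF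
  have hFm : AEStronglyMeasurable (Function.uncurry F) (m.prod m) := by
    have h1 : AEStronglyMeasurable (fun p : ℝ × ℝ => k₁ (y - p.1) * k₂ (p.1 - p.2) * u p.2)
        (m.prod m) := by
      refine AEStronglyMeasurable.mul ?_ (hum.comp_snd)
      exact (Measurable.aestronglyMeasurable (by fun_prop))
    have h2 : Function.uncurry F = indicator {p : ℝ × ℝ | p.2 < p.1}
        (fun p : ℝ × ℝ => k₁ (y - p.1) * k₂ (p.1 - p.2) * u p.2) := by
      ext ⟨t, s⟩; simp [F, indicator, Function.uncurry]
    rw [h2]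
    exact h1.indicator (measurableSet_lt measurable_snd measurable_fst)
  -- the slices `t ↦ F t s` live on `(s, y]`
  have hslice : ∀ s ∈ Ioc 0 y, (fun t => F t s) =ᵐ[m]
      indicator (Ioc s y) (fun t => k₁ (y - t) * k₂ (t - s) * u s) := by
    intro s hs
    filter_upwards [ae_restrict_mem measurableSet_Ioc] with t ht
    simp only [F, indicator, mem_Ioc]
    by_cases h : s < t <;> simp [h, ht.2]
  have hsub : ∀ s ∈ Ioc (0 : ℝ) y, Ioc s y ∩ Ioc 0 y = Ioc s y := fun s hs =>
    inter_eq_left.2 (fun t ht => ⟨hs.1.trans ht.1, ht.2⟩)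
  have hbd : ∀ s ∈ Ioc 0 y, ∀ᵐ t ∂(volume.restrict (Ioc s y)),
      ‖k₁ (y - t) * k₂ (t - s) * u s‖ ≤
        C₁ * C₂ * ‖u s‖ * ((y - t) ^ (a - 1) * (t - s) ^ (b - 1)) := by
    intro s hs
    have : ∀ᵐ t : ℝ, t ≠ y := by simp [ae_iff]
    filter_upwards [ae_restrict_mem measurableSet_Ioc, ae_restrict_of_ae this] with t ht hty
    have hlt : t < y := lt_of_le_of_ne ht.2 hty
    have h1 := hk₁ (y - t) ⟨by linarith, by linarith [hs.1, ht.1]⟩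
    have h2 := hk₂ (t - s) ⟨by linarith [ht.1], by linarith [hs.1]⟩
    rw [norm_mul, norm_mul]
    calc ‖k₁ (y - t)‖ * ‖k₂ (t - s)‖ * ‖u s‖
        ≤ (C₁ * (y - t) ^ (a - 1)) * (C₂ * (t - s) ^ (b - 1)) * ‖u s‖ := by
          gcongr
          exact (norm_nonneg _).trans h1
      _ = _ := by ring
  have hsl : ∀ s ∈ Ioc 0 y, Integrable (fun t => k₁ (y - t) * k₂ (t - s) * u s)
      (volume.restrict (Ioc s y)) := by
    intro s hs
    refine Integrable.mono' ((integrableOn_beta (s := s) (y := y) ha hb).const_mul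
      (C₁ * C₂ * ‖u s‖)) ?_ (hbd s hs)
    exact Measurable.aestronglyMeasurable (by fun_prop)
  have hFi : Integrable (Function.uncurry F) (m.prod m) := by
    rw [integrable_prod_iff' hFm]
    constructor
    · filter_upwards [ae_restrict_mem measurableSet_Ioc] with s hs
      change Integrable (fun t => F t s) m
      rw [integrable_congr (hslice s hs), integrable_indicator_iff measurableSet_Ioc, IntegrableOn,
        hm, Measure.restrict_restrict measurableSet_Ioc, hsub s hs]
      exact hsl s hs
    · refine Integrable.mono' (hu.const_mul
        (C₁ * C₂ * (Real.Gamma a * Real.Gamma b / Real.Gamma (a + b)))) ?_ ?_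
      · exact hFm.norm.prod_swap.integral_prod_right'
      · have : ∀ᵐ t : ℝ, t ≠ y := by simp [ae_iff]
        filter_upwards [ae_restrict_mem measurableSet_Ioc, ae_restrict_of_ae this] with s hs hsy
        have hlt : s < y := lt_of_le_of_ne hs.2 hsy
        rw [Real.norm_of_nonneg (integral_nonneg fun _ => norm_nonneg _)]
        have h1 : ∫ t, ‖Function.uncurry F (t, s)‖ ∂m =
            ∫ t in Ioc s y, ‖k₁ (y - t) * k₂ (t - s) * u s‖ := by
          have : (fun t => ‖Function.uncurry F (t, s)‖) =ᵐ[m]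
              indicator (Ioc s y) (fun t => ‖k₁ (y - t) * k₂ (t - s) * u s‖) := by
            filter_upwards [hslice s hs] with t ht
            simp only [Function.uncurry]
            rw [ht, norm_indicator_eq_indicator_norm]
          rw [integral_congr_ae this, integral_indicator measurableSet_Ioc, hm,
            Measure.restrict_restrict measurableSet_Ioc, hsub s hs]
        rw [h1]
        calc ∫ t in Ioc s y, ‖k₁ (y - t) * k₂ (t - s) * u s‖
            ≤ ∫ t in Ioc s y, C₁ * C₂ * ‖u s‖ * ((y - t) ^ (a - 1) * (t - s) ^ (b - 1)) :=
              integral_mono_ae (hsl s hs).norm ((integrableOn_beta ha hb).const_mul _) (hbd s hs)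
          _ = _ := by
              rw [integral_const_mul, integral_beta ha hb hlt]; ring
  have hswap := integral_integral_swap hFi
  have hL : causalConv k₁ (causalConv k₂ u) y = ∫ t, ∫ s, F t s ∂m ∂m := by
    unfold causalConv
    apply integral_congr_ae
    filter_upwards [ae_restrict_mem measurableSet_Ioc] with t ht
    have : (fun s => F t s) =ᵐ[m]
        indicator (Ioo 0 t) (fun s => k₁ (y - t) * (k₂ (t - s) * u s)) := by
      filter_upwards [ae_restrict_mem measurableSet_Ioc] with s hs
      simp only [F, indicator, mem_Ioo]
      by_cases h : s < t <;> simp [h, hs.1, mul_assoc]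
    rw [integral_congr_ae this, integral_indicator measurableSet_Ioo, hm,
      Measure.restrict_restrict measurableSet_Ioo,
      inter_eq_left.2 (show Ioo 0 t ⊆ Ioc 0 y from fun s hs => ⟨hs.1, hs.2.le.trans ht.2⟩),
      integral_const_mul, integral_Ioc_eq_integral_Ioo]
  rw [hL, hswap]
  unfold causalConv
  apply integral_congr_ae
  filter_upwards [ae_restrict_mem measurableSet_Ioc] with s hs
  rw [integral_congr_ae (hslice s hs), integral_indicator measurableSet_Ioc, hm,
    Measure.restrict_restrict measurableSet_Ioc, hsub s hs, integral_mul_const,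
    ← intervalIntegral.integral_of_le hs.2, ← intervalIntegral.integral_of_le (sub_nonneg.2 hs.2)]
  congr 1
  have := intervalIntegral.integral_comp_sub_right (a := s) (b := y)
    (fun t => k₁ (y - s - t) * k₂ t) s
  rw [sub_self] at this
  rw [← this]
  congr 1; ext t; ring_nf

theorem powKer_conv_powKer {a b y : ℝ} (ha : 0 < a) (hb : 0 < b) (hy : 0 < y) :
    causalConv (powKer a) (powKer b) y = powKer (a + b) y := by
  unfold causalConv powKer
  simp_rw [← Complex.ofReal_mul]
  rw [integral_complex_ofReal]
  congr 1
  have h := integral_beta_zero ha hb hy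
  have := (Real.Gamma_pos_of_pos ha).ne'
  have := (Real.Gamma_pos_of_pos hb).ne'
  rw [intervalIntegral.integral_of_le hy.le] at h
  have h2 : ∀ t : ℝ, (y - t) ^ (a - 1) / Real.Gamma a * (t ^ (b - 1) / Real.Gamma b) =
      (Real.Gamma a * Real.Gamma b)⁻¹ * ((y - t) ^ (a - 1) * t ^ (b - 1)) := by
    intro t; field_simp
  simp_rw [h2]
  rw [integral_const_mul, h]
  field_simp

theorem rlIntegral_eq_causalConv {ρ : ℝ} (hρ : 0 < ρ) (u : ℝ → ℂ) {y : ℝ} (hy : 0 ≤ y) :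
    rlIntegral ρ u y = causalConv (powKer ρ) u y := by
  unfold rlIntegral causalConv powKer
  rw [if_neg hρ.ne', intervalIntegral.integral_of_le hy, ← integral_const_mul]
  congr 1; ext t; push_cast; ring

theorem rlIntegral_zero (u : ℝ → ℂ) : rlIntegral 0 u = u := by
  ext y; simp [rlIntegral]

theorem integrableOn_rpow_mul {c y : ℝ} (hc : 0 ≤ c) {u : ℝ → ℂ}
    (hu : IntegrableOn u (Ioc 0 y)) :
    IntegrableOn (fun s => (y - s) ^ c * ‖u s‖) (Ioc 0 y) := by
  refine Integrable.mono' (hu.norm.const_mul (y ^ c)) ?_ ?_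
  · exact (Measurable.aestronglyMeasurable (by fun_prop)).mul hu.aestronglyMeasurable.norm
  · filter_upwards [ae_restrict_mem measurableSet_Ioc] with s hs
    have : 0 ≤ y - s := sub_nonneg.2 hs.2
    rw [norm_mul, norm_norm, Real.norm_of_nonneg (by positivity)]
    gcongr
    linarith [hs.1]

theorem norm_powKer_le {a y : ℝ} (ha : 0 < a) :
    ∀ t ∈ Ioc 0 y, ‖powKer a t‖ ≤ (Real.Gamma a)⁻¹ * t ^ (a - 1) :=
  fun _ ht => (norm_powKer ha ht.1.le).le

/-- The semigroup law, at every point as soon as the total order is at least `1`. -/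
theorem rlIntegral_rlIntegral {a b y : ℝ} (ha : 0 < a) (hb : 0 ≤ b) (hab : 1 ≤ a + b)
    (hy : 0 < y) {u : ℝ → ℂ} (hu : IntegrableOn u (Ioc 0 y)) :
    rlIntegral a (rlIntegral b u) y = rlIntegral (a + b) u y := by
  rcases hb.eq_or_lt with rfl | hb
  · rw [rlIntegral_zero, add_zero]
  rw [rlIntegral_eq_causalConv ha _ hy.le, rlIntegral_eq_causalConv (by linarith) _ hy.le]
  rw [causalConv_congr (k' := powKer a) (u' := causalConv (powKer b) u) (fun _ _ => rfl)
    (Eventually.of_forall fun t ht => rlIntegral_eq_causalConv hb u ht.1.le),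
    causalConv_assoc ha hb (measurable_powKer a) (measurable_powKer b) (norm_powKer_le ha)
    (norm_powKer_le hb) hu.aestronglyMeasurable (integrableOn_rpow_mul (by linarith) hu)]
  exact causalConv_congr (fun t ht => powKer_conv_powKer ha hb ht.1) (Eventually.of_forall fun _ _ => rfl)

theorem rlIntegral_congr_ae {ρ y : ℝ} (hρ : 0 < ρ) (hy : 0 ≤ y) {u v : ℝ → ℂ}
    (h : ∀ᵐ t, t ∈ Ioo 0 y → u t = v t) : rlIntegral ρ u y = rlIntegral ρ v y := by
  rw [rlIntegral_eq_causalConv hρ _ hy, rlIntegral_eq_causalConv hρ _ hy]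
  exact causalConv_congr (fun _ _ => rfl) h

/-! ### Linearity -/

/-- The causal convolution integral `∫_0^y k(y - t) u(t) dt` converges absolutely. -/
def ConvAt (k u : ℝ → ℂ) (y : ℝ) : Prop :=
  IntegrableOn (fun t => k (y - t) * u t) (Ioc 0 y)

theorem causalConv_add_right {k u v : ℝ → ℂ} {y : ℝ} (hu : ConvAt k u y) (hv : ConvAt k v y) :
    causalConv k (fun t => u t + v t) y = causalConv k u y + causalConv k v y := by
  unfold causalConv
  rw [← integral_add hu hv]
  congr 1; ext t; ring

theorem causalConv_const_mul_right (k u : ℝ → ℂ) (c : ℂ) (y : ℝ) :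
    causalConv k (fun t => c * u t) y = c * causalConv k u y := by
  unfold causalConv
  rw [← integral_const_mul]
  congr 1; ext t; ring

theorem causalConv_add_left {k l u : ℝ → ℂ} {y : ℝ} (hk : ConvAt k u y) (hl : ConvAt l u y) :
    causalConv (fun t => k t + l t) u y = causalConv k u y + causalConv l u y := by
  unfold causalConv
  rw [← integral_add hk hl]
  congr 1; ext t; ring

theorem causalConv_const_mul_left (k u : ℝ → ℂ) (c : ℂ) (y : ℝ) :
    causalConv (fun t => c * k t) u y = c * causalConv k u y := by
  unfold causalConv
  rw [← integral_const_mul]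
  congr 1; ext t; ring

theorem ConvAt.add {k u v : ℝ → ℂ} {y : ℝ} (hu : ConvAt k u y) (hv : ConvAt k v y) :
    ConvAt k (fun t => u t + v t) y := by
  unfold ConvAt; simp_rw [mul_add]; exact Integrable.add hu hv

theorem ConvAt.const_mul {k u : ℝ → ℂ} {y : ℝ} (hu : ConvAt k u y) (c : ℂ) :
    ConvAt k (fun t => c * u t) y := by
  unfold ConvAt; simp_rw [mul_left_comm]; exact Integrable.const_mul hu c

theorem ConvAt.const_mul_left {k u : ℝ → ℂ} {y : ℝ} (hu : ConvAt k u y) (c : ℂ) :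
    ConvAt (fun t => c * k t) u y := by
  unfold ConvAt; simp_rw [mul_assoc]; exact Integrable.const_mul hu c

/-- Convergence for a kernel bounded near `0` and an integrable function. -/
theorem ConvAt.of_bounded {k u : ℝ → ℂ} {y C : ℝ} (hkm : Measurable k)
    (hk : ∀ t ∈ Ioo 0 y, ‖k t‖ ≤ C) (hu : IntegrableOn u (Ioc 0 y)) : ConvAt k u y := by
  refine Integrable.mono' (hu.norm.const_mul C) ?_ ?_
  · exact (Measurable.aestronglyMeasurable (by fun_prop)).mul hu.aestronglyMeasurable
  · have : ∀ᵐ t : ℝ, t ≠ y := by simp [ae_iff]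
    filter_upwards [ae_restrict_mem measurableSet_Ioc, ae_restrict_of_ae this] with t ht hty
    have hlt : t < y := lt_of_le_of_ne ht.2 hty
    rw [norm_mul]
    gcongr
    exact hk _ ⟨by linarith, by linarith [ht.1]⟩

/-- Convergence for a kernel and a function with integrable power bounds. -/
theorem ConvAt.of_rpow {k u : ℝ → ℂ} {y a C δ D : ℝ} (ha : 0 < a) (hδ : δ < 1)
    (hkm : Measurable k) (hk : ∀ t ∈ Ioc 0 y, ‖k t‖ ≤ C * t ^ (a - 1))
    (hum : AEStronglyMeasurable u (volume.restrict (Ioc 0 y)))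
    (hu : ∀ t ∈ Ioc 0 y, ‖u t‖ ≤ D * t ^ (-δ)) : ConvAt k u y := by
  have h := integrableOn_beta (s := 0) (y := y) ha (sub_pos.2 hδ)
  refine Integrable.mono' (h.const_mul (C * D)) ?_ ?_
  · exact (Measurable.aestronglyMeasurable (by fun_prop)).mul hum
  · have : ∀ᵐ t : ℝ, t ≠ y := by simp [ae_iff]
    filter_upwards [ae_restrict_mem measurableSet_Ioc, ae_restrict_of_ae this] with t ht hty
    have hlt : t < y := lt_of_le_of_ne ht.2 hty
    have h1 := hk (y - t) ⟨by linarith, by linarith [ht.1]⟩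
    rw [norm_mul, sub_zero, sub_sub_cancel_left]
    calc ‖k (y - t)‖ * ‖u t‖ ≤ (C * (y - t) ^ (a - 1)) * (D * t ^ (-δ)) := by
          gcongr
          · exact (norm_nonneg _).trans h1
          · exact hu t ht
      _ = _ := by ring

/-! ### Continuity -/

/-- A continuous kernel vanishing at `0` turns locally integrable functions into continuous ones. -/
theorem continuousOn_causalConv {k u : ℝ → ℂ} (hk : ContinuousOn k (Ici 0)) (hk0 : k 0 = 0)
    (hu : ∀ Y, 0 < Y → IntegrableOn u (Ioc 0 Y)) : ContinuousOn (causalConv k u) (Ioi 0) := by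
  set K : ℝ → ℂ := fun t => k (max t 0) with hK
  have hKc : Continuous K := hk.comp_continuous (by fun_prop) (fun t => mem_Ici.2 (le_max_right t 0))
  intro y₀ hy₀
  set Y := y₀ + 1 with hY
  have hY0 : 0 < Y := by have : 0 < y₀ := hy₀; linarith
  have key : ∀ y ∈ Ioo 0 Y, causalConv k u y = ∫ t in Ioc 0 Y, K (y - t) * u t := by
    intro y hy
    unfold causalConv
    have h1 : ∫ t in Ioc 0 y, k (y - t) * u t = ∫ t in Ioc 0 y, K (y - t) * u t := by
      apply setIntegral_congr_fun measurableSet_Ioc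
      intro t ht
      simp only [hK]
      rw [max_eq_left (by linarith [ht.2])]
    rw [h1]
    symm
    apply setIntegral_eq_of_subset_of_forall_sdiff_eq_zero measurableSet_Ioc
    · exact fun t ht => ⟨ht.1, ht.2.trans hy.2.le⟩
    · intro t ht
      have : y < t := by
        by_contra h
        exact ht.2 ⟨ht.1.1, not_lt.1 h⟩
      simp only [hK]
      rw [max_eq_right (by linarith), hk0, zero_mul]
  obtain ⟨C, hC⟩ := (isCompact_Icc (a := -Y) (b := Y)).exists_bound_of_continuousOn
    hKc.continuousOn
  have hcont : ContinuousOn (fun y => ∫ t in Ioc 0 Y, K (y - t) * u t) (Ioo 0 Y) := by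
    apply continuousOn_of_dominated (bound := fun t => C * ‖u t‖)
    · intro y hy
      exact (Continuous.aestronglyMeasurable (by fun_prop)).mul (hu Y hY0).aestronglyMeasurable
    · intro y hy
      filter_upwards [ae_restrict_mem measurableSet_Ioc] with t ht
      rw [norm_mul]
      gcongr
      exact hC _ ⟨by linarith [hy.1, ht.2], by linarith [hy.2, ht.1]⟩
    · exact (hu Y hY0).norm.const_mul C
    · refine Eventually.of_forall fun t => Continuous.continuousOn (by fun_prop)
  have hn : Ioo 0 Y ∈ 𝓝 y₀ := Ioo_mem_nhds hy₀ (by linarith)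
  refine ContinuousAt.continuousWithinAt ((hcont.continuousAt hn).congr ?_)
  filter_upwards [hn] with y hy
  exact (key y hy).symm

theorem continuous_powKer {a : ℝ} (ha : 1 ≤ a) : Continuous (powKer a) := by
  unfold powKer
  have : Continuous fun t : ℝ => t ^ (a - 1) := Real.continuous_rpow_const (by linarith)
  fun_prop

theorem powKer_zero {a : ℝ} (ha : 1 < a) : powKer a 0 = 0 := by
  simp [powKer, Real.zero_rpow (by linarith : a - 1 ≠ 0)]

theorem continuousOn_rlIntegral {a : ℝ} (ha : 1 < a) {u : ℝ → ℂ}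
    (hu : ∀ Y, 0 < Y → IntegrableOn u (Ioc 0 Y)) : ContinuousOn (rlIntegral a u) (Ioi 0) :=
  (continuousOn_causalConv (continuous_powKer ha.le).continuousOn (powKer_zero ha) hu).congr
    fun y hy => rlIntegral_eq_causalConv (by linarith) u (le_of_lt hy)

theorem rlIntegral_one (u : ℝ → ℂ) (y : ℝ) : rlIntegral 1 u y = ∫ t in (0 : ℝ)..y, u t := by
  simp [rlIntegral]

/-! ### Parameters -/

/-- Fubini for a fractional integral and an integral over a parameter. -/
theorem integral_rlIntegral {H : ℝ → ℝ → ℂ} {ρ y : ℝ} (hρ : 0 < ρ) (hy : 0 < y)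
    (hH : IntegrableOn (fun p : ℝ × ℝ => H p.1 p.2) (univ ×ˢ Ioo 0 y))
    (hc : IntegrableOn (fun t => (y - t) ^ (ρ - 1) * ∫ x, ‖H x t‖) (Ioo 0 y)) :
    Integrable (fun x => rlIntegral ρ (H x) y) ∧
      ∫ x, rlIntegral ρ (H x) y = rlIntegral ρ (fun t => ∫ x, H x t) y := by
  set m := volume.restrict (Ioo (0 : ℝ) y) with hm
  have hmm : (volume : Measure (ℝ × ℝ)).restrict (univ ×ˢ Ioo 0 y) = volume.prod m := by
    rw [Measure.volume_eq_prod, ← Measure.prod_restrict, Measure.restrict_univ]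
  rw [IntegrableOn, hmm] at hH
  have hF : Integrable (Function.uncurry fun x t => powKer ρ (y - t) * H x t)
      (volume.prod m) := by
    rw [integrable_prod_iff']
    · constructor
      · filter_upwards [hH.prod_left_ae] with t ht
        change Integrable (fun x => powKer ρ (y - t) * H x t)
        exact ht.const_mul _
      · refine (hc.const_mul (Real.Gamma ρ)⁻¹).congr ?_
        filter_upwards [ae_restrict_mem measurableSet_Ioo] with t ht
        simp only [Function.uncurry, norm_mul]
        rw [integral_const_mul, norm_powKer hρ (by linarith [ht.2])]
        ring
    · refine AEStronglyMeasurable.mul ?_ hH.aestronglyMeasurable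
      have := measurable_powKer ρ
      exact Measurable.aestronglyMeasurable (by fun_prop)
  have e1 : ∀ x, rlIntegral ρ (H x) y = ∫ t, powKer ρ (y - t) * H x t ∂m := fun x => by
    rw [rlIntegral_eq_causalConv hρ _ hy.le, causalConv, integral_Ioc_eq_integral_Ioo]
  simp_rw [e1]
  refine ⟨hF.integral_prod_left, ?_⟩
  rw [integral_integral_swap hF, rlIntegral_eq_causalConv hρ _ hy.le, causalConv,
    integral_Ioc_eq_integral_Ioo]
  simp_rw [integral_const_mul]
  rfl

/-- For order at least `1` the kernel is bounded and Fubini applies at every point. -/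
theorem integral_rlIntegral_of_one_le {H : ℝ → ℝ → ℂ} {ρ y : ℝ} (hρ : 1 ≤ ρ) (hy : 0 < y)
    (hH : IntegrableOn (fun p : ℝ × ℝ => H p.1 p.2) (univ ×ˢ Ioo 0 y)) :
    Integrable (fun x => rlIntegral ρ (H x) y) ∧
      ∫ x, rlIntegral ρ (H x) y = rlIntegral ρ (fun t => ∫ x, H x t) y := by
  refine integral_rlIntegral (by linarith) hy hH ?_
  have hmm : (volume : Measure (ℝ × ℝ)).restrict (univ ×ˢ Ioo 0 y) =
      volume.prod (volume.restrict (Ioo (0 : ℝ) y)) := by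
    rw [Measure.volume_eq_prod, ← Measure.prod_restrict, Measure.restrict_univ]
  rw [IntegrableOn, hmm] at hH
  have h := (hH.norm.integral_prod_right)
  have h2 := integrableOn_rpow_mul (y := y) (sub_nonneg.2 hρ)
    (u := fun t => ((∫ x, ‖H x t‖ : ℝ) : ℂ)) (by
      rw [integrableOn_Ioc_iff_integrableOn_Ioo]; exact h.ofReal)
  rw [integrableOn_Ioc_iff_integrableOn_Ioo] at h2
  refine h2.congr (Eventually.of_forall fun t => ?_)
  simp only [Complex.norm_real]
  rw [Real.norm_of_nonneg (integral_nonneg fun _ => norm_nonneg _)]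

/-- For an arbitrary order Fubini applies at almost every point, since convolutions of integrable
functions exist almost everywhere. -/
theorem integral_rlIntegral_ae {H : ℝ → ℝ → ℂ} {ρ : ℝ} (hρ : 0 ≤ ρ)
    (hH : ∀ Y, 0 < Y → IntegrableOn (fun p : ℝ × ℝ => H p.1 p.2) (univ ×ˢ Ioo 0 Y)) :
    ∀ᵐ y, 0 < y → Integrable (fun x => rlIntegral ρ (H x) y) ∧
      ∫ x, rlIntegral ρ (H x) y = rlIntegral ρ (fun t => ∫ x, H x t) y := by
  have hmm : ∀ y : ℝ, (volume : Measure (ℝ × ℝ)).restrict (univ ×ˢ Ioo 0 y) =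
      volume.prod (volume.restrict (Ioo (0 : ℝ) y)) := fun y => by
    rw [Measure.volume_eq_prod, ← Measure.prod_restrict, Measure.restrict_univ]
  have hall : ∀ n : ℕ, ∀ᵐ y : ℝ, 0 < y → y < n + 1 → Integrable (fun x => rlIntegral ρ (H x) y) ∧
      ∫ x, rlIntegral ρ (H x) y = rlIntegral ρ (fun t => ∫ x, H x t) y := by
    intro n
    have hY : (0 : ℝ) < n + 1 := by positivity
    have hHY := hH _ hY
    rw [IntegrableOn, hmm] at hHY
    rcases hρ.eq_or_lt with rfl | hρ
    · have h := hHY.prod_left_ae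
      rw [ae_restrict_iff' measurableSet_Ioo] at h
      filter_upwards [h] with y hy h0 h1
      simp only [rlIntegral_zero]
      exact ⟨hy ⟨h0, h1⟩, trivial⟩
    set A : ℝ → ℝ := indicator (Ioo 0 ((n : ℝ) + 1)) (fun t => ∫ x, ‖H x t‖) with hA
    set B : ℝ → ℝ := indicator (Ioo 0 ((n : ℝ) + 1)) (fun t => t ^ (ρ - 1)) with hB
    have hAi : Integrable A := by
      rw [hA, integrable_indicator_iff measurableSet_Ioo]
      exact hHY.norm.integral_prod_right
    have hBi : Integrable B := by
      rw [hB, integrable_indicator_iff measurableSet_Ioo, ← intervalIntegrable_iff_integrableOn_Ioo_of_le hY.le]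
      exact intervalIntegral.intervalIntegrable_rpow' (by linarith)
    have hex := hAi.ae_convolution_exists (ContinuousLinearMap.mul ℝ ℝ) hBi
    filter_upwards [hex] with y hy h0 h1
    refine integral_rlIntegral hρ h0 ((hH _ hY).mono_set ?_) ?_
    · exact prod_mono le_rfl (Ioo_subset_Ioo_right h1.le)
    · have h2 : IntegrableOn (fun t => A t * B (y - t)) (Ioo 0 y) := Integrable.integrableOn hy
      refine h2.congr_fun ?_ measurableSet_Ioo
      intro t ht
      simp only [hA, hB]
      rw [indicator_of_mem (show t ∈ Ioo 0 ((n : ℝ) + 1) from ⟨ht.1, ht.2.trans h1⟩),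
        indicator_of_mem (show y - t ∈ Ioo 0 ((n : ℝ) + 1) from
          ⟨by linarith [ht.2], by linarith [ht.1]⟩), mul_comm]
  rw [← ae_all_iff] at hall
  filter_upwards [hall] with y hy h0
  obtain ⟨n, hn⟩ := exists_nat_gt y
  exact hy n h0 (by linarith)

/-! ### Mittag-Leffler functions -/

/-- The lower bound comes from the part of Euler's integral over `(A, ∞)`. -/
theorem rpow_mul_exp_neg_le_Gamma {A s : ℝ} (hA : 0 < A) (hs : 1 ≤ s) :
    A ^ (s - 1) * Real.exp (-A) ≤ Real.Gamma s := by
  rw [Real.Gamma_eq_integral (by linarith), ← integral_exp_neg_Ioi A, ← integral_const_mul]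
  have hi := Real.GammaIntegral_convergent (s := s) (by linarith)
  calc ∫ x in Ioi A, A ^ (s - 1) * Real.exp (-x)
      ≤ ∫ x in Ioi A, Real.exp (-x) * x ^ (s - 1) := by
        apply setIntegral_mono_on
        · exact (integrableOn_exp_neg_Ioi A).const_mul _
        · exact hi.mono_set (Ioi_subset_Ioi hA.le)
        · exact measurableSet_Ioi
        · intro x hx
          rw [mul_comm]
          gcongr
          exact le_of_lt hx
    _ ≤ ∫ x in Ioi 0, Real.exp (-x) * x ^ (s - 1) := by
        apply setIntegral_mono_set hi
        · filter_upwards [ae_restrict_mem measurableSet_Ioi] with x hx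
          have : (0 : ℝ) < x := hx
          simp only [Pi.zero_apply]
          positivity
        · exact (Ioi_subset_Ioi hA.le).eventuallyLE

/-- Geometric majorant of the Mittag-Leffler series, from the bound of `Γ` with `A = 2 (1 + r)`. -/
theorem norm_mittagLeffler_term_le {μ b r : ℝ} (hμ : 1 ≤ μ) (hb : 0 < b) (hr : 0 ≤ r) {z : ℂ}
    (hz : ‖z‖ ≤ r ^ μ) (n : ℕ) :
    ‖z ^ n / (Real.Gamma (μ * n + b) : ℂ)‖ ≤
      (1 + (Real.Gamma b)⁻¹) * Real.exp (4 + 4 * r) * (1 / 2) ^ n := by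
  have hΓb := Real.Gamma_pos_of_pos hb
  rcases Nat.eq_zero_or_pos n with rfl | hn
  · simp only [pow_zero, CharP.cast_eq_zero, mul_zero, zero_add, mul_one, one_div, norm_inv]
    rw [Complex.norm_real, Real.norm_of_nonneg hΓb.le]
    calc (Real.Gamma b)⁻¹ = (Real.Gamma b)⁻¹ * 1 := by ring
      _ ≤ (1 + (Real.Gamma b)⁻¹) * Real.exp (4 + 4 * r) := by
        gcongr
        · linarith
        · exact Real.one_le_exp (by positivity)
  have hn1 : (1 : ℝ) ≤ n := by exact_mod_cast hn
  have hμn : (n : ℝ) ≤ μ * n := by nlinarith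
  set A := 2 * (1 + r) with hA
  have hA2 : 2 ≤ A := by linarith
  have hA0 : 0 < A := by linarith
  have hs : 1 ≤ μ * n + b := by linarith
  have hΓ := rpow_mul_exp_neg_le_Gamma hA0 hs
  have hΓ0 : 0 < Real.Gamma (μ * n + b) := Real.Gamma_pos_of_pos (by linarith)
  rw [norm_div, norm_pow, Complex.norm_real, Real.norm_of_nonneg hΓ0.le, div_le_iff₀ hΓ0]
  have h1 : ‖z‖ ^ n ≤ (A / 2) ^ (μ * n) := by
    calc ‖z‖ ^ n ≤ (r ^ μ) ^ n := by gcongr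
      _ = r ^ (μ * n) := by rw [← Real.rpow_natCast, ← Real.rpow_mul hr]
      _ ≤ _ := by
        apply Real.rpow_le_rpow hr (by rw [hA]; linarith) (by positivity)
  have h2 : (A / 2) ^ (μ * n) ≤ A ^ (μ * n) * (1 / 2) ^ n := by
    rw [div_eq_mul_one_div, Real.mul_rpow hA0.le (by norm_num)]
    gcongr
    rw [← Real.rpow_natCast]
    exact Real.rpow_le_rpow_of_exponent_ge (by norm_num) (by norm_num) hμn
  have h3 : A ^ (μ * n) ≤ A ^ (μ * n + b - 1) * A := by
    rw [← Real.rpow_add_one hA0.ne']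
    exact Real.rpow_le_rpow_of_exponent_le (by linarith) (by linarith)
  have h4 : A ≤ Real.exp A := by linarith [Real.add_one_le_exp A]
  have h5 : Real.exp (4 + 4 * r) = Real.exp A * Real.exp A := by
    rw [← Real.exp_add]; congr 1; rw [hA]; ring
  calc ‖z‖ ^ n ≤ A ^ (μ * n + b - 1) * A * (1 / 2) ^ n := by
        refine h1.trans (h2.trans ?_); gcongr
    _ ≤ A ^ (μ * n + b - 1) * Real.exp A * (1 / 2) ^ n := by gcongr
    _ = 1 * (Real.exp A * Real.exp A) * (1 / 2) ^ n * (A ^ (μ * n + b - 1) * Real.exp (-A)) := by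
        rw [Real.exp_neg]; field_simp
    _ ≤ (1 + (Real.Gamma b)⁻¹) * Real.exp (4 + 4 * r) * (1 / 2) ^ n * Real.Gamma (μ * n + b) := by
        rw [h5]
        gcongr
        linarith [inv_pos.2 hΓb]

theorem exists_norm_le_rpow {μ : ℝ} (hμ : 1 ≤ μ) (z : ℂ) : ∃ r : ℝ, 0 ≤ r ∧ ‖z‖ ≤ r ^ μ :=
  ⟨‖z‖ ^ μ⁻¹, by positivity, by
    rw [← Real.rpow_mul (norm_nonneg _), inv_mul_cancel₀ (by positivity), Real.rpow_one]⟩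

theorem summable_mittagLeffler {μ b : ℝ} (hμ : 1 ≤ μ) (hb : 0 < b) (z : ℂ) :
    Summable (fun n : ℕ => ‖z ^ n / (Real.Gamma (μ * n + b) : ℂ)‖) := by
  obtain ⟨r, hr, hz⟩ := exists_norm_le_rpow hμ z
  exact Summable.of_nonneg_of_le (fun _ => norm_nonneg _)
    (norm_mittagLeffler_term_le hμ hb hr hz) (summable_geometric_two.mul_left _)

theorem norm_mittagLeffler_le {μ b r : ℝ} (hμ : 1 ≤ μ) (hb : 0 < b) (hr : 0 ≤ r) {z : ℂ}
    (hz : ‖z‖ ≤ r ^ μ) :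
    ‖mittagLeffler μ b z‖ ≤ (1 + (Real.Gamma b)⁻¹) * 2 * Real.exp (4 + 4 * r) := by
  calc ‖mittagLeffler μ b z‖ ≤ ∑' n : ℕ, (1 + (Real.Gamma b)⁻¹) * Real.exp (4 + 4 * r) * (1 / 2) ^ n :=
        tsum_of_norm_bounded (summable_geometric_two.mul_left _).hasSum
          (norm_mittagLeffler_term_le hμ hb hr hz)
    _ = _ := by rw [tsum_mul_left, tsum_geometric_two]; ring

theorem continuous_mittagLeffler {μ b : ℝ} (hμ : 1 ≤ μ) (hb : 0 < b) :
    Continuous (mittagLeffler μ b) := by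
  rw [continuous_iff_continuousAt]
  intro z₀
  set R := ‖z₀‖ + 1
  have hR : 0 ≤ R := by positivity
  have h : ContinuousOn (mittagLeffler μ b) (Metric.ball 0 R) := by
    apply continuousOn_tsum (u := fun n => (1 + (Real.Gamma b)⁻¹) * Real.exp (4 + 4 * R ^ μ⁻¹) *
      (1 / 2) ^ n)
    · intro n; fun_prop
    · exact summable_geometric_two.mul_left _
    · intro n z hz
      apply norm_mittagLeffler_term_le hμ hb (by positivity)
      rw [← Real.rpow_mul hR, inv_mul_cancel₀ (by positivity), Real.rpow_one]
      simpa using (mem_ball_zero_iff.1 hz).le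
  exact h.continuousAt (Metric.isOpen_ball.mem_nhds (by simp [R]))

theorem prabhakarML_one (a b : ℝ) (z : ℂ) : prabhakarML a b 1 z = mittagLeffler a b z := by
  unfold prabhakarML mittagLeffler
  congr 1; ext n
  rw [ascPochhammer_eval_one]
  have : (n.factorial : ℂ) ≠ 0 := by exact_mod_cast n.factorial_ne_zero
  push_cast
  field_simp

/-! ### Mittag-Leffler kernels -/

/-- The kernel `t^{b-1} E_{μ,b}(ω t^μ)`. -/
noncomputable def mlKer (μ b : ℝ) (ω : ℂ) (t : ℝ) : ℂ :=
  ((t ^ (b - 1) : ℝ) : ℂ) * mittagLeffler μ b (ω * ((t ^ μ : ℝ) : ℂ))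

theorem mlKer_term {μ b t : ℝ} (ω : ℂ) (ht : 0 < t) (n : ℕ) :
    ((t ^ (b - 1) : ℝ) : ℂ) * ((ω * ((t ^ μ : ℝ) : ℂ)) ^ n / (Real.Gamma (μ * n + b) : ℂ)) =
      ω ^ n * powKer (μ * n + b) t := by
  unfold powKer
  rw [show μ * n + b - 1 = (b - 1) + μ * n by ring, Real.rpow_add ht, Real.rpow_mul ht.le,
    Real.rpow_natCast]
  push_cast
  ring

theorem hasSum_mlKer {μ b t : ℝ} (hμ : 1 ≤ μ) (hb : 0 < b) (ω : ℂ) (ht : 0 < t) :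
    HasSum (fun n : ℕ => ω ^ n * powKer (μ * n + b) t) (mlKer μ b ω t) := by
  have h := (summable_mittagLeffler hμ hb (ω * ((t ^ μ : ℝ) : ℂ))).of_norm.hasSum
  have h2 := h.mul_left ((t ^ (b - 1) : ℝ) : ℂ)
  simp_rw [mlKer_term ω ht] at h2
  exact h2

theorem summable_norm_mlKer {μ b t : ℝ} (hμ : 1 ≤ μ) (hb : 0 < b) (ω : ℂ) (ht : 0 < t) :
    Summable (fun n : ℕ => ‖ω ^ n * powKer (μ * n + b) t‖) := by
  have h := (summable_mittagLeffler hμ hb (ω * ((t ^ μ : ℝ) : ℂ))).mul_left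
    ‖((t ^ (b - 1) : ℝ) : ℂ)‖
  simp_rw [← norm_mul, mlKer_term ω ht] at h
  exact h

/-- The recursion `E_{μ,b}(z) = 1/Γ(b) + z E_{μ,b+μ}(z)` for kernels. -/
theorem mlKer_eq_powKer_add {μ b t : ℝ} (hμ : 1 ≤ μ) (hb : 0 < b) (ω : ℂ) (ht : 0 < t) :
    mlKer μ b ω t = powKer b t + ω * mlKer μ (b + μ) ω t := by
  have h1 := hasSum_mlKer hμ hb ω ht
  have h2 := (hasSum_mlKer hμ (by linarith : 0 < b + μ) ω ht).mul_left ω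
  rw [← hasSum_nat_add_iff' 1] at h1
  simp only [Finset.range_one, Finset.sum_singleton, pow_zero, CharP.cast_eq_zero, mul_zero,
    zero_add, one_mul] at h1
  have h3 : (fun n : ℕ => ω ^ (n + 1) * powKer (μ * ((n + 1 : ℕ) : ℝ) + b) t) =
      fun n : ℕ => ω * (ω ^ n * powKer (μ * n + (b + μ)) t) := by
    ext n
    rw [show μ * ((n + 1 : ℕ) : ℝ) + b = μ * n + (b + μ) by push_cast; ring]
    ring
  rw [h3] at h1
  have := h1.unique h2
  linear_combination this

theorem norm_mlKer_le {μ b r Y : ℝ} (hμ : 1 ≤ μ) (hb : 0 < b) (hr : 0 ≤ r) {ω : ℂ}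
    (hω : ‖ω‖ ≤ r ^ μ) : ∀ t ∈ Ioc 0 Y, ‖mlKer μ b ω t‖ ≤
      (1 + (Real.Gamma b)⁻¹) * 2 * Real.exp (4 + 4 * (r * Y)) * t ^ (b - 1) := by
  intro t ht
  have h0 : 0 < t := ht.1
  have h := norm_mittagLeffler_le hμ hb (by positivity : 0 ≤ r * t)
    (z := ω * ((t ^ μ : ℝ) : ℂ)) (by
      rw [norm_mul, Complex.norm_real, Real.norm_of_nonneg (by positivity), Real.mul_rpow hr h0.le]
      gcongr)
  rw [mlKer, norm_mul, Complex.norm_real, Real.norm_of_nonneg (by positivity), mul_comm]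
  have := Real.Gamma_pos_of_pos hb
  gcongr
  refine h.trans ?_
  gcongr
  exact ht.2

theorem measurable_mlKer {μ b : ℝ} (hμ : 1 ≤ μ) (hb : 0 < b) {X : Type*} [MeasurableSpace X]
    {ω : X → ℂ} {t : X → ℝ} (hω : Measurable ω) (ht : Measurable t) :
    Measurable (fun x => mlKer μ b (ω x) (t x)) := by
  unfold mlKer
  have := (continuous_mittagLeffler hμ hb).measurable
  fun_prop

theorem measurable_mlKer_const {μ b : ℝ} (hμ : 1 ≤ μ) (hb : 0 < b) (ω : ℂ) :
    Measurable (mlKer μ b ω) :=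
  measurable_mlKer hμ hb measurable_const measurable_id

theorem continuousOn_mlKer {μ b : ℝ} (hμ : 1 ≤ μ) (hb : 0 < b) (ω : ℂ) :
    ContinuousOn (mlKer μ b ω) (Ioi 0) := by
  intro t ht
  have h0 : t ≠ 0 := ne_of_gt ht
  apply ContinuousAt.continuousWithinAt
  unfold mlKer
  have h1 : ContinuousAt (fun t : ℝ => t ^ (b - 1)) t := Real.continuousAt_rpow_const _ _ (Or.inl h0)
  have h2 : ContinuousAt (fun t : ℝ => t ^ μ) t := Real.continuousAt_rpow_const _ _ (Or.inl h0)
  exact (Complex.continuous_ofReal.continuousAt.comp h1).mul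
    ((continuous_mittagLeffler hμ hb).continuousAt.comp
      (continuousAt_const.mul (Complex.continuous_ofReal.continuousAt.comp h2)))

theorem continuous_mlKer {μ b : ℝ} (hμ : 1 ≤ μ) (hb : 1 ≤ b) (ω : ℂ) :
    Continuous (mlKer μ b ω) := by
  unfold mlKer
  have h1 : Continuous fun t : ℝ => t ^ (b - 1) := Real.continuous_rpow_const (by linarith)
  have h2 : Continuous fun t : ℝ => t ^ μ := Real.continuous_rpow_const (by linarith)
  have := continuous_mittagLeffler hμ (by linarith : 0 < b)
  fun_prop

theorem mlKer_zero {μ b : ℝ} (hb : 1 < b) (ω : ℂ) : mlKer μ b ω 0 = 0 := by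
  simp [mlKer, Real.zero_rpow (by linarith : b - 1 ≠ 0)]

/-- Termwise fractional integration of a Mittag-Leffler kernel. -/
theorem powKer_conv_mlKer {μ a b y : ℝ} (hμ : 1 ≤ μ) (ha : 0 < a) (hb : 0 < b) (hy : 0 < y)
    (ω : ℂ) : causalConv (powKer a) (mlKer μ b ω) y = mlKer μ (a + b) ω y := by
  set F : ℕ → ℝ → ℂ := fun n t => powKer a (y - t) * (ω ^ n * powKer (μ * n + b) t) with hF
  have hc : ∀ n : ℕ, 0 < μ * n + b := fun n => by positivity
  have hFi : ∀ n, IntegrableOn (F n) (Ioc 0 y) := fun n =>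
    (ConvAt.of_rpow ha (sub_lt_self _ (hc n)) (measurable_powKer a)
      (norm_powKer_le ha) (measurable_powKer _).aestronglyMeasurable (D := (Real.Gamma (μ * n + b))⁻¹)
      (fun t ht => by
        rw [neg_sub]; exact norm_powKer_le (hc n) t ht)).const_mul (ω ^ n)
  have hFv : ∀ n, ∫ t in Ioc 0 y, F n t = ω ^ n * powKer (μ * n + (a + b)) y := fun n => by
    have := causalConv_const_mul_right (powKer a) (powKer (μ * n + b)) (ω ^ n) y
    rw [powKer_conv_powKer ha (hc n) hy, show a + (μ * n + b) = μ * n + (a + b) by ring] at this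
    exact this
  have hFn : ∀ n, ∫ t in Ioc 0 y, ‖F n t‖ = ‖ω ^ n * powKer (μ * n + (a + b)) y‖ := fun n => by
    have h1 : ∀ t ∈ Ioc 0 y, ‖F n t‖ = ‖ω ^ n‖ *
        ((y - t) ^ (a - 1) / Real.Gamma a * (t ^ (μ * n + b - 1) / Real.Gamma (μ * n + b))) := by
      intro t ht
      simp only [hF]
      rw [norm_mul, norm_mul, norm_powKer ha (sub_nonneg.2 ht.2), norm_powKer (hc n) ht.1.le]
      ring
    have h2 := powKer_conv_powKer ha (hc n) hy
    unfold causalConv powKer at h2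
    simp_rw [← Complex.ofReal_mul] at h2
    rw [integral_complex_ofReal, Complex.ofReal_inj,
      show a + (μ * n + b) = μ * n + (a + b) by ring] at h2
    rw [setIntegral_congr_fun measurableSet_Ioc h1, integral_const_mul, h2, norm_mul,
      norm_powKer (by positivity) hy.le]
    ring
  have h := hasSum_integral_of_summable_integral_norm hFi (by
    simp_rw [hFn]; exact summable_norm_mlKer hμ (by positivity) ω hy)
  simp_rw [hFv] at h
  rw [(hasSum_mlKer hμ (by positivity) ω hy).unique h]
  unfold causalConv
  apply setIntegral_congr_fun measurableSet_Ioc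
  intro t ht
  simp only [hF]
  rw [tsum_mul_left, (hasSum_mlKer hμ hb ω ht.1).tsum_eq]

/-! ### The symbol -/

theorem norm_psi (α θ κ : ℝ) : ‖psi α θ κ‖ = |κ| ^ α := by
  rw [psi, norm_mul, mul_comm Complex.I, Complex.norm_exp_ofReal_mul_I, mul_one, Complex.norm_real,
    Real.norm_of_nonneg (by positivity)]

theorem measurable_psi (α θ : ℝ) : Measurable (psi α θ) := by
  have : Measurable Real.sign := by
    unfold Real.sign
    exact Measurable.ite measurableSet_Iio measurable_const
      (Measurable.ite measurableSet_Ioi measurable_const measurable_const)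
  unfold psi
  fun_prop

theorem norm_psi_sub_le {α μ : ℝ} (hμ : 1 ≤ μ) (θ k κ : ℝ) :
    ‖psi α θ κ - (k : ℂ) ^ 2‖ ≤ (|κ| ^ (α / μ) + |k| ^ (2 / μ)) ^ μ := by
  have hμ0 : μ ≠ 0 := by positivity
  calc ‖psi α θ κ - (k : ℂ) ^ 2‖ ≤ ‖psi α θ κ‖ + ‖(k : ℂ) ^ 2‖ := norm_sub_le _ _
    _ = (|κ| ^ (α / μ)) ^ μ + (|k| ^ (2 / μ)) ^ μ := by
      rw [norm_psi, ← Real.rpow_mul (abs_nonneg _), ← Real.rpow_mul (abs_nonneg _),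
        div_mul_cancel₀ _ hμ0, div_mul_cancel₀ _ hμ0]
      simp
    _ ≤ _ := Real.add_rpow_le_rpow_add (by positivity) (by positivity) hμ

/-! ### Fourier transforms of functions -/

theorem fourierT_eq_fourierInv (f : ℝ → ℂ) (κ : ℝ) :
    fourierT f κ = 𝓕⁻ f (κ / (2 * Real.pi)) := by
  rw [Real.fourierInv_eq', fourierT]
  congr 1; ext x
  rw [smul_eq_mul, mul_comm]
  congr 2
  have : (Real.pi : ℂ) ≠ 0 := by exact_mod_cast Real.pi_ne_zero
  simp only [RCLike.inner_apply, conj_trivial]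
  push_cast
  field_simp

theorem invFourierT_eq_fourier (h : ℝ → ℂ) (x : ℝ) :
    invFourierT h x = (1 / (2 * (Real.pi : ℂ))) * 𝓕 h (x / (2 * Real.pi)) := by
  rw [Real.fourier_real_eq_integral_exp_smul, invFourierT]
  congr 2; ext κ
  rw [smul_eq_mul, mul_comm]
  congr 2
  have : (Real.pi : ℂ) ≠ 0 := by exact_mod_cast Real.pi_ne_zero
  push_cast
  field_simp

theorem invFourierT_eq_fourierT_neg (h : ℝ → ℂ) (x : ℝ) :
    invFourierT h x = (1 / (2 * (Real.pi : ℂ))) * fourierT h (-x) := by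
  unfold invFourierT fourierT
  congr 2; ext κ; congr 2; push_cast; ring

theorem norm_exp_I_mul (r : ℝ) : ‖Complex.exp (Complex.I * (r : ℂ))‖ = 1 := by
  rw [mul_comm, Complex.norm_exp_ofReal_mul_I]

theorem norm_exp_neg_I_mul (r : ℝ) : ‖Complex.exp (-Complex.I * (r : ℂ))‖ = 1 := by
  have := norm_exp_I_mul (-r)
  push_cast at this
  rwa [mul_neg, ← neg_mul] at this

theorem norm_fourierT_le (f : ℝ → ℂ) (κ : ℝ) : ‖fourierT f κ‖ ≤ ∫ x, ‖f x‖ := by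
  refine (norm_integral_le_integral_norm _).trans (le_of_eq ?_)
  simp_rw [norm_mul, norm_exp_I_mul, mul_one]

theorem norm_invFourierT_le (h : ℝ → ℂ) (x : ℝ) :
    ‖invFourierT h x‖ ≤ (1 / (2 * Real.pi)) * ∫ κ, ‖h κ‖ := by
  rw [invFourierT_eq_fourierT_neg, norm_mul]
  have : ‖(1 / (2 * (Real.pi : ℂ)))‖ = 1 / (2 * Real.pi) := by
    simp [abs_of_pos Real.pi_pos]
  rw [this]
  gcongr
  exact norm_fourierT_le _ _

theorem continuous_fourierT {f : ℝ → ℂ} (hf : Integrable f) : Continuous (fourierT f) := by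
  unfold fourierT
  apply continuous_of_dominated (bound := fun x => ‖f x‖)
  · intro κ
    exact hf.aestronglyMeasurable.mul (Continuous.aestronglyMeasurable (by fun_prop))
  · intro κ
    refine Eventually.of_forall fun x => ?_
    rw [norm_mul, norm_exp_I_mul, mul_one]
  · exact hf.norm
  · exact Eventually.of_forall fun x => by fun_prop

theorem continuous_invFourierT {h : ℝ → ℂ} (hh : Integrable h) : Continuous (invFourierT h) := by
  have := continuous_fourierT hh
  simp_rw [funext (invFourierT_eq_fourierT_neg h)]
  fun_prop

theorem fourierT_congr_ae {f g : ℝ → ℂ} (h : f =ᵐ[volume] g) : fourierT f = fourierT g := by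
  ext κ
  exact integral_congr_ae (by filter_upwards [h] with x hx; rw [hx])

theorem invFourierT_congr_ae {f g : ℝ → ℂ} (h : f =ᵐ[volume] g) :
    invFourierT f = invFourierT g := by
  ext κ
  unfold invFourierT
  congr 1
  exact integral_congr_ae (by filter_upwards [h] with x hx; rw [hx])

theorem integrable_mul_exp {h : ℝ → ℂ} (hh : Integrable h) (x : ℝ) :
    Integrable (fun κ : ℝ => h κ * Complex.exp (-Complex.I * ((κ * x : ℝ) : ℂ))) :=
  hh.mul_bdd (c := 1) (Continuous.aestronglyMeasurable (by fun_prop))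
    (Eventually.of_forall fun κ => (norm_exp_neg_I_mul _).le)

theorem invFourierT_add {g h : ℝ → ℂ} (hg : Integrable g) (hh : Integrable h) (x : ℝ) :
    invFourierT (fun κ => g κ + h κ) x = invFourierT g x + invFourierT h x := by
  unfold invFourierT
  simp_rw [add_mul]
  rw [integral_add (integrable_mul_exp hg x) (integrable_mul_exp hh x), mul_add]

theorem invFourierT_const_mul (c : ℂ) (h : ℝ → ℂ) (x : ℝ) :
    invFourierT (fun κ => c * h κ) x = c * invFourierT h x := by
  unfold invFourierT
  simp_rw [mul_assoc c]
  rw [integral_const_mul]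
  ring

/-- Riemann–Lebesgue. -/
theorem tendsto_invFourierT (h : ℝ → ℂ) : Tendsto (invFourierT h) (cocompact ℝ) (𝓝 0) := by
  have h1 : Tendsto (fun x : ℝ => x / (2 * Real.pi)) (cocompact ℝ) (cocompact ℝ) :=
    (Homeomorph.mulRight₀ (2 * Real.pi)⁻¹ (by positivity)).isClosedEmbedding.tendsto_cocompact
  have h2 := ((Real.zero_at_infty_fourier h).comp h1).const_mul (1 / (2 * (Real.pi : ℂ)))
  rw [mul_zero] at h2
  exact h2.congr fun x => (invFourierT_eq_fourier h x).symm

/-- Multiplication formula. -/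
theorem integral_mul_fourierT {f g : ℝ → ℂ} (hf : Integrable f) (hg : Integrable g) :
    ∫ x, f x * fourierT g x = ∫ κ, fourierT f κ * g κ := by
  have hF : Integrable (Function.uncurry fun x κ : ℝ =>
      f x * g κ * Complex.exp (Complex.I * ((x * κ : ℝ) : ℂ))) (volume.prod volume) := by
    refine (hf.mul_prod hg).mul_bdd (c := 1) (Continuous.aestronglyMeasurable (by fun_prop))
      (Eventually.of_forall fun p => (norm_exp_I_mul _).le)
  have h := integral_integral_swap hF
  unfold fourierT
  simp_rw [← integral_const_mul, ← integral_mul_const]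
  calc _ = _ := by simp_rw [← mul_assoc]
    _ = _ := h
    _ = _ := by
      congr 1; ext κ; congr 1; ext x
      rw [mul_comm x κ]; ring

theorem integral_invFourierT_mul {h g : ℝ → ℂ} (hh : Integrable h) (hg : Integrable g) :
    ∫ x, invFourierT h x * g x = ∫ κ, h κ * invFourierT g κ := by
  simp_rw [invFourierT_eq_fourierT_neg, mul_assoc, mul_left_comm (h _), integral_const_mul]
  congr 1
  rw [← integral_neg_eq_self, ]
  simp only [neg_neg]
  rw [← integral_mul_fourierT hh hg.comp_neg]
  congr 1; ext x
  congr 1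
  unfold fourierT
  rw [← integral_neg_eq_self]
  congr 1; ext t
  simp only [neg_neg]
  congr 2; push_cast; ring

/-! ### Schwartz functions -/

/-- The dilation by `2π`, which converts between the two normalisations of the Fourier transform. -/
noncomputable def dilation : ℝ ≃L[ℝ] ℝ :=
  ContinuousLinearEquiv.unitsEquivAut ℝ (Units.mk0 (2 * Real.pi) (by positivity))

theorem dilation_apply (x : ℝ) : dilation x = x * (2 * Real.pi) := rfl

theorem dilation_symm_apply (x : ℝ) : dilation.symm x = x / (2 * Real.pi) := by
  rw [ContinuousLinearEquiv.symm_apply_eq, dilation_apply]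
  field_simp

theorem exists_schwartz_eq_fourierT (φ : 𝓢(ℝ, ℂ)) : ∃ ψ : 𝓢(ℝ, ℂ), ∀ x, ψ x = fourierT φ x :=
  ⟨SchwartzMap.compCLMOfContinuousLinearEquiv ℂ dilation.symm (𝓕⁻ φ), fun x => by
    rw [SchwartzMap.compCLMOfContinuousLinearEquiv_apply, Function.comp_apply,
      dilation_symm_apply, fourierT_eq_fourierInv, SchwartzMap.fourierInv_coe]⟩

theorem exists_schwartz_fourierT_eq (ψ : 𝓢(ℝ, ℂ)) : ∃ φ : 𝓢(ℝ, ℂ), ∀ x, fourierT φ x = ψ x :=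
  ⟨𝓕 (SchwartzMap.compCLMOfContinuousLinearEquiv ℂ dilation ψ), fun x => by
    rw [fourierT_eq_fourierInv, ← SchwartzMap.fourierInv_coe, FourierPair.fourierInv_fourier_eq,
      SchwartzMap.compCLMOfContinuousLinearEquiv_apply, Function.comp_apply, dilation_apply]
    congr 1
    field_simp⟩

theorem invFourierT_fourierT_schwartz (φ : 𝓢(ℝ, ℂ)) (x : ℝ) :
    invFourierT (fourierT φ) x = φ x := by
  have h1 : φ x = 𝓕 (𝓕⁻ φ) x := by rw [FourierInvPair.fourier_fourierInv_eq]
  rw [h1, SchwartzMap.fourier_coe, Real.fourier_real_eq_integral_exp_smul, invFourierT]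
  have h2 := Measure.integral_comp_div
    (fun v : ℝ => Complex.exp (((-2 * Real.pi * v * x : ℝ) : ℂ) * Complex.I) • (𝓕⁻ φ) v)
    (2 * Real.pi)
  rw [abs_of_pos (by positivity), Complex.real_smul] at h2
  have hpi : (Real.pi : ℂ) ≠ 0 := by exact_mod_cast Real.pi_ne_zero
  have h3 : ∀ κ : ℝ, fourierT φ κ * Complex.exp (-Complex.I * ((κ * x : ℝ) : ℂ)) =
      Complex.exp (((-2 * Real.pi * (κ / (2 * Real.pi)) * x : ℝ) : ℂ) * Complex.I) •
        (𝓕⁻ φ) (κ / (2 * Real.pi)) := by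
    intro κ
    rw [fourierT_eq_fourierInv, SchwartzMap.fourierInv_coe, smul_eq_mul, mul_comm]
    congr 2
    push_cast
    field_simp
  simp_rw [h3]
  rw [h2, ← mul_assoc]
  push_cast
  rw [one_div, inv_mul_cancel₀ (mul_ne_zero two_ne_zero hpi), one_mul]

theorem exists_norm_weight_mul_schwartz_le (ψ : 𝓢(ℝ, ℂ)) (m : ℕ) :
    ∃ C : ℝ, ∀ x : ℝ, (1 + |x|) ^ m * ‖ψ x‖ ≤ C :=
  ⟨_, fun x => by
    simpa using SchwartzMap.one_add_le_sup_seminorm_apply (𝕜 := ℂ) (m := (m, 0)) le_rfl le_rfl ψ x⟩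

theorem schwartz_mul_eq_weight {m : ℕ} (f : ℂ) (ψ : ℂ) (x : ℝ) :
    f * ψ = ((((1 + |x|) ^ m)⁻¹ : ℝ) • f) * (((1 + |x|) ^ m : ℝ) • ψ) := by
  have : (1 + |x|) ^ m ≠ 0 := by positivity
  rw [smul_mul_smul_comm, inv_mul_cancel₀ this, one_smul]

theorem FracHelmholtz.IsTempered.integrable_mul {f : ℝ → ℂ} (hf : IsTempered f) (ψ : 𝓢(ℝ, ℂ)) :
    Integrable (fun x => f x * ψ x) := by
  obtain ⟨m, hm⟩ := hf
  obtain ⟨C, hC⟩ := exists_norm_weight_mul_schwartz_le ψ m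
  simp_rw [fun x => schwartz_mul_eq_weight (m := m) (f x) (ψ x) x]
  refine hm.mul_bdd (c := C) (Continuous.aestronglyMeasurable ?_)
    (Eventually.of_forall fun x => ?_)
  · have := ψ.continuous; fun_prop
  · rw [norm_smul, Real.norm_of_nonneg (by positivity)]; exact hC x

theorem FracHelmholtz.IsTempered.locallyIntegrable {f : ℝ → ℂ} (hf : IsTempered f) :
    LocallyIntegrable f := by
  obtain ⟨m, hm⟩ := hf
  rw [locallyIntegrable_iff]
  intro K hK
  have h := (hm.integrableOn (s := K)).continuousOn_smul (f := fun x : ℝ => (1 + |x|) ^ m)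
    (by fun_prop) hK
  refine h.congr (Eventually.of_forall fun x => ?_)
  have : (1 + |x|) ^ m ≠ 0 := by positivity
  simp only [smul_smul]
  rw [mul_inv_cancel₀ this, one_smul]

theorem MeasureTheory.Integrable.isTempered {f : ℝ → ℂ} (hf : Integrable f) : IsTempered f :=
  ⟨0, by simpa using hf⟩

theorem integrable_weight_two : Integrable (fun x : ℝ => ((1 + |x|) ^ 2)⁻¹) := by
  have := integrable_one_add_norm (E := ℝ) (μ := volume) (r := 2) (by simp)
  refine this.congr (Eventually.of_forall fun x => ?_)
  simp only [Real.norm_eq_abs]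
  rw [Real.rpow_neg (by positivity)]
  norm_cast

theorem isTempered_of_bounded {f : ℝ → ℂ} {C : ℝ} (hf : AEStronglyMeasurable f)
    (hC : ∀ x, ‖f x‖ ≤ C) : IsTempered f :=
  ⟨2, by
    have := integrable_weight_two.ofReal (𝕜 := ℂ)
    simp_rw [Complex.real_smul]
    exact this.mul_bdd hf (Eventually.of_forall hC)⟩

/-- Locally integrable functions are determined by their pairings with compactly supported
Schwartz functions. -/
theorem ae_eq_of_forall_integral_mul_schwartz {f g : ℝ → ℂ} (hf : LocallyIntegrable f)
    (hg : LocallyIntegrable g)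
    (h : ∀ φ : 𝓢(ℝ, ℂ), HasCompactSupport φ → ∫ x, f x * φ x = ∫ x, g x * φ x) : f =ᵐ[volume] g := by
  have hs : LocallyIntegrable (fun x => f x - g x) := hf.sub hg
  have := ae_eq_zero_of_integral_contDiff_smul_eq_zero hs (fun φ hφ hφc => by
    have hc : HasCompactSupport (fun x => (φ x : ℂ)) := hφc.comp_left (g := Complex.ofReal) rfl
    have hd : ContDiff ℝ (↑(⊤ : ℕ∞)) (fun x => (φ x : ℂ)) := Complex.ofRealCLM.contDiff.comp hφ
    have h1 := h (hc.toSchwartzMap hd) hc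
    simp only [HasCompactSupport.toSchwartzMap_toFun] at h1
    have hcont : Continuous φ := hφ.continuous
    have i1 := hf.integrable_smul_left_of_hasCompactSupport hcont hφc
    have i2 := hg.integrable_smul_left_of_hasCompactSupport hcont hφc
    simp_rw [smul_sub]
    rw [integral_sub i1 i2, sub_eq_zero]
    simp_rw [Complex.real_smul, mul_comm (φ _ : ℂ)]
    exact h1)
  filter_upwards [this] with x hx
  exact sub_eq_zero.1 hx

/-! ### The Fourier transform of tempered functions -/

theorem hasFourierT_fourierT {f : ℝ → ℂ} (hf : Integrable f) (h : IsTempered (fourierT f)) :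
    HasFourierT f (fourierT f) :=
  ⟨hf.isTempered, h, fun φ => integral_mul_fourierT hf φ.integrable⟩

theorem hasFourierT_invFourierT {h : ℝ → ℂ} (hh : Integrable h) :
    HasFourierT (invFourierT h) h := by
  refine ⟨isTempered_of_bounded (continuous_invFourierT hh).aestronglyMeasurable
    (norm_invFourierT_le h), hh.isTempered, fun φ => ?_⟩
  obtain ⟨ψ, hψ⟩ := exists_schwartz_eq_fourierT φ
  have e : fourierT (fun t => φ t) = ψ := funext fun x => (hψ x).symm
  rw [e, integral_invFourierT_mul hh ψ.integrable, ← e]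
  simp_rw [invFourierT_fourierT_schwartz]

theorem FracHelmholtz.HasFourierT.ae_eq_left {f f' h : ℝ → ℂ} (hf : HasFourierT f h)
    (hf' : HasFourierT f' h) :
    f =ᵐ[volume] f' := by
  apply ae_eq_of_forall_integral_mul_schwartz hf.tempered_left.locallyIntegrable
    hf'.tempered_left.locallyIntegrable
  intro ψ _
  obtain ⟨φ, hφ⟩ := exists_schwartz_fourierT_eq ψ
  simp_rw [← hφ]
  exact (hf.pairing φ).trans (hf'.pairing φ).symm

theorem FracHelmholtz.HasFourierT.ae_eq_right {f h h' : ℝ → ℂ} (hf : HasFourierT f h)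
    (hf' : HasFourierT f h') :
    h =ᵐ[volume] h' := by
  apply ae_eq_of_forall_integral_mul_schwartz hf.tempered_right.locallyIntegrable
    hf'.tempered_right.locallyIntegrable
  exact fun φ _ => (hf.pairing φ).symm.trans (hf'.pairing φ)

theorem FracHelmholtz.HasFourierT.congr_right {f h h' : ℝ → ℂ} (hf : HasFourierT f h)
    (hh : h =ᵐ[volume] h') :
    HasFourierT f h' := by
  refine ⟨hf.tempered_left, ?_, fun φ => ?_⟩
  · obtain ⟨m, hm⟩ := hf.tempered_right
    exact ⟨m, hm.congr (by filter_upwards [hh] with x hx; rw [hx])⟩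
  · rw [hf.pairing φ]
    exact integral_congr_ae (by filter_upwards [hh] with x hx; rw [hx])

theorem invFourierT_fourierT_ae {f : ℝ → ℂ} (hf : Integrable f) (hf' : Integrable (fourierT f)) :
    invFourierT (fourierT f) =ᵐ[volume] f :=
  (hasFourierT_invFourierT hf').ae_eq_left (hasFourierT_fourierT hf hf'.isTempered)

/-- A continuous function with an integrable Fourier transform is given by the inversion formula. -/
theorem FracHelmholtz.HasFourierT.eq_invFourierT {f h : ℝ → ℂ} (hf : HasFourierT f h)
    (hh : Integrable h)
    (hc : Continuous f) : f = invFourierT h :=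
  Continuous.ae_eq_iff_eq volume hc (continuous_invFourierT hh) |>.1
    (hf.ae_eq_left (hasFourierT_invFourierT hh))

/-! ### Fractional integrals of locally integrable functions -/

/-- Integrability on every bounded interval `(0, Y]`. -/
def LocInt (u : ℝ → ℂ) : Prop := ∀ Y, 0 < Y → IntegrableOn u (Ioc 0 Y)

theorem LocInt.add {u v : ℝ → ℂ} (hu : LocInt u) (hv : LocInt v) : LocInt (fun t => u t + v t) :=
  fun Y hY => (hu Y hY).add (hv Y hY)

theorem LocInt.const_mul {u : ℝ → ℂ} (hu : LocInt u) (c : ℂ) : LocInt (fun t => c * u t) :=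
  fun Y hY => (hu Y hY).const_mul c

theorem integrableOn_rpow_Ioc {c : ℝ} (hc : -1 < c) (Y : ℝ) (hY : 0 < Y) :
    IntegrableOn (fun t : ℝ => t ^ c) (Ioc 0 Y) := by
  rw [← intervalIntegrable_iff_integrableOn_Ioc_of_le hY.le]
  exact intervalIntegral.intervalIntegrable_rpow' hc

theorem locInt_of_rpow_bound {u : ℝ → ℂ} {δ : ℝ} (hδ : δ < 1) (hm : Measurable u)
    (h : ∀ Y, 0 < Y → ∃ C, ∀ t ∈ Ioc 0 Y, ‖u t‖ ≤ C * t ^ (-δ)) : LocInt u := by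
  intro Y hY
  obtain ⟨C, hC⟩ := h Y hY
  refine Integrable.mono' ((integrableOn_rpow_Ioc (c := -δ) (by linarith) Y hY).const_mul C)
    hm.aestronglyMeasurable ?_
  filter_upwards [ae_restrict_mem measurableSet_Ioc] with t ht using hC t ht

theorem locInt_powKer {a : ℝ} (ha : 0 < a) : LocInt (powKer a) :=
  locInt_of_rpow_bound (δ := 1 - a) (by linarith) (measurable_powKer a) fun Y _ =>
    ⟨_, fun t ht => by rw [neg_sub]; exact norm_powKer_le ha t ht⟩

theorem locInt_mlKer {μ b : ℝ} (hμ : 1 ≤ μ) (hb : 0 < b) (ω : ℂ) : LocInt (mlKer μ b ω) := by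
  obtain ⟨r, hr, hω⟩ := exists_norm_le_rpow hμ ω
  exact locInt_of_rpow_bound (δ := 1 - b) (by linarith)
    (measurable_mlKer_const hμ hb _) fun Y _ =>
    ⟨_, fun t ht => by rw [neg_sub]; exact norm_mlKer_le hμ hb hr hω t ht⟩

theorem norm_causalConv_le {k u : ℝ → ℂ} {C y Y : ℝ} (hC : 0 ≤ C)
    (hk : ∀ t ∈ Ioo 0 Y, ‖k t‖ ≤ C) (hu : IntegrableOn u (Ioc 0 Y)) (hy : y ≤ Y) :
    ‖causalConv k u y‖ ≤ C * ∫ t in Ioc 0 Y, ‖u t‖ := by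
  have hu' : IntegrableOn u (Ioc 0 y) := hu.mono_set (Ioc_subset_Ioc_right hy)
  calc ‖causalConv k u y‖ ≤ ∫ t in Ioc 0 y, C * ‖u t‖ := by
        apply norm_integral_le_of_norm_le (hu'.norm.const_mul C)
        have : ∀ᵐ t : ℝ, t ≠ y := by simp [ae_iff]
        filter_upwards [ae_restrict_mem measurableSet_Ioc, ae_restrict_of_ae this] with t ht hty
        have hlt : t < y := lt_of_le_of_ne ht.2 hty
        rw [norm_mul]
        gcongr
        exact hk _ ⟨by linarith, by linarith [ht.1]⟩
    _ = C * ∫ t in Ioc 0 y, ‖u t‖ := integral_const_mul _ _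
    _ ≤ _ := by
      refine mul_le_mul_of_nonneg_left ?_ hC
      exact setIntegral_mono_set hu.norm (Eventually.of_forall fun _ => norm_nonneg _)
        (Ioc_subset_Ioc_right hy).eventuallyLE

theorem norm_powKer_le_of_one_le {a Y : ℝ} (ha : 1 ≤ a) :
    ∀ t ∈ Ioo 0 Y, ‖powKer a t‖ ≤ (Real.Gamma a)⁻¹ * Y ^ (a - 1) := by
  intro t ht
  have := Real.Gamma_pos_of_pos (by linarith : 0 < a)
  rw [norm_powKer (by linarith) ht.1.le]
  gcongr
  · exact ht.1.le
  · exact ht.2.le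

theorem continuousOn_rlIntegral_one {u : ℝ → ℂ} (hu : LocInt u) :
    ContinuousOn (rlIntegral 1 u) (Ici 0) := by
  intro y hy
  have hy0 : (0 : ℝ) ≤ y := hy
  have hY : 0 < y + 1 := by linarith
  have h1 : ContinuousOn (fun x => ∫ t in (0 : ℝ)..x, u t) (uIcc 0 (y + 1)) :=
    intervalIntegral.continuousOn_primitive_interval (by
      rw [uIcc_of_le hY.le, integrableOn_Icc_iff_integrableOn_Ioc]; exact hu _ hY)
  rw [uIcc_of_le hY.le] at h1
  have h2 : ContinuousOn (rlIntegral 1 u) (Icc 0 (y + 1)) := by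
    rw [funext (rlIntegral_one u)]; exact h1
  refine (h2 y ⟨hy0, by linarith⟩).mono_of_mem_nhdsWithin ?_
  rw [← Ici_inter_Iic]
  exact inter_mem self_mem_nhdsWithin (mem_nhdsWithin_of_mem_nhds (Iic_mem_nhds (by linarith)))

theorem continuousOn_rlIntegral_of_one_le {a : ℝ} (ha : 1 ≤ a) {u : ℝ → ℂ} (hu : LocInt u) :
    ContinuousOn (rlIntegral a u) (Ioi 0) := by
  rcases ha.eq_or_lt with rfl | ha
  · exact (continuousOn_rlIntegral_one hu).mono Ioi_subset_Ici_self
  · exact continuousOn_rlIntegral ha hu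

theorem LocInt.of_continuousOn_of_bounded {v : ℝ → ℂ} (hc : ContinuousOn v (Ioi 0))
    (hb : ∀ Y, 0 < Y → ∃ C, ∀ t ∈ Ioc 0 Y, ‖v t‖ ≤ C) : LocInt v := by
  intro Y hY
  obtain ⟨C, hC⟩ := hb Y hY
  refine Integrable.mono' (g := fun _ => C) (integrableOn_const (by simp)) ?_ ?_
  · exact (hc.mono Ioc_subset_Ioi_self).aestronglyMeasurable measurableSet_Ioc
  · filter_upwards [ae_restrict_mem measurableSet_Ioc] with t ht using hC t ht

theorem LocInt.causalConv {k u : ℝ → ℂ} (hk : ContinuousOn k (Ici 0)) (hk0 : k 0 = 0)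
    (hu : LocInt u) : LocInt (causalConv k u) := by
  refine LocInt.of_continuousOn_of_bounded (continuousOn_causalConv hk hk0 hu) fun Y hY => ?_
  obtain ⟨C, hC⟩ := (isCompact_Icc (a := 0) (b := Y)).exists_bound_of_continuousOn
    (hk.mono Icc_subset_Ici_self)
  refine ⟨C * ∫ t in Ioc 0 Y, ‖u t‖, fun t ht => norm_causalConv_le
    ((norm_nonneg _).trans (hC 0 ⟨le_rfl, hY.le⟩)) (fun s hs => hC s ⟨hs.1.le, hs.2.le⟩)
    (hu Y hY) ht.2⟩

theorem LocInt.rlIntegral {a : ℝ} (ha : 1 ≤ a) {u : ℝ → ℂ} (hu : LocInt u) :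
    LocInt (rlIntegral a u) := by
  refine LocInt.of_continuousOn_of_bounded (continuousOn_rlIntegral_of_one_le ha hu) fun Y hY =>
    ⟨(Real.Gamma a)⁻¹ * Y ^ (a - 1) * ∫ t in Ioc 0 Y, ‖u t‖, fun t ht => ?_⟩
  have := Real.Gamma_pos_of_pos (by linarith : 0 < a)
  rw [rlIntegral_eq_causalConv (by linarith) u ht.1.le]
  exact norm_causalConv_le (by positivity) (norm_powKer_le_of_one_le ha) (hu Y hY) ht.2

theorem rlIntegral_const_mul (ρ : ℝ) (c : ℂ) (u : ℝ → ℂ) (y : ℝ) :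
    rlIntegral ρ (fun t => c * u t) y = c * rlIntegral ρ u y := by
  unfold FracHelmholtz.rlIntegral
  split_ifs
  · rfl
  · simp_rw [mul_left_comm _ c, intervalIntegral.integral_const_mul]
    ring

theorem rlIntegral_mul_const (ρ : ℝ) (c : ℂ) (u : ℝ → ℂ) (y : ℝ) :
    rlIntegral ρ (fun t => u t * c) y = rlIntegral ρ u y * c := by
  simp_rw [mul_comm _ c]; exact rlIntegral_const_mul ρ c u y

theorem convAt_powKer {a y : ℝ} (ha : 1 ≤ a) (hy : 0 < y) {u : ℝ → ℂ} (hu : LocInt u) :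
    ConvAt (powKer a) u y :=
  ConvAt.of_bounded (measurable_powKer a) (norm_powKer_le_of_one_le ha) (hu y hy)

theorem rlIntegral_add {a y : ℝ} (ha : 0 < a) (hy : 0 ≤ y) {u v : ℝ → ℂ}
    (hu : ConvAt (powKer a) u y) (hv : ConvAt (powKer a) v y) :
    rlIntegral a (fun t => u t + v t) y = rlIntegral a u y + rlIntegral a v y := by
  simp_rw [rlIntegral_eq_causalConv ha _ hy]
  exact causalConv_add_right hu hv

/-- Taylor's formula at `0+` for a function which is only assumed to be twice differentiable with
integrable second derivative. -/
theorem eq_add_rlIntegral_two {U : ℝ → ℂ} {f g : ℂ}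
    (hd : ∀ y, 0 < y → DifferentiableAt ℝ U y ∧ DifferentiableAt ℝ (deriv U) y)
    (hi : LocInt (iteratedDeriv 2 U)) (hf : Tendsto U (𝓝[>] 0) (𝓝 f))
    (hg : Tendsto (deriv U) (𝓝[>] 0) (𝓝 g)) {y : ℝ} (hy : 0 < y) :
    U y = f + (y : ℂ) * g + rlIntegral 2 (iteratedDeriv 2 U) y := by
  set q := iteratedDeriv 2 U with hq
  have hq' : q = deriv (deriv U) := by
    rw [hq, iteratedDeriv_succ, iteratedDeriv_one]
  have h1 : ∀ z, 0 < z → deriv U z = g + rlIntegral 1 q z := by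
    intro z hz
    have h := intervalIntegral.integral_eq_sub_of_hasDerivAt_of_tendsto hz
      (f := deriv U) (f' := q) (fun x hx => by rw [hq']; exact (hd x hx.1).2.hasDerivAt)
      ((intervalIntegrable_iff_integrableOn_Ioc_of_le hz.le).2 (hi z hz)) hg
      ((hd z hz).2.continuousAt.tendsto.mono_left nhdsWithin_le_nhds)
    rw [rlIntegral_one, h]; ring
  have hI1 : LocInt (rlIntegral 1 q) := hi.rlIntegral le_rfl
  have hconst : IntegrableOn (fun _ : ℝ => g) (Ioc 0 y) := integrableOn_const (by simp)
  have h2 : IntervalIntegrable (deriv U) volume 0 y := by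
    rw [intervalIntegrable_iff_integrableOn_Ioc_of_le hy.le]
    exact (hconst.add (hI1 y hy)).congr_fun (fun z hz => (h1 z hz.1).symm) measurableSet_Ioc
  have h3 := intervalIntegral.integral_eq_sub_of_hasDerivAt_of_tendsto hy
      (f := U) (f' := deriv U) (fun x hx => (hd x hx.1).1.hasDerivAt) h2 hf
      ((hd y hy).1.continuousAt.tendsto.mono_left nhdsWithin_le_nhds)
  have h4 : ∫ t in (0 : ℝ)..y, deriv U t = (y : ℂ) * g + rlIntegral 2 q y := by
    rw [intervalIntegral.integral_of_le hy.le,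
      setIntegral_congr_fun measurableSet_Ioc (fun z hz => h1 z hz.1),
      integral_add hconst (hI1 y hy), ← intervalIntegral.integral_of_le hy.le,
      ← intervalIntegral.integral_of_le hy.le, ← rlIntegral_one (rlIntegral 1 q),
      rlIntegral_rlIntegral one_pos zero_le_one (by norm_num) hy (hi y hy)]
    norm_num
  rw [add_assoc, ← h4, h3]
  ring

/-! ### The Volterra equation -/

/-- Uniqueness for the homogeneous Volterra equation, from Grönwall's inequality; the kernel is
bounded because `μ ≥ 1`. -/
theorem rlIntegral_one_eq_zero {μ : ℝ} (hμ : 1 ≤ μ) {ω : ℂ} {D : ℝ → ℂ} (hD : LocInt D)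
    (h : ∀ y, 0 < y → rlIntegral 1 D y = ω * rlIntegral (1 + μ) D y) {Y : ℝ} (hY : 0 < Y) :
    rlIntegral 1 D Y = 0 := by
  -- the primitive of `D`, cut off outside `(0, Y]` so as to be continuous on all of `ℝ`
  set w : ℝ → ℂ := fun y => ∫ t in (0 : ℝ)..y, indicator (Ioc 0 Y) D t with hw
  have hDi : Integrable (indicator (Ioc 0 Y) D) :=
    (integrable_indicator_iff measurableSet_Ioc).2 (hD Y hY)
  have hwc : Continuous w :=
    intervalIntegral.continuous_primitive (fun a b => hDi.intervalIntegrable) 0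
  have hwe : ∀ y ∈ Icc 0 Y, w y = rlIntegral 1 D y := by
    intro y hy
    rw [rlIntegral_one, hw]
    simp only
    rw [intervalIntegral.integral_of_le hy.1, intervalIntegral.integral_of_le hy.1]
    exact setIntegral_congr_fun measurableSet_Ioc fun t ht =>
      indicator_of_mem (show t ∈ Ioc 0 Y from ⟨ht.1, ht.2.trans hy.2⟩) _
  set K := ‖ω‖ * ((Real.Gamma μ)⁻¹ * Y ^ (μ - 1)) with hK
  have hΓ := Real.Gamma_pos_of_pos (by linarith : 0 < μ)
  have hbd : ∀ y ∈ Icc 0 Y, ‖w y‖ ≤ K * ∫ t in (0 : ℝ)..y, ‖w t‖ := by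
    intro y hy
    rcases hy.1.eq_or_lt with rfl | h0
    · simp [hw]
    rw [hwe y hy, h y h0, add_comm, ← rlIntegral_rlIntegral (by linarith) zero_le_one (by linarith)
      h0 (hD y h0), rlIntegral_eq_causalConv (by linarith) _ h0.le, norm_mul, hK, mul_assoc]
    gcongr
    have e : causalConv (powKer μ) (rlIntegral 1 D) y = causalConv (powKer μ) w y :=
      causalConv_congr (fun _ _ => rfl) (Eventually.of_forall fun t ht =>
        (hwe t ⟨ht.1.le, ht.2.le.trans hy.2⟩).symm)
    rw [e, intervalIntegral.integral_of_le h0.le]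
    refine norm_causalConv_le (by positivity) (fun t ht => ?_)
      (hwc.integrableOn_Ioc) le_rfl
    exact norm_powKer_le_of_one_le hμ t ⟨ht.1, ht.2.trans_le hy.2⟩
  -- Grönwall's inequality for `V' ≤ K V`, `V 0 = 0`
  set V : ℝ → ℝ := fun y => ∫ t in (0 : ℝ)..y, ‖w t‖ with hV
  have hVd : ∀ y, HasDerivAt V ‖w y‖ y := fun y =>
    intervalIntegral.integral_hasDerivAt_right (hwc.norm.intervalIntegrable _ _)
      (hwc.norm.stronglyMeasurableAtFilter _ _) hwc.norm.continuousAt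
  have hV0 : ∀ y ∈ Icc 0 Y, 0 ≤ V y := fun y hy =>
    intervalIntegral.integral_nonneg hy.1 fun _ _ => norm_nonneg _
  have hgr := norm_le_gronwallBound_of_norm_deriv_right_le (f := V) (f' := fun y => ‖w y‖)
    (δ := 0) (K := K) (ε := 0) (a := 0) (b := Y)
    (fun y _ => (hVd y).continuousAt.continuousWithinAt) (fun y _ => (hVd y).hasDerivWithinAt)
    (by simp [hV]) (fun y hy => by
      rw [norm_norm, add_zero, Real.norm_of_nonneg (hV0 y (Ico_subset_Icc_self hy))]
      exact hbd y (Ico_subset_Icc_self hy)) Y ⟨hY.le, le_rfl⟩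
  rw [gronwallBound_ε0_δ0, Real.norm_of_nonneg (hV0 Y ⟨hY.le, le_rfl⟩)] at hgr
  have h2 := hbd Y ⟨hY.le, le_rfl⟩
  have h3 : V Y = 0 := le_antisymm hgr (hV0 Y ⟨hY.le, le_rfl⟩)
  change ‖w Y‖ ≤ K * V Y at h2
  rw [h3, mul_zero] at h2
  rw [← hwe Y ⟨hY.le, le_rfl⟩]
  exact norm_le_zero_iff.1 h2

/-- The solution `a e_{1-β} + b e_{2-β} + e_μ * v` of the fractional equation of order `μ` with
parameter `ω`, where `e_c(t) = t^{c-1} E_{μ,c}(ω t^μ)`. -/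
noncomputable def volterraSol (μ β : ℝ) (ω a b : ℂ) (v : ℝ → ℂ) (y : ℝ) : ℂ :=
  a * mlKer μ (1 - β) ω y + b * mlKer μ (2 - β) ω y + causalConv (mlKer μ μ ω) v y

theorem powKer_conv_causalConv_mlKer {μ a b y : ℝ} (hμ : 1 ≤ μ) (ha : 0 < a) (hb : 0 < b)
    (hab : 1 ≤ a + b) (hy : 0 < y) (ω : ℂ) {v : ℝ → ℂ} (hv : LocInt v) :
    causalConv (powKer a) (causalConv (mlKer μ b ω) v) y = causalConv (mlKer μ (a + b) ω) v y := by
  obtain ⟨r, hr, hω⟩ := exists_norm_le_rpow hμ ω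
  rw [causalConv_assoc ha hb (measurable_powKer a)
    (measurable_mlKer_const hμ hb _) (norm_powKer_le ha)
    (norm_mlKer_le hμ hb hr hω) (hv y hy).aestronglyMeasurable
    (integrableOn_rpow_mul (by linarith) (hv y hy))]
  exact causalConv_congr (fun t ht => powKer_conv_mlKer hμ ha hb ht.1 ω)
    (Eventually.of_forall fun _ _ => rfl)

theorem convAt_mlKer {μ b y : ℝ} (hμ : 1 ≤ μ) (hb : 1 ≤ b) (hy : 0 < y) (ω : ℂ) {v : ℝ → ℂ}
    (hv : LocInt v) : ConvAt (mlKer μ b ω) v y := by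
  obtain ⟨C, hC⟩ := (isCompact_Icc (a := 0) (b := y)).exists_bound_of_continuousOn
    (continuous_mlKer hμ hb ω).continuousOn
  exact ConvAt.of_bounded (measurable_mlKer_const hμ (by linarith) _)
    (fun t ht => hC t ⟨ht.1.le, ht.2.le⟩) (hv y hy)

theorem causalConv_mlKer_eq {μ b y : ℝ} (hμ : 1 ≤ μ) (hb : 1 ≤ b) (hy : 0 < y) (ω : ℂ) {v : ℝ → ℂ}
    (hv : LocInt v) : causalConv (mlKer μ b ω) v y =
      causalConv (powKer b) v y + ω * causalConv (mlKer μ (b + μ) ω) v y := by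
  rw [← causalConv_const_mul_left, ← causalConv_add_left (convAt_powKer hb hy hv)
    ((convAt_mlKer hμ (by linarith) hy ω hv).const_mul_left ω)]
  exact causalConv_congr (fun t ht => mlKer_eq_powKer_add hμ (by linarith) ω ht.1)
    (Eventually.of_forall fun _ _ => rfl)

theorem locInt_volterraSol {μ β : ℝ} (hμ : 1 < μ) (hβ : β < 1) (ω a b : ℂ) {v : ℝ → ℂ}
    (hv : LocInt v) : LocInt (volterraSol μ β ω a b v) :=
  (((locInt_mlKer hμ.le (by linarith) ω).const_mul a).add
    ((locInt_mlKer hμ.le (by linarith) ω).const_mul b)).add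
    (LocInt.causalConv (continuous_mlKer hμ.le hμ.le ω).continuousOn (mlKer_zero hμ ω) hv)

theorem rlIntegral_mlKer {μ a b y : ℝ} (hμ : 1 ≤ μ) (ha : 0 < a) (hb : 0 < b) (hy : 0 < y)
    (ω : ℂ) : rlIntegral a (mlKer μ b ω) y = mlKer μ (a + b) ω y := by
  rw [rlIntegral_eq_causalConv ha _ hy.le, powKer_conv_mlKer hμ ha hb hy]

theorem convAt_powKer_mlKer {μ a b y : ℝ} (hμ : 1 ≤ μ) (ha : 0 < a) (hb : 0 < b) (ω : ℂ) :
    ConvAt (powKer a) (mlKer μ b ω) y := by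
  obtain ⟨r, hr, hω⟩ := exists_norm_le_rpow hμ ω
  exact ConvAt.of_rpow ha (by linarith : 1 - b < 1) (measurable_powKer a) (norm_powKer_le ha)
    (measurable_mlKer_const hμ hb ω).aestronglyMeasurable
    (fun t ht => by rw [neg_sub]; exact norm_mlKer_le hμ hb hr hω t ht)

theorem ConvAt.of_bounded_right {k u : ℝ → ℂ} {y C : ℝ} (hk : LocInt k) (hy : 0 < y)
    (hum : AEStronglyMeasurable u (volume.restrict (Ioc 0 y))) (hu : ∀ t ∈ Ioc 0 y, ‖u t‖ ≤ C) :
    ConvAt k u y := by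
  have h1 : IntegrableOn (fun t => k (y - t)) (Ioc 0 y) := by
    rw [← intervalIntegrable_iff_integrableOn_Ioc_of_le hy.le]
    have := ((intervalIntegrable_iff_integrableOn_Ioc_of_le hy.le).2 (hk y hy)).comp_sub_left y
    simpa using this.symm
  exact h1.mul_bdd (c := C) hum
    (by filter_upwards [ae_restrict_mem measurableSet_Ioc] with t ht using hu t ht)

theorem convAt_powKer_causalConv_mlKer {μ a b y : ℝ} (hμ : 1 ≤ μ) (ha : 0 < a) (hb : 1 < b)
    (hy : 0 < y) (ω : ℂ) {v : ℝ → ℂ} (hv : LocInt v) :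
    ConvAt (powKer a) (causalConv (mlKer μ b ω) v) y := by
  have hk := continuous_mlKer hμ hb.le ω
  obtain ⟨C, hC⟩ := (isCompact_Icc (a := 0) (b := y)).exists_bound_of_continuousOn
    hk.continuousOn
  have hcc := continuousOn_causalConv hk.continuousOn (mlKer_zero hb ω) hv
  exact ConvAt.of_bounded_right (locInt_powKer ha) hy
    ((hcc.mono Ioc_subset_Ioi_self).aestronglyMeasurable measurableSet_Ioc)
    fun t ht => norm_causalConv_le ((norm_nonneg _).trans (hC 0 ⟨le_rfl, hy.le⟩))
      (fun s hs => hC s ⟨hs.1.le, hs.2.le⟩) (hv y hy) ht.2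

/-- Fractional integration shifts the index of all three terms. -/
theorem rlIntegral_mlKer_sum {μ c b₁ b₂ b₃ y : ℝ} (hμ : 1 ≤ μ) (hc : 0 ≤ c) (hb₁ : 0 < b₁)
    (hb₂ : 0 < b₂) (hb₃ : 1 < b₃) (hy : 0 < y) (ω a b : ℂ) {v : ℝ → ℂ} (hv : LocInt v) :
    rlIntegral c (fun t => a * mlKer μ b₁ ω t + b * mlKer μ b₂ ω t +
      causalConv (mlKer μ b₃ ω) v t) y = a * mlKer μ (c + b₁) ω y +
      b * mlKer μ (c + b₂) ω y + causalConv (mlKer μ (c + b₃) ω) v y := by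
  rcases hc.eq_or_lt with rfl | hc0
  · simp only [rlIntegral_zero, zero_add]
  have k1 := (convAt_powKer_mlKer (y := y) hμ hc0 hb₁ ω).const_mul a
  have k2 := (convAt_powKer_mlKer (y := y) hμ hc0 hb₂ ω).const_mul b
  have k3 := convAt_powKer_causalConv_mlKer hμ hc0 hb₃ hy ω hv
  rw [rlIntegral_add hc0 hy.le (k1.add k2) k3, rlIntegral_add hc0 hy.le k1 k2,
    rlIntegral_const_mul, rlIntegral_const_mul, rlIntegral_mlKer hμ hc0 hb₁ hy,
    rlIntegral_mlKer hμ hc0 hb₂ hy, rlIntegral_eq_causalConv hc0 _ hy.le,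
    powKer_conv_causalConv_mlKer hμ hc0 (by linarith) (by linarith) hy ω hv]

theorem rlIntegral_volterraSol {μ β c y : ℝ} (hμ : 1 < μ) (hβ : β < 1) (hc : 1 ≤ c) (hy : 0 < y)
    (ω a b : ℂ) {v : ℝ → ℂ} (hv : LocInt v) :
    rlIntegral c (volterraSol μ β ω a b v) y = a * mlKer μ (c + (1 - β)) ω y +
      b * mlKer μ (c + (2 - β)) ω y + causalConv (mlKer μ (c + μ) ω) v y :=
  rlIntegral_mlKer_sum hμ.le (by linarith) (by linarith) (by linarith) hμ hy ω a b hv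

/-- The integrated Volterra equation of the explicit solution. -/
theorem rlIntegral_one_volterraSol {μ β y : ℝ} (hμ : 1 < μ) (hβ : β < 1) (hy : 0 < y) (ω a b : ℂ)
    {v : ℝ → ℂ} (hv : LocInt v) :
    rlIntegral 1 (volterraSol μ β ω a b v) y = a * powKer (2 - β) y + b * powKer (3 - β) y +
      rlIntegral (1 + μ) (fun t => v t + ω * volterraSol μ β ω a b v t) y := by
  have hs := locInt_volterraSol hμ hβ ω a b hv
  have hc : 1 ≤ 1 + μ := by linarith
  rw [rlIntegral_add (by linarith) hy.le (convAt_powKer hc hy hv)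
    (convAt_powKer hc hy (hs.const_mul ω)), rlIntegral_const_mul,
    rlIntegral_volterraSol hμ hβ le_rfl hy ω a b hv, rlIntegral_volterraSol hμ hβ hc hy ω a b hv,
    mlKer_eq_powKer_add hμ.le (by linarith) ω hy, mlKer_eq_powKer_add (b := 1 + (2 - β)) hμ.le (by linarith) ω hy,
    causalConv_mlKer_eq hμ.le (by linarith) hy ω hv, rlIntegral_eq_causalConv (by linarith) _ hy.le,
    show 1 + (1 - β) = 2 - β by ring, show 1 + (2 - β) = 3 - β by ring,
    show 2 - β + μ = 1 + μ + (1 - β) by ring, show 3 - β + μ = 1 + μ + (2 - β) by ring]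
  ring

/-- The integrated Volterra equation has only the explicit solution. -/
theorem rlIntegral_one_eq_volterraSol {μ β : ℝ} (hμ : 1 < μ) (hβ : β < 1) {ω a b : ℂ}
    {u v : ℝ → ℂ} (hu : LocInt u) (hv : LocInt v)
    (h : ∀ y, 0 < y → rlIntegral 1 u y = a * powKer (2 - β) y + b * powKer (3 - β) y +
      rlIntegral (1 + μ) (fun t => v t + ω * u t) y) {y : ℝ} (hy : 0 < y) :
    rlIntegral 1 u y = rlIntegral 1 (volterraSol μ β ω a b v) y := by
  set s := volterraSol μ β ω a b v with hsdef
  have hs : LocInt s := locInt_volterraSol hμ hβ ω a b hv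
  have hsub : ∀ c, 1 ≤ c → ∀ y, 0 < y →
      rlIntegral c (fun t => u t + (-1) * s t) y = rlIntegral c u y - rlIntegral c s y := by
    intro c hc y hy
    rw [rlIntegral_add (by linarith) hy.le (convAt_powKer hc hy hu)
      (convAt_powKer hc hy (hs.const_mul _)), rlIntegral_const_mul]
    ring
  have hc : 1 ≤ 1 + μ := by linarith
  have h0 := rlIntegral_one_eq_zero hμ.le (hu.add (hs.const_mul (-1))) (ω := ω) (fun y hy => by
    rw [hsub 1 le_rfl y hy, hsub _ hc y hy, h y hy, rlIntegral_one_volterraSol hμ hβ hy ω a b hv,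
      rlIntegral_add (by linarith) hy.le (convAt_powKer hc hy hv)
      (convAt_powKer hc hy (hu.const_mul ω)), rlIntegral_const_mul,
      rlIntegral_add (by linarith) hy.le (convAt_powKer hc hy hv)
      (convAt_powKer hc hy (hs.const_mul ω)), rlIntegral_const_mul]
    ring) hy
  rw [hsub 1 le_rfl y hy] at h0
  exact sub_eq_zero.1 h0

theorem continuousOn_volterraSol {μ β : ℝ} (hμ : 1 < μ) (hβ : β < 1) (ω a b : ℂ) {v : ℝ → ℂ}
    (hv : LocInt v) : ContinuousOn (volterraSol μ β ω a b v) (Ioi 0) := by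
  have h1 := continuousOn_mlKer hμ.le (by linarith : 0 < 1 - β) ω
  have h2 := continuousOn_mlKer hμ.le (by linarith : 0 < 2 - β) ω
  have h3 := continuousOn_causalConv (continuous_mlKer hμ.le hμ.le ω).continuousOn
    (mlKer_zero hμ ω) hv
  unfold volterraSol
  fun_prop

theorem hasDerivAt_rlIntegral_one {w : ℝ → ℂ} (hw : LocInt w) (hwc : ContinuousOn w (Ioi 0))
    {y : ℝ} (hy : 0 < y) : HasDerivAt (rlIntegral 1 w) (w y) y := by
  rw [funext (rlIntegral_one w)]
  exact intervalIntegral.integral_hasDerivAt_right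
    ((intervalIntegrable_iff_integrableOn_Ioc_of_le hy.le).2 (hw y hy))
    (hwc.stronglyMeasurableAtFilter isOpen_Ioi y hy) (hwc.continuousAt (Ioi_mem_nhds hy))

/-- Continuous functions with the same primitive agree. -/
theorem eq_of_rlIntegral_one_eq {u v : ℝ → ℂ} (hu : LocInt u) (hv : LocInt v)
    (huc : ContinuousOn u (Ioi 0)) (hvc : ContinuousOn v (Ioi 0))
    (h : ∀ y, 0 < y → rlIntegral 1 u y = rlIntegral 1 v y) {y : ℝ} (hy : 0 < y) : u y = v y := by
  refine (hasDerivAt_rlIntegral_one hu huc hy).unique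
    ((hasDerivAt_rlIntegral_one hv hvc hy).congr_of_eventuallyEq ?_)
  filter_upwards [Ioi_mem_nhds hy] with z hz using h z hz

theorem tendsto_rlIntegral_one {w : ℝ → ℂ} (hw : LocInt w) :
    Tendsto (rlIntegral 1 w) (𝓝[>] 0) (𝓝 0) := by
  have h := continuousOn_rlIntegral_one hw 0 (mem_Ici.2 le_rfl)
  have h0 : rlIntegral 1 w 0 = 0 := by simp [rlIntegral_one]
  rw [ContinuousWithinAt, h0] at h
  exact h.mono_left (nhdsWithin_mono _ Ioi_subset_Ici_self)

/-- Converse of Taylor's formula: regularity and initial values of a twofold integral. -/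
theorem taylor_converse {U p : ℝ → ℂ} {a b : ℂ} (hp : LocInt p) (hpc : ContinuousOn p (Ioi 0))
    (hU : ∀ y, 0 < y → U y = a + (y : ℂ) * b + rlIntegral 2 p y) :
    (∀ y, 0 < y → DifferentiableAt ℝ U y ∧ DifferentiableAt ℝ (deriv U) y ∧
      iteratedDeriv 2 U y = p y) ∧
      Tendsto U (𝓝[>] 0) (𝓝 a) ∧ Tendsto (deriv U) (𝓝[>] 0) (𝓝 b) := by
  have hU' : ∀ y, 0 < y → U y = a + (y : ℂ) * b + rlIntegral 1 (rlIntegral 1 p) y := by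
    intro y hy
    rw [hU y hy, rlIntegral_rlIntegral one_pos zero_le_one (by norm_num) hy (hp y hy)]
    norm_num
  have h1l := hp.rlIntegral le_rfl
  have hev : ∀ y : ℝ, 0 < y → ∀ᶠ z in 𝓝 y, 0 < z := fun y hy => Ioi_mem_nhds hy
  have hid : ∀ y : ℝ, HasDerivAt (fun z : ℝ => (z : ℂ)) 1 y := fun y => Complex.ofRealCLM.hasDerivAt
  have hd1 : ∀ y, 0 < y → HasDerivAt U (b + rlIntegral 1 p y) y := by
    intro y hy
    have h2 := ((((hid y).mul_const b).const_add a).add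
      (hasDerivAt_rlIntegral_one h1l (continuousOn_rlIntegral_of_one_le le_rfl hp) hy))
    rw [one_mul] at h2
    exact h2.congr_of_eventuallyEq ((hev y hy).mono fun z hz => hU' z hz)
  have hd2 : ∀ y, 0 < y → HasDerivAt (deriv U) (p y) y := by
    intro y hy
    exact ((hasDerivAt_rlIntegral_one hp hpc hy).const_add b).congr_of_eventuallyEq
      ((hev y hy).mono fun z hz => (hd1 z hz).deriv)
  refine ⟨fun y hy => ⟨(hd1 y hy).differentiableAt, (hd2 y hy).differentiableAt, ?_⟩, ?_, ?_⟩
  · rw [iteratedDeriv_succ, iteratedDeriv_one]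
    exact (hd2 y hy).deriv
  · have h0 : Tendsto (fun y : ℝ => a + (y : ℂ) * b + rlIntegral 1 (rlIntegral 1 p) y) (𝓝[>] 0)
        (𝓝 (a + ((0 : ℝ) : ℂ) * b + 0)) := by
      refine Tendsto.add (tendsto_const_nhds.add (Tendsto.mul_const b ?_))
        (tendsto_rlIntegral_one h1l)
      exact (Complex.continuous_ofReal.tendsto 0).mono_left nhdsWithin_le_nhds
    simp only [Complex.ofReal_zero, zero_mul, add_zero] at h0
    refine h0.congr' ?_
    filter_upwards [self_mem_nhdsWithin] with y hy using (hU' y hy).symm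
  · have h0 := (tendsto_rlIntegral_one hp).const_add b
    rw [add_zero] at h0
    refine h0.congr' ?_
    filter_upwards [self_mem_nhdsWithin] with y hy using (hd1 y hy).deriv.symm

/-! ### Integrable functions on strips -/

/-- Integrability on every strip `ℝ × (0, Y)`. -/
def StripInt (H : ℝ → ℝ → ℂ) : Prop :=
  ∀ Y, 0 < Y → IntegrableOn (fun p : ℝ × ℝ => H p.1 p.2) (univ ×ˢ Ioo 0 Y)

theorem restrict_strip (s : Set ℝ) :
    (volume : Measure (ℝ × ℝ)).restrict (univ ×ˢ s) = volume.prod (volume.restrict s) := by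
  rw [Measure.volume_eq_prod, ← Measure.prod_restrict, Measure.restrict_univ]

theorem StripInt.locInt_integral {H : ℝ → ℝ → ℂ} (hH : StripInt H) :
    LocInt (fun t => ∫ x, H x t) := by
  intro Y hY
  have h := hH Y hY
  rw [IntegrableOn, restrict_strip] at h
  rw [integrableOn_Ioc_iff_integrableOn_Ioo]
  exact h.integral_prod_right

theorem StripInt.locInt_integral_norm {H : ℝ → ℝ → ℂ} (hH : StripInt H) {Y : ℝ} (hY : 0 < Y) :
    IntegrableOn (fun t => ∫ x, ‖H x t‖) (Ioo 0 Y) := by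
  have h := hH Y hY
  rw [IntegrableOn, restrict_strip] at h
  exact h.norm.integral_prod_right

theorem LocInt.of_nat {u : ℝ → ℂ} (h : ∀ n : ℕ, IntegrableOn u (Ioo 0 ((n : ℝ) + 1))) :
    LocInt u := by
  intro Y _
  obtain ⟨n, hn⟩ := exists_nat_gt Y
  exact (h n).mono_set fun t ht => ⟨ht.1, by linarith [ht.2]⟩

theorem StripInt.locInt_slice {H : ℝ → ℝ → ℂ} (hH : StripInt H) : ∀ᵐ x, LocInt (H x) := by
  have h : ∀ n : ℕ, ∀ᵐ x, IntegrableOn (H x) (Ioo 0 ((n : ℝ) + 1)) := by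
    intro n
    have h := hH (n + 1) (by positivity)
    rw [IntegrableOn, restrict_strip] at h
    exact h.prod_right_ae
  rw [← ae_all_iff] at h
  filter_upwards [h] with x hx using LocInt.of_nat hx

/-- A function integrable on strips up to a polynomial weight becomes integrable after
multiplication by a Schwartz function. -/
theorem stripInt_mul_schwartz {H : ℝ → ℝ → ℂ} (hH : ∀ Y : ℝ, 0 < Y → ∃ m : ℕ,
      IntegrableOn (fun p : ℝ × ℝ => (((1 + |p.1|) ^ m)⁻¹ : ℝ) • H p.1 p.2) (univ ×ˢ Ioo 0 Y))
    (ψ : 𝓢(ℝ, ℂ)) : StripInt (fun x t => H x t * ψ x) := by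
  intro Y hY
  obtain ⟨m, hm⟩ := hH Y hY
  obtain ⟨C, hC⟩ := exists_norm_weight_mul_schwartz_le ψ m
  simp_rw [fun p : ℝ × ℝ => schwartz_mul_eq_weight (m := m) (H p.1 p.2) (ψ p.1) p.1]
  refine Integrable.mul_bdd (c := C) hm (Continuous.aestronglyMeasurable ?_)
    (Eventually.of_forall fun p => ?_)
  · have := ψ.continuous; fun_prop
  · rw [norm_smul, Real.norm_of_nonneg (by positivity)]; exact hC p.1

theorem locInt_slice_of_weight {H : ℝ → ℝ → ℂ} (hH : ∀ Y : ℝ, 0 < Y → ∃ m : ℕ,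
      IntegrableOn (fun p : ℝ × ℝ => (((1 + |p.1|) ^ m)⁻¹ : ℝ) • H p.1 p.2) (univ ×ˢ Ioo 0 Y)) :
    ∀ᵐ x, LocInt (H x) := by
  have h : ∀ n : ℕ, ∀ᵐ x, IntegrableOn (H x) (Ioo 0 ((n : ℝ) + 1)) := by
    intro n
    obtain ⟨m, h⟩ := hH (n + 1) (by positivity)
    rw [IntegrableOn, restrict_strip] at h
    filter_upwards [h.prod_right_ae] with x hx
    have h0 : ((1 + |x|) ^ m) ≠ 0 := by positivity
    refine (hx.smul ((1 + |x|) ^ m)).congr (Eventually.of_forall fun t => ?_)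
    simp only [Pi.smul_apply, smul_smul]
    rw [mul_inv_cancel₀ h0, one_smul]
  rw [← ae_all_iff] at h
  filter_upwards [h] with x hx using LocInt.of_nat hx

/-! ### The transformed source term -/

theorem iUnion_strip : (⋃ n : ℕ, (univ : Set ℝ) ×ˢ Ioo (0 : ℝ) ((n : ℝ) + 1)) = univ ×ˢ Ioi 0 := by
  ext p
  simp only [mem_iUnion, mem_prod, mem_univ, true_and, mem_Ioo, mem_Ioi]
  constructor
  · rintro ⟨_, h, _⟩; exact h
  · intro h
    obtain ⟨n, hn⟩ := exists_nat_gt p.2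
    exact ⟨n, h, by linarith⟩

/-- The Fourier transform in `x` of a function integrable on strips agrees, for almost every `t`,
with a jointly measurable function dominated by a locally integrable function of `t`. -/
theorem exists_measurable_fourierT {Φ : ℝ → ℝ → ℂ} (hΦ : StripInt Φ) :
    ∃ (V : ℝ → ℝ → ℂ) (M : ℝ → ℝ), Measurable (fun p : ℝ × ℝ => V p.1 p.2) ∧
      (∀ κ t, ‖V κ t‖ ≤ M t) ∧ (∀ Y, 0 < Y → IntegrableOn M (Ioc 0 Y)) ∧
      ∀ᵐ t, 0 < t → ∀ κ, fourierT (fun x => Φ x t) κ = V κ t := by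
  have hm : AEStronglyMeasurable (fun p : ℝ × ℝ => Φ p.1 p.2)
      (volume.restrict (univ ×ˢ Ioi 0)) := by
    rw [← iUnion_strip, aestronglyMeasurable_iUnion_iff]
    exact fun n => (hΦ _ (by positivity)).aestronglyMeasurable
  set F := hm.mk with hF
  have hFm : StronglyMeasurable F := hm.stronglyMeasurable_mk
  have hFe : (fun p : ℝ × ℝ => Φ p.1 p.2) =ᵐ[volume.restrict (univ ×ˢ Ioi 0)] F := hm.ae_eq_mk
  have hFi : StripInt (fun x t => F (x, t)) := fun Y hY =>
    (hΦ Y hY).congr (ae_restrict_of_ae_restrict_of_subset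
      (prod_mono le_rfl Ioo_subset_Ioi_self) hFe)
  refine ⟨fun κ t => fourierT (fun x => F (x, t)) κ, fun t => ∫ x, ‖F (x, t)‖, ?_, ?_, ?_, ?_⟩
  · unfold fourierT
    have : StronglyMeasurable (fun q : (ℝ × ℝ) × ℝ =>
        F (q.2, q.1.2) * Complex.exp (Complex.I * ((q.1.1 * q.2 : ℝ) : ℂ))) := by
      refine StronglyMeasurable.mul (hFm.comp_measurable (by fun_prop)) ?_
      exact Measurable.stronglyMeasurable (by fun_prop)
    exact this.integral_prod_right'.measurable
  · exact fun κ t => norm_fourierT_le _ _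
  · intro Y hY
    rw [integrableOn_Ioc_iff_integrableOn_Ioo]
    exact hFi.locInt_integral_norm hY
  · rw [restrict_strip] at hFe
    have h1 := Measure.ae_ae_of_ae_prod (Measure.measurePreserving_swap.quasiMeasurePreserving.ae hFe)
    rw [ae_restrict_iff' measurableSet_Ioi] at h1
    filter_upwards [h1] with t ht h0 κ
    have := fourierT_congr_ae (ht h0)
    exact congrFun this κ

/-! ### Solutions on the Fourier side -/

theorem hilferDeriv_eq {μ : ℝ} (hμ : 1 < μ) (hμ' : μ ≤ 2) (ν : ℝ) (u : ℝ → ℂ) (y : ℝ) :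
    hilferDeriv μ ν u y = rlIntegral (ν * (2 - μ))
      (iteratedDeriv 2 (rlIntegral ((1 - ν) * (2 - μ)) u)) y := by
  have h : ⌈μ⌉₊ = 2 := by
    rw [Nat.ceil_eq_iff (by norm_num)]
    exact ⟨by norm_num; exact hμ, by exact_mod_cast hμ'⟩
  unfold hilferDeriv
  rw [h]
  norm_num

section Solution

variable {α θ μ ν k : ℝ} {f g : ℝ → ℂ} {Φ N Nh : ℝ → ℝ → ℂ}

theorem FracHelmholtz.IsSolution.continuous_slice (hN : IsSolution α θ μ ν k f g Φ N) {y : ℝ}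
    (hy : 0 < y) : Continuous (fun x => N x y) :=
  hN.continuousOn.comp_continuous (by fun_prop : Continuous fun x : ℝ => (x, y))
    fun _ => ⟨mem_univ _, hy⟩

theorem FracHelmholtz.IsSolution.eq_invFourierT (hN : IsSolution α θ μ ν k f g Φ N)
    (hNh : ∀ y : ℝ, 0 < y → HasFourierT (fun x => N x y) (fun κ => Nh κ y) ∧
      Integrable (fun κ => Nh κ y)) {y : ℝ} (hy : 0 < y) (x : ℝ) :
    N x y = invFourierT (fun κ => Nh κ y) x :=
  congrFun ((hNh y hy).1.eq_invFourierT (hNh y hy).2 (hN.continuous_slice hy)) x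

/-- Near `y = 0` a solution is dominated by the integral of its Fourier transform. -/
theorem FracHelmholtz.IsSolution.stripInt_mul (hN : IsSolution α θ μ ν k f g Φ N)
    (hNh : ∀ y : ℝ, 0 < y → HasFourierT (fun x => N x y) (fun κ => Nh κ y) ∧
      Integrable (fun κ => Nh κ y)) (hNh' : StripInt Nh) (ψ : 𝓢(ℝ, ℂ)) :
    StripInt (fun x t => N x t * ψ x) := by
  intro Y hY
  have hψ : Integrable (fun x => ‖ψ x‖) := ψ.integrable.norm
  have h1 := (hψ.mul_prod ((hNh'.locInt_integral_norm hY).const_mul (1 / (2 * Real.pi))))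
  rw [IntegrableOn, restrict_strip]
  refine Integrable.mono' h1 ?_ ?_
  · have h2 : ContinuousOn (fun p : ℝ × ℝ => N p.1 p.2 * ψ p.1) (univ ×ˢ Ioo 0 Y) := by
      have := ψ.continuous
      exact (hN.continuousOn.mono (prod_mono le_rfl Ioo_subset_Ioi_self)).mul
        (Continuous.continuousOn (by fun_prop))
    have h3 := h2.aestronglyMeasurable (μ := volume) (MeasurableSet.univ.prod measurableSet_Ioo)
    rwa [restrict_strip] at h3
  · rw [← restrict_strip]
    filter_upwards [ae_restrict_mem (MeasurableSet.univ.prod measurableSet_Ioo)] with p hp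
    rw [norm_mul, mul_comm, hN.eq_invFourierT hNh hp.2.1]
    gcongr
    exact norm_invFourierT_le _ _

theorem isTempered_fourierT {f : ℝ → ℂ} (hf : Integrable f) :
    IsTempered (fourierT f) :=
  isTempered_of_bounded (continuous_fourierT hf).aestronglyMeasurable (norm_fourierT_le f)

/-- The equation paired with the Fourier transform of a Schwartz function, after integration to
total order `3 - β` in `y`. -/
theorem FracHelmholtz.IsSolution.pairing_equation (hμ : 1 < μ) (hμ' : μ ≤ 2) (hν : 0 ≤ ν)
    (hν' : ν ≤ 1) (hf : Integrable f) (hg : Integrable g)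
    (hΦ : ∀ y : ℝ, 0 < y → Integrable (fun x => Φ x y)) {V : ℝ → ℝ → ℂ}
    (hV : ∀ᵐ t, 0 < t → ∀ κ, fourierT (fun x => Φ x t) κ = V κ t)
    (hN : IsSolution α θ μ ν k f g Φ N)
    (hNh : ∀ y : ℝ, 0 < y → HasFourierT (fun x => N x y) (fun κ => Nh κ y) ∧
      Integrable (fun κ => Nh κ y)) (hNh' : StripInt Nh) (φ : 𝓢(ℝ, ℂ)) {y : ℝ} (hy : 0 < y) :
    rlIntegral 1 (fun t => ∫ κ, Nh κ t * φ κ) y =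
      (∫ κ, fourierT f κ * φ κ) * powKer (2 - (1 - ν) * (2 - μ)) y +
      (∫ κ, fourierT g κ * φ κ) * powKer (3 - (1 - ν) * (2 - μ)) y +
      rlIntegral (1 + μ)
        (fun t => ∫ κ, (V κ t + (psi α θ κ - (k : ℂ) ^ 2) * Nh κ t) * φ κ) y := by
  set β := (1 - ν) * (2 - μ) with hβ
  set γ := ν * (2 - μ) with hγ
  have hβ0 : 0 ≤ β := mul_nonneg (by linarith) (by linarith)
  have hγ0 : 0 ≤ γ := mul_nonneg (by linarith) (by linarith)
  have hsum : β + γ + μ = 2 := by rw [hβ, hγ]; ring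
  obtain ⟨ψ, hψ⟩ := exists_schwartz_eq_fourierT φ
  have hpair : ∀ {F h : ℝ → ℂ}, HasFourierT F h → ∫ x, F x * ψ x = ∫ κ, h κ * φ κ := by
    intro F h hF
    rw [← hF.pairing φ]; simp_rw [hψ]
  set U2 : ℝ → ℝ → ℂ := fun x => iteratedDeriv 2 (rlIntegral β (N x)) with hU2
  set q : ℝ → ℂ := fun t => ∫ x, U2 x t * ψ x with hq
  have A1 := hN.stripInt_mul hNh hNh' ψ
  have A2 : StripInt (fun x t => U2 x t * ψ x) := stripInt_mul_schwartz hN.integrable_deriv ψ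
  have hql : LocInt q := A2.locInt_integral
  set n : ℝ → ℂ := fun t => ∫ x, N x t * ψ x with hn
  have hnl : LocInt n := A1.locInt_integral
  have hnN : ∀ t, 0 < t → n t = ∫ κ, Nh κ t * φ κ := fun t ht => hpair (hNh t ht).1
  have hfφ := hpair (hasFourierT_fourierT hf (isTempered_fourierT hf))
  have hgφ := hpair (hasFourierT_fourierT hg (isTempered_fourierT hg))
  have hfi := hf.isTempered.integrable_mul ψ
  have hgi := hg.isTempered.integrable_mul ψ
  rw [← hfφ, ← hgφ]
  set fφ := ∫ x, f x * ψ x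
  set gφ := ∫ x, g x * ψ x
  -- Taylor's formula in `y` with the boundary data, paired with `ψ`; as the kernel of `I^β` is
  -- unbounded, it commutes with the pairing only for almost every `t`
  have E1 : ∀ᵐ t, t ∈ Ioo 0 y → rlIntegral β n t =
      (fφ * powKer 1 t + gφ * powKer 2 t) + rlIntegral 2 q t := by
    filter_upwards [integral_rlIntegral_ae (H := fun x t => N x t * ψ x) hβ0 A1] with t ht ht0
    have h1 := (ht ht0.1).2
    simp_rw [rlIntegral_mul_const] at h1
    rw [← h1]
    have hi2 := integral_rlIntegral_of_one_le (H := fun x t => U2 x t * ψ x) (ρ := 2)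
      (by norm_num) ht0.1 (A2 t ht0.1)
    simp_rw [rlIntegral_mul_const] at hi2
    have h2 : (fun x => rlIntegral β (N x) t * ψ x) =ᵐ[volume] fun x =>
        (f x * ψ x + (t : ℂ) * (g x * ψ x)) + rlIntegral 2 (U2 x) t * ψ x := by
      filter_upwards [hN.differentiable, hN.boundary_f, hN.boundary_g,
        locInt_slice_of_weight (H := U2) hN.integrable_deriv] with x h1 h2 h3 h4
      have h5 : rlIntegral β (N x) t = f x + (t : ℂ) * g x + rlIntegral 2 (U2 x) t :=
        eq_add_rlIntegral_two (U := rlIntegral β (N x)) h1 h4 h2 h3 ht0.1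
      rw [h5]
      ring
    have e1 : powKer 1 t = 1 := by simp [powKer]
    have e2 : powKer 2 t = t := by
      simp only [powKer, Real.Gamma_two]; norm_num
    have hfg : Integrable (fun x => f x * ψ x + (t : ℂ) * (g x * ψ x)) := hfi.add (hgi.const_mul _)
    rw [integral_congr_ae h2, integral_add hfg hi2.1,
      integral_add hfi (hgi.const_mul _), integral_const_mul, hi2.2, e1, e2]
    ring
  -- the equation paired with `ψ`, where the Riesz–Feller derivative becomes its symbol
  have E2 : ∀ᵐ t, t ∈ Ioo 0 y → rlIntegral γ q t =
      ∫ κ, (V κ t + (psi α θ κ - (k : ℂ) ^ 2) * Nh κ t) * φ κ := by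
    obtain ⟨R, hR, heq⟩ := hN.equation
    filter_upwards [integral_rlIntegral_ae (H := fun x t => U2 x t * ψ x) hγ0 A2, hV] with t ht hVt ht0
    have h1 := (ht ht0.1).2
    simp_rw [rlIntegral_mul_const] at h1
    rw [← h1]
    obtain ⟨fh, hfh, hRfh⟩ := hR t ht0.1
    have hNt := (hNh t ht0.1).1
    have hRN : HasFourierT (fun x => R x t) (fun κ => -psi α θ κ * Nh κ t) := by
      refine hRfh.congr_right ?_
      filter_upwards [hfh.ae_eq_right hNt] with κ hκ
      rw [hκ]
    have hΦt : HasFourierT (fun x => Φ x t) (fun κ => V κ t) := by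
      have := hasFourierT_fourierT (hΦ t ht0.1) (isTempered_fourierT (hΦ t ht0.1))
      rwa [funext (hVt ht0.1)] at this
    have h2 : (fun x => rlIntegral γ (U2 x) t * ψ x) =ᵐ[volume] fun x =>
        (Φ x t * ψ x - R x t * ψ x) - (k : ℂ) ^ 2 * (N x t * ψ x) := by
      filter_upwards [heq t ht0.1] with x hx
      rw [hilferDeriv_eq hμ hμ'] at hx
      have hx' : R x t + rlIntegral γ (U2 x) t + (k : ℂ) ^ 2 * N x t = Φ x t := hx
      rw [← hx']; ring
    have i1 := hΦt.tempered_left.integrable_mul ψ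
    have i2 := hRN.tempered_left.integrable_mul ψ
    have i3 := (hNt.tempered_left.integrable_mul ψ).const_mul ((k : ℂ) ^ 2)
    have j1 := hΦt.tempered_right.integrable_mul φ
    have j2 := hRN.tempered_right.integrable_mul φ
    have j3 := (hNt.tempered_right.integrable_mul φ).const_mul ((k : ℂ) ^ 2)
    have i12 : Integrable (fun x => Φ x t * ψ x - R x t * ψ x) := i1.sub i2
    have j12 : Integrable (fun κ => V κ t * φ κ - -psi α θ κ * Nh κ t * φ κ) := j1.sub j2
    rw [integral_congr_ae h2, integral_sub i12 i3, integral_sub i1 i2, integral_const_mul,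
      hpair hΦt, hpair hRN, hpair hNt, ← integral_const_mul, ← integral_sub j1 j2,
      ← integral_sub j12 j3]
    congr 1; ext κ; ring
  have hβ1 : 0 < 1 - β := by linarith
  -- a further integration turns both almost everywhere identities into one at `y`
  calc rlIntegral 1 (fun t => ∫ κ, Nh κ t * φ κ) y = rlIntegral 1 n y :=
        rlIntegral_congr_ae one_pos hy.le (Eventually.of_forall fun t ht => (hnN t ht.1).symm)
    _ = rlIntegral (1 - β) (rlIntegral β n) y := by
        rw [rlIntegral_rlIntegral hβ1 hβ0 (by linarith) hy (hnl y hy), sub_add_cancel]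
    _ = rlIntegral (1 - β) (fun t => (fφ * powKer 1 t + gφ * powKer 2 t) + rlIntegral 2 q t) y :=
        rlIntegral_congr_ae hβ1 hy.le E1
    _ = fφ * powKer (2 - β) y + gφ * powKer (3 - β) y + rlIntegral (3 - β) q y := by
        have hc : ∀ c : ℝ, 1 ≤ c → ConvAt (powKer (1 - β)) (powKer c) y := fun c hc =>
          ConvAt.of_rpow hβ1 zero_lt_one (measurable_powKer _) (norm_powKer_le hβ1)
            (measurable_powKer _).aestronglyMeasurable
            (D := (Real.Gamma c)⁻¹ * y ^ (c - 1)) (fun t ht => by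
              have := Real.Gamma_pos_of_pos (by linarith : 0 < c)
              rw [norm_powKer (by linarith) ht.1.le, neg_zero, Real.rpow_zero, mul_one]
              gcongr
              · exact ht.1.le
              · exact ht.2)
        obtain ⟨C, hC⟩ : ∃ C, ∀ t ∈ Ioc 0 y, ‖rlIntegral 2 q t‖ ≤ C :=
          ⟨_, fun t ht => by
            rw [rlIntegral_eq_causalConv two_pos q ht.1.le]
            exact norm_causalConv_le (by
              have := Real.Gamma_pos_of_pos (two_pos : (0 : ℝ) < 2)
              positivity) (norm_powKer_le_of_one_le one_le_two) (hql y hy) ht.2⟩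
        have hc2 : ConvAt (powKer (1 - β)) (rlIntegral 2 q) y :=
          ConvAt.of_rpow hβ1 zero_lt_one (measurable_powKer _) (norm_powKer_le hβ1)
            ((hql.rlIntegral one_le_two) y hy).aestronglyMeasurable (D := C) (fun t ht => by
              rw [neg_zero, Real.rpow_zero, mul_one]; exact hC t ht)
        have k1 := (hc 1 le_rfl).const_mul fφ
        have k2 := (hc 2 one_le_two).const_mul gφ
        rw [rlIntegral_add hβ1 hy.le (k1.add k2) hc2, rlIntegral_add hβ1 hy.le k1 k2,
          rlIntegral_const_mul, rlIntegral_const_mul, rlIntegral_eq_causalConv hβ1 _ hy.le,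
          rlIntegral_eq_causalConv hβ1 _ hy.le, powKer_conv_powKer hβ1 one_pos hy,
          powKer_conv_powKer hβ1 two_pos hy,
          rlIntegral_rlIntegral hβ1 zero_le_two (by linarith) hy (hql y hy),
          show 1 - β + 1 = 2 - β by ring, show 1 - β + 2 = 3 - β by ring]
    _ = _ := by
        congr 1
        rw [show 3 - β = (1 + μ) + γ by linarith,
          ← rlIntegral_rlIntegral (by linarith) hγ0 (by linarith) hy (hql y hy)]
        exact rlIntegral_congr_ae (by linarith) hy.le E2

end Solution

/-! ### The representation formula on the Fourier side -/

theorem measurable_causalConv {K V : ℝ → ℝ → ℂ} (hK : Measurable (fun p : ℝ × ℝ => K p.1 p.2))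
    (hV : Measurable (fun p : ℝ × ℝ => V p.1 p.2)) :
    Measurable (fun p : ℝ × ℝ => causalConv (K p.1) (V p.1) p.2) := by
  have h1 : Measurable (fun q : (ℝ × ℝ) × ℝ => K q.1.1 (q.1.2 - q.2) * V q.1.1 q.2) :=
    (hK.comp (by fun_prop : Measurable fun q : (ℝ × ℝ) × ℝ => (q.1.1, q.1.2 - q.2))).mul
      (hV.comp (by fun_prop : Measurable fun q : (ℝ × ℝ) × ℝ => (q.1.1, q.2)))
  have hs : MeasurableSet {q : (ℝ × ℝ) × ℝ | q.2 ∈ Ioc 0 q.1.2} :=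
    (measurableSet_lt measurable_const measurable_snd).inter
      (measurableSet_le measurable_snd measurable_fst.snd)
  have h2 := (h1.indicator hs).stronglyMeasurable.integral_prod_right' (ν := volume)
  convert h2.measurable using 1
  ext p
  rw [causalConv, ← integral_indicator measurableSet_Ioc]
  rfl

theorem measurable_symbol (α θ k : ℝ) : Measurable (fun κ => psi α θ κ - (k : ℂ) ^ 2) :=
  (measurable_psi α θ).sub_const _

theorem measurable_volterraSol {μ β : ℝ} (hμ : 1 < μ) (hβ : β < 1) {ω a b : ℝ → ℂ} {V : ℝ → ℝ → ℂ}
    (hω : Measurable ω) (ha : Measurable a) (hb : Measurable b)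
    (hV : Measurable (fun p : ℝ × ℝ => V p.1 p.2)) :
    Measurable (fun p : ℝ × ℝ => volterraSol μ β (ω p.1) (a p.1) (b p.1) (V p.1) p.2) := by
  unfold volterraSol
  have h1 := measurable_mlKer hμ.le (by linarith : 0 < 1 - β) (hω.comp measurable_fst)
    (measurable_snd : Measurable (Prod.snd : ℝ × ℝ → ℝ))
  have h2 := measurable_mlKer hμ.le (by linarith : 0 < 2 - β) (hω.comp measurable_fst)
    (measurable_snd : Measurable (Prod.snd : ℝ × ℝ → ℝ))
  have h3 := measurable_mlKer hμ.le (by linarith : 0 < μ) (hω.comp measurable_fst)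
    (measurable_snd : Measurable (Prod.snd : ℝ × ℝ → ℝ))
  exact (((ha.comp measurable_fst).mul h1).add ((hb.comp measurable_fst).mul h2)).add
    (measurable_causalConv (K := fun κ => mlKer μ μ (ω κ)) h3 hV)

/-- The integrand of the solution formula is the solution of the Volterra equation. -/
theorem terms_eq_volterraSol (α θ μ ν k : ℝ) (f g : ℝ → ℂ) {Φ V : ℝ → ℝ → ℂ}
    (hV : ∀ᵐ t, 0 < t → ∀ κ, fourierT (fun x => Φ x t) κ = V κ t) {y : ℝ} (hy : 0 < y) (κ : ℝ) :
    ((y ^ (-((1 - ν) * (2 - μ))) : ℝ) : ℂ) * termF α θ μ ν k f y κ +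
      ((y ^ (1 - (1 - ν) * (2 - μ)) : ℝ) : ℂ) * termG α θ μ ν k g y κ + termPhi α θ μ k Φ y κ =
    volterraSol μ ((1 - ν) * (2 - μ)) (psi α θ κ - (k : ℂ) ^ 2) (fourierT f κ) (fourierT g κ)
      (V κ) y := by
  have h : termPhi α θ μ k Φ y κ = causalConv (mlKer μ μ (psi α θ κ - (k : ℂ) ^ 2)) (V κ) y := by
    rw [causalConv_congr (u' := fun t => fourierT (fun x => Φ x t) κ) (fun _ _ => rfl)
      (by filter_upwards [hV] with t ht ht0 using (ht ht0.1 κ).symm), termPhi, prabhakarOp,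
      intervalIntegral.integral_of_le hy.le]
    unfold causalConv mlKer
    simp_rw [prabhakarML_one]
  rw [h, termF, termG, volterraSol]
  unfold mlKer
  rw [show 1 - (1 - ν) * (2 - μ) - 1 = -((1 - ν) * (2 - μ)) by ring,
    show 2 - (1 - ν) * (2 - μ) - 1 = 1 - (1 - ν) * (2 - μ) by ring,
    mul_comm ((y ^ μ : ℝ) : ℂ)]
  ring

/-- Bound of the explicit solution, uniform for bounded parameters. -/
theorem exists_norm_volterraSol_le {μ β r Y : ℝ} (hμ : 1 < μ) (hβ0 : 0 ≤ β) (hβ : β < 1)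
    (hr : 0 ≤ r) (hY : 0 < Y) : ∃ C : ℝ, 0 ≤ C ∧ ∀ ω : ℂ, ‖ω‖ ≤ r ^ μ → ∀ (a b : ℂ) (v : ℝ → ℂ),
      LocInt v → ∀ t ∈ Ioc 0 Y, ‖volterraSol μ β ω a b v t‖ ≤
        C * (‖a‖ + ‖b‖ + ∫ s in Ioc 0 Y, ‖v s‖) * t ^ (-β) := by
  have hΓ : ∀ c : ℝ, 0 < c → 0 ≤ (1 + (Real.Gamma c)⁻¹) * 2 * Real.exp (4 + 4 * (r * Y)) :=
    fun c hc => by have := Real.Gamma_pos_of_pos hc; positivity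
  obtain ⟨c₁, hc₁⟩ : ∃ c, c = (1 + (Real.Gamma (1 - β))⁻¹) * 2 * Real.exp (4 + 4 * (r * Y)) := ⟨_, rfl⟩
  obtain ⟨c₂, hc₂⟩ : ∃ c, c = (1 + (Real.Gamma (2 - β))⁻¹) * 2 * Real.exp (4 + 4 * (r * Y)) := ⟨_, rfl⟩
  obtain ⟨c₃, hc₃⟩ : ∃ c, c = (1 + (Real.Gamma μ)⁻¹) * 2 * Real.exp (4 + 4 * (r * Y)) := ⟨_, rfl⟩
  have h1 : 0 ≤ c₁ := hc₁ ▸ hΓ _ (by linarith)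
  have h2 : 0 ≤ c₂ := hc₂ ▸ hΓ _ (by linarith)
  have h3 : 0 ≤ c₃ := hc₃ ▸ hΓ _ (by linarith)
  refine ⟨c₁ + c₂ * Y + c₃ * Y ^ (μ - 1) * Y ^ β, by positivity, fun ω hω a b v hv t ht => ?_⟩
  have ht0 : 0 < t := ht.1
  have b1 : ‖mlKer μ (1 - β) ω t‖ ≤ c₁ * t ^ (-β) := by
    have := norm_mlKer_le hμ.le (by linarith : 0 < 1 - β) hr hω t ht
    rwa [show 1 - β - 1 = -β by ring, ← hc₁] at this
  have b2 : ‖mlKer μ (2 - β) ω t‖ ≤ c₂ * Y * t ^ (-β) := by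
    have := norm_mlKer_le hμ.le (by linarith : 0 < 2 - β) hr hω t ht
    rw [show 2 - β - 1 = 1 + -β by ring, Real.rpow_add ht0, Real.rpow_one, ← hc₂] at this
    refine this.trans ?_
    rw [mul_assoc]
    gcongr
    exact ht.2
  have b3 : ‖causalConv (mlKer μ μ ω) v t‖ ≤ c₃ * Y ^ (μ - 1) * ∫ s in Ioc 0 Y, ‖v s‖ := by
    refine norm_causalConv_le (by positivity) (fun s hs => ?_) (hv Y hY) ht.2
    refine (norm_mlKer_le hμ.le (by linarith : 0 < μ) hr hω s ⟨hs.1, hs.2.le⟩).trans ?_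
    rw [← hc₃]
    gcongr
    · exact hs.1.le
    · exact hs.2.le
  have hone : 1 ≤ Y ^ β * t ^ (-β) := by
    rw [Real.rpow_neg ht0.le, ← div_eq_mul_inv, ← Real.div_rpow hY.le ht0.le]
    exact Real.one_le_rpow ((one_le_div ht0).2 ht.2) hβ0
  have hI : 0 ≤ ∫ s in Ioc 0 Y, ‖v s‖ := integral_nonneg fun _ => norm_nonneg _
  set I := ∫ s in Ioc 0 Y, ‖v s‖
  have htβ : 0 ≤ t ^ (-β) := by positivity
  calc ‖volterraSol μ β ω a b v t‖ ≤ ‖a‖ * (c₁ * t ^ (-β)) + ‖b‖ * (c₂ * Y * t ^ (-β)) +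
        c₃ * Y ^ (μ - 1) * I * (Y ^ β * t ^ (-β)) := by
        unfold volterraSol
        refine (norm_add₃_le).trans ?_
        rw [norm_mul, norm_mul]
        gcongr
        exact b3.trans (le_mul_of_one_le_right (by positivity) hone)
    _ ≤ _ := by
        have e1 : 0 ≤ c₂ * Y + c₃ * Y ^ (μ - 1) * Y ^ β := by positivity
        have e2 : 0 ≤ c₁ + c₃ * Y ^ (μ - 1) * Y ^ β := by positivity
        have e3 : 0 ≤ c₁ + c₂ * Y := by positivity
        have p1 : 0 ≤ (‖a‖ * (c₂ * Y + c₃ * Y ^ (μ - 1) * Y ^ β) +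
          ‖b‖ * (c₁ + c₃ * Y ^ (μ - 1) * Y ^ β) + I * (c₁ + c₂ * Y)) * t ^ (-β) := by positivity
        linear_combination p1

theorem norm_symbol_le_weight {α : ℝ} (hα : 0 ≤ α) (hα' : α ≤ 2) (θ k κ : ℝ) :
    ‖psi α θ κ - (k : ℂ) ^ 2‖ ≤ (1 + k ^ 2) * (1 + |κ|) ^ 4 := by
  have h0 : 0 ≤ |κ| := abs_nonneg κ
  calc ‖psi α θ κ - (k : ℂ) ^ 2‖ ≤ ‖psi α θ κ‖ + ‖(k : ℂ) ^ 2‖ := norm_sub_le _ _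
    _ = |κ| ^ α + k ^ 2 := by rw [norm_psi]; simp
    _ ≤ (1 + |κ|) ^ 4 + k ^ 2 * (1 + |κ|) ^ 4 := by
      gcongr
      · calc |κ| ^ α ≤ (1 + |κ|) ^ α := by gcongr; linarith
          _ ≤ (1 + |κ|) ^ ((4 : ℕ) : ℝ) :=
            Real.rpow_le_rpow_of_exponent_le (by linarith) (by push_cast; linarith)
          _ = _ := Real.rpow_natCast _ _
      · exact le_mul_of_one_le_right (by positivity) (one_le_pow₀ (by linarith))
    _ = _ := by ring

theorem integrableOn_weight_source {α : ℝ} (hα : 0 ≤ α) (hα' : α ≤ 2) (θ k : ℝ) {V Nh : ℝ → ℝ → ℂ}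
    {M : ℝ → ℝ} (hVm : Measurable (fun p : ℝ × ℝ => V p.1 p.2)) (hVM : ∀ κ t, ‖V κ t‖ ≤ M t)
    (hM : ∀ Y, 0 < Y → IntegrableOn M (Ioc 0 Y)) (hNh : StripInt Nh) {Y : ℝ} (hY : 0 < Y) :
    IntegrableOn (fun p : ℝ × ℝ => (((1 + |p.1|) ^ 4)⁻¹ : ℝ) •
      (V p.1 p.2 + (psi α θ p.1 - (k : ℂ) ^ 2) * Nh p.1 p.2)) (univ ×ˢ Ioo 0 Y) := by
  simp_rw [smul_add]
  apply Integrable.add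
  · rw [restrict_strip]
    have hMi : IntegrableOn M (Ioo 0 Y) := (hM Y hY).mono_set Ioo_subset_Ioc_self
    refine Integrable.mono' (integrable_weight_two.mul_prod hMi) ?_ ?_
    · have hw : Measurable (fun p : ℝ × ℝ => ((1 + |p.1|) ^ 4)⁻¹) := by fun_prop
      exact (hw.smul hVm).aestronglyMeasurable
    · refine Eventually.of_forall fun p => ?_
      rw [norm_smul, Real.norm_of_nonneg (by positivity)]
      gcongr
      · linarith [abs_nonneg p.1]
      · norm_num
      · exact hVM _ _
  · refine Integrable.mono' ((hNh Y hY).norm.const_mul (1 + k ^ 2)) ?_ ?_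
    · have hw : AEStronglyMeasurable (fun p : ℝ × ℝ => ((1 + |p.1|) ^ 4)⁻¹)
          (volume.restrict (univ ×ˢ Ioo 0 Y)) := Measurable.aestronglyMeasurable (by fun_prop)
      refine hw.smul ?_
      exact ((measurable_symbol α θ k).comp measurable_fst).aestronglyMeasurable.mul
        (hNh Y hY).aestronglyMeasurable
    · refine Eventually.of_forall fun p => ?_
      rw [norm_smul, Real.norm_of_nonneg (by positivity), norm_mul, ← mul_assoc]
      gcongr
      rw [inv_mul_le_iff₀ (by positivity), mul_comm]
      exact norm_symbol_le_weight hα hα' θ k p.1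

/-- Continuous functions on `(0, ∞)` are determined by their values at positive rationals. -/
theorem eq_of_forall_rat {u v : ℝ → ℂ} (hu : ContinuousOn u (Ioi 0)) (hv : ContinuousOn v (Ioi 0))
    (h : ∀ q : ℚ, (0 : ℝ) < q → u q = v q) {y : ℝ} (hy : 0 < y) : u y = v y := by
  have hE : EqOn u v (Ioi 0 ∩ range ((↑) : ℚ → ℝ)) := by
    rintro _ ⟨h0, q, rfl⟩; exact h q h0
  exact hE.of_subset_closure hu hv inter_subset_left
    (Rat.denseRange_cast.open_subset_closure_inter isOpen_Ioi) hy

section Solution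

variable {α θ μ ν k : ℝ} {f g : ℝ → ℂ} {Φ N Nh : ℝ → ℝ → ℂ}

/-- Almost every slice of the transform of a solution satisfies the integrated Volterra equation. -/
theorem FracHelmholtz.IsSolution.volterra_equation (hα : 0 ≤ α) (hα' : α ≤ 2) (hμ : 1 < μ)
    (hμ' : μ ≤ 2) (hν : 0 ≤ ν)
    (hν' : ν ≤ 1) (hf : Integrable f) (hg : Integrable g)
    (hΦ : ∀ y : ℝ, 0 < y → Integrable (fun x => Φ x y)) {V : ℝ → ℝ → ℂ} {M : ℝ → ℝ}
    (hVm : Measurable (fun p : ℝ × ℝ => V p.1 p.2)) (hVM : ∀ κ t, ‖V κ t‖ ≤ M t)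
    (hM : ∀ Y, 0 < Y → IntegrableOn M (Ioc 0 Y))
    (hV : ∀ᵐ t, 0 < t → ∀ κ, fourierT (fun x => Φ x t) κ = V κ t)
    (hN : IsSolution α θ μ ν k f g Φ N)
    (hNh : ∀ y : ℝ, 0 < y → HasFourierT (fun x => N x y) (fun κ => Nh κ y) ∧
      Integrable (fun κ => Nh κ y)) (hNh' : StripInt Nh) :
    ∀ᵐ κ, ∀ y, 0 < y → rlIntegral 1 (Nh κ) y =
      fourierT f κ * powKer (2 - (1 - ν) * (2 - μ)) y +
      fourierT g κ * powKer (3 - (1 - ν) * (2 - μ)) y +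
      rlIntegral (1 + μ) (fun t => V κ t + (psi α θ κ - (k : ℂ) ^ 2) * Nh κ t) y := by
  set β := (1 - ν) * (2 - μ) with hβ
  have hβ1 : β < 1 := by
    have : β ≤ 2 - μ := by rw [hβ]; nlinarith
    linarith
  set H : ℝ → ℝ → ℂ := fun κ t => V κ t + (psi α θ κ - (k : ℂ) ^ 2) * Nh κ t with hH
  have hw : ∀ Y : ℝ, 0 < Y → ∃ m : ℕ, IntegrableOn
      (fun p : ℝ × ℝ => (((1 + |p.1|) ^ m)⁻¹ : ℝ) • H p.1 p.2) (univ ×ˢ Ioo 0 Y) := fun Y hY =>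
    ⟨4, integrableOn_weight_source hα hα' θ k hVm hVM hM hNh' hY⟩
  have hfc := continuous_fourierT hf
  have hgc := continuous_fourierT hg
  -- at a fixed `y` the exceptional set of `κ` depends on `y`
  have key : ∀ y, 0 < y → ∀ᵐ κ, rlIntegral 1 (Nh κ) y = fourierT f κ * powKer (2 - β) y +
      fourierT g κ * powKer (3 - β) y + rlIntegral (1 + μ) (H κ) y := by
    intro y hy
    have hR1 := (integral_rlIntegral_of_one_le le_rfl hy (hNh' y hy)).1
    have hR2 : IsTempered (fun κ => rlIntegral (1 + μ) (H κ) y) := by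
      refine ⟨4, ?_⟩
      have := (integral_rlIntegral_of_one_le (H := fun κ t => (((1 + |κ|) ^ 4)⁻¹ : ℝ) • H κ t)
        (by linarith : 1 ≤ 1 + μ) hy
        (integrableOn_weight_source hα hα' θ k hVm hVM hM hNh' hy)).1
      simp_rw [Complex.real_smul, rlIntegral_const_mul] at this
      simp_rw [Complex.real_smul]
      exact this
    have hfg : LocallyIntegrable (fun κ => fourierT f κ * powKer (2 - β) y +
        fourierT g κ * powKer (3 - β) y) :=
      Continuous.locallyIntegrable (by fun_prop)
    have hloc : LocallyIntegrable (fun κ => fourierT f κ * powKer (2 - β) y +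
        fourierT g κ * powKer (3 - β) y + rlIntegral (1 + μ) (H κ) y) :=
      hfg.add hR2.locallyIntegrable
    refine ae_eq_of_forall_integral_mul_schwartz hR1.locallyIntegrable hloc fun φ _ => ?_
    have hE := hN.pairing_equation hμ hμ' hν hν' hf hg hΦ hV hNh hNh' φ hy
    have e1 := (integral_rlIntegral_of_one_le (H := fun κ t => Nh κ t * φ κ) le_rfl hy
      (stripInt_mul_schwartz (fun Y hY => ⟨0, by simpa using hNh' Y hY⟩) φ y hy)).2
    have e2 := integral_rlIntegral_of_one_le (H := fun κ t => H κ t * φ κ)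
      (by linarith : 1 ≤ 1 + μ) hy (stripInt_mul_schwartz hw φ y hy)
    simp_rw [rlIntegral_mul_const] at e1 e2
    rw [e1, hE, ← e2.2]
    have i1 := (isTempered_fourierT hf).integrable_mul φ
    have i2 := (isTempered_fourierT hg).integrable_mul φ
    rw [← integral_mul_const, ← integral_mul_const,
      ← integral_add (i1.mul_const _) (i2.mul_const _)]
    have i12 : Integrable (fun κ => fourierT f κ * φ κ * powKer (2 - β) y +
      fourierT g κ * φ κ * powKer (3 - β) y) := (i1.mul_const _).add (i2.mul_const _)
    rw [← integral_add i12 e2.1]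
    congr 1; ext κ; ring
  -- both sides are continuous in `y`, so a common exceptional set for rational `y` suffices
  have hall : ∀ᵐ κ, ∀ q : ℚ, (0 : ℝ) < q → rlIntegral 1 (Nh κ) q =
      fourierT f κ * powKer (2 - β) q + fourierT g κ * powKer (3 - β) q +
      rlIntegral (1 + μ) (H κ) q := by
    rw [ae_all_iff]
    intro q
    by_cases hq : (0 : ℝ) < q
    · filter_upwards [key q hq] with κ hκ _ using hκ
    · exact Eventually.of_forall fun κ h => absurd h hq
  filter_upwards [hall, hNh'.locInt_slice, locInt_slice_of_weight hw] with κ h1 h2 h3 y hy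
  have c1 := continuousOn_rlIntegral_of_one_le le_rfl h2
  have c2 := continuousOn_rlIntegral_of_one_le (by linarith : 1 ≤ 1 + μ) h3
  have c3 := (continuous_powKer (by linarith : 1 ≤ 2 - β)).continuousOn (s := Ioi 0)
  have c4 := (continuous_powKer (by linarith : 1 ≤ 3 - β)).continuousOn (s := Ioi 0)
  exact eq_of_forall_rat c1 (v := fun y => fourierT f κ * powKer (2 - β) y +
      fourierT g κ * powKer (3 - β) y + rlIntegral (1 + μ) (H κ) y) (by fun_prop) h1 hy

theorem Icc_half_mem_nhds {z : ℝ} (hz : 0 < z) : Icc (z / 2) (z + 1) ∈ 𝓝 z :=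
  Icc_mem_nhds (by linarith) (by linarith)

theorem FracHelmholtz.IsSolution.continuousOn_pairing (hN : IsSolution α θ μ ν k f g Φ N)
    (ψ : 𝓢(ℝ, ℂ)) : ContinuousOn (fun t => ∫ x, N x t * ψ x) (Ioi 0) := by
  intro z hz
  have hz0 : (0 : ℝ) < z := hz
  apply ContinuousAt.continuousWithinAt
  obtain ⟨C, hC⟩ := hN.bounded (z / 2) (z + 1) (by linarith)
  refine ContinuousOn.continuousAt (s := Icc (z / 2) (z + 1)) ?_ (Icc_half_mem_nhds hz0)
  apply continuousOn_of_dominated (bound := fun x => C * ‖ψ x‖)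
  · intro t ht
    exact ((hN.continuous_slice (by linarith [ht.1])).mul ψ.continuous).aestronglyMeasurable
  · intro t ht
    refine Eventually.of_forall fun x => ?_
    rw [norm_mul]
    gcongr
    exact hC x t ht
  · exact ψ.integrable.norm.const_mul C
  · refine Eventually.of_forall fun x => ContinuousOn.mul ?_ continuousOn_const
    exact hN.continuousOn.comp (by fun_prop : ContinuousOn (fun t : ℝ => (x, t)) _)
      fun t ht => ⟨mem_univ _, lt_of_lt_of_le (by linarith : (0 : ℝ) < z / 2) ht.1⟩

/-- Families with an integrable power singularity at `t = 0`, locally uniformly in `κ`, pair well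
with compactly supported test functions. -/
theorem pairing_of_rpow_bound {S : ℝ → ℝ → ℂ} {β : ℝ} (hβ0 : 0 ≤ β) (hβ1 : β < 1)
    (hSm : Measurable (fun p : ℝ × ℝ => S p.1 p.2)) (hSc : ∀ κ, ContinuousOn (S κ) (Ioi 0))
    (hSb : ∀ R Y, 0 ≤ R → 0 < Y → ∃ C, ∀ κ t, |κ| ≤ R → t ∈ Ioc 0 Y → ‖S κ t‖ ≤ C * t ^ (-β))
    (φ : 𝓢(ℝ, ℂ)) (hφ : HasCompactSupport φ) :
    StripInt (fun κ t => S κ t * φ κ) ∧ ContinuousOn (fun t => ∫ κ, S κ t * φ κ) (Ioi 0) := by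
  obtain ⟨R, hR⟩ := hφ.isBounded.exists_norm_le
  have hSφ : ∀ Y, 0 < Y → ∃ C, ∀ κ t, t ∈ Ioc 0 Y → ‖S κ t * φ κ‖ ≤ ‖φ κ‖ * (C * t ^ (-β)) := by
    intro Y hY
    obtain ⟨C, hC⟩ := hSb (max R 0) Y (le_max_right _ _) hY
    refine ⟨C, fun κ t ht => ?_⟩
    rw [norm_mul, mul_comm]
    by_cases hκ : κ ∈ tsupport φ
    · gcongr
      exact hC κ t ((hR κ hκ).trans (le_max_left _ _)) ht
    · rw [image_eq_zero_of_notMem_tsupport hκ]; simp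
  have hSφm : Measurable (fun p : ℝ × ℝ => S p.1 p.2 * φ p.1) :=
    hSm.mul (φ.continuous.measurable.comp measurable_fst)
  constructor
  · intro Y hY
    obtain ⟨C, hC⟩ := hSφ Y hY
    rw [IntegrableOn, restrict_strip]
    have hi : Integrable (fun t : ℝ => C * t ^ (-β)) (volume.restrict (Ioo 0 Y)) :=
      ((integrableOn_rpow_Ioc (by linarith) Y hY).mono_set Ioo_subset_Ioc_self).const_mul C
    refine Integrable.mono' (φ.integrable.norm.mul_prod hi) hSφm.aestronglyMeasurable ?_
    rw [← restrict_strip]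
    filter_upwards [ae_restrict_mem (MeasurableSet.univ.prod measurableSet_Ioo)] with p hp
    exact hC p.1 p.2 ⟨hp.2.1, hp.2.2.le⟩
  · intro z hz
    have hz0 : (0 : ℝ) < z := hz
    apply ContinuousAt.continuousWithinAt
    obtain ⟨C, hC⟩ := hSφ (z + 1) (by linarith)
    refine ContinuousOn.continuousAt (s := Icc (z / 2) (z + 1)) ?_ (Icc_half_mem_nhds hz0)
    apply continuousOn_of_dominated (bound := fun κ => ‖φ κ‖ * (|C| * (z / 2) ^ (-β)))
    · intro t ht
      exact (hSφm.comp (by fun_prop : Measurable fun κ : ℝ => (κ, t))).aestronglyMeasurable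
    · intro t ht
      have ht0 : 0 < t := by linarith [ht.1]
      refine Eventually.of_forall fun κ => (hC κ t ⟨ht0, ht.2⟩).trans ?_
      refine mul_le_mul_of_nonneg_left ?_ (norm_nonneg _)
      exact mul_le_mul (le_abs_self C)
        (Real.rpow_le_rpow_of_nonpos (by linarith) ht.1 (by linarith))
        (by positivity) (abs_nonneg C)
    · exact φ.integrable.norm.mul_const _
    · refine Eventually.of_forall fun κ => ContinuousOn.mul ((hSc κ).mono fun t ht => ?_)
        continuousOn_const
      exact lt_of_lt_of_le (by linarith : (0 : ℝ) < z / 2) ht.1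

theorem locallyIntegrable_of_rpow_bound {S : ℝ → ℝ → ℂ} {β : ℝ}
    (hSm : Measurable (fun p : ℝ × ℝ => S p.1 p.2))
    (hSb : ∀ R Y, 0 ≤ R → 0 < Y → ∃ C, ∀ κ t, |κ| ≤ R → t ∈ Ioc 0 Y → ‖S κ t‖ ≤ C * t ^ (-β))
    {y : ℝ} (hy : 0 < y) : LocallyIntegrable (fun κ => S κ y) := by
  rw [locallyIntegrable_iff]
  intro K hK
  obtain ⟨R, hR⟩ := hK.isBounded.exists_norm_le
  obtain ⟨C, hC⟩ := hSb (max R 0) y (le_max_right _ _) hy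
  refine Measure.integrableOn_of_bounded hK.measure_lt_top.ne (M := C * y ^ (-β))
    (hSm.comp (by fun_prop : Measurable fun κ : ℝ => (κ, y))).aestronglyMeasurable ?_
  filter_upwards [ae_restrict_mem hK.measurableSet] with κ hκ
  exact hC κ y ((hR κ hκ).trans (le_max_left _ _)) ⟨hy, le_rfl⟩

/-- Bounds of the explicit solution on compact sets of frequencies. -/
theorem exists_norm_volterraSol_le_of_abs_le {β : ℝ} (hα : 0 ≤ α) (hμ : 1 < μ) (hβ0 : 0 ≤ β)
    (hβ1 : β < 1) (θ k : ℝ) (f g : ℝ → ℂ) {V : ℝ → ℝ → ℂ} {M : ℝ → ℝ} (hVl : ∀ κ, LocInt (V κ))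
    (hVM : ∀ κ t, ‖V κ t‖ ≤ M t) (hM : ∀ Y, 0 < Y → IntegrableOn M (Ioc 0 Y)) {R Y : ℝ}
    (hR : 0 ≤ R) (hY : 0 < Y) : ∃ C, ∀ κ t, |κ| ≤ R → t ∈ Ioc 0 Y →
      ‖volterraSol μ β (psi α θ κ - (k : ℂ) ^ 2) (fourierT f κ) (fourierT g κ) (V κ) t‖ ≤
        C * t ^ (-β) := by
  obtain ⟨C, hC0, hC⟩ := exists_norm_volterraSol_le (r := R ^ (α / μ) + |k| ^ (2 / μ)) hμ hβ0 hβ1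
    (by positivity) hY
  refine ⟨C * ((∫ x, ‖f x‖) + (∫ x, ‖g x‖) + ∫ s in Ioc 0 Y, M s), fun κ t hκ ht => ?_⟩
  have ht0 : 0 < t := ht.1
  have hr : (|κ| ^ (α / μ) + |k| ^ (2 / μ)) ^ μ ≤ (R ^ (α / μ) + |k| ^ (2 / μ)) ^ μ := by gcongr
  refine (hC _ ((norm_psi_sub_le hμ.le θ k κ).trans hr) _ _ _ (hVl κ) t ht).trans ?_
  have h1 : ∫ s in Ioc 0 Y, ‖V κ s‖ ≤ ∫ s in Ioc 0 Y, M s :=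
    integral_mono (hVl κ Y hY).norm (hM Y hY) (fun s => hVM κ s)
  have h2 := norm_fourierT_le f κ
  have h3 := norm_fourierT_le g κ
  gcongr

/-- The transform of a solution is the explicit solution of the Volterra equation, for every
`y > 0`: both have the same primitive, and both pair continuously in `y` with test functions. -/
theorem FracHelmholtz.IsSolution.fourier_eq_volterraSol (hα : 0 ≤ α) (hα' : α ≤ 2) (hμ : 1 < μ)
    (hμ' : μ ≤ 2) (hν : 0 ≤ ν)
    (hν' : ν ≤ 1) (hf : Integrable f) (hg : Integrable g)
    (hΦ : ∀ y : ℝ, 0 < y → Integrable (fun x => Φ x y)) {V : ℝ → ℝ → ℂ} {M : ℝ → ℝ}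
    (hVm : Measurable (fun p : ℝ × ℝ => V p.1 p.2)) (hVM : ∀ κ t, ‖V κ t‖ ≤ M t)
    (hM : ∀ Y, 0 < Y → IntegrableOn M (Ioc 0 Y))
    (hV : ∀ᵐ t, 0 < t → ∀ κ, fourierT (fun x => Φ x t) κ = V κ t)
    (hN : IsSolution α θ μ ν k f g Φ N)
    (hNh : ∀ y : ℝ, 0 < y → HasFourierT (fun x => N x y) (fun κ => Nh κ y) ∧
      Integrable (fun κ => Nh κ y)) (hNh' : StripInt Nh) {y : ℝ} (hy : 0 < y) :
    (fun κ => Nh κ y) =ᵐ[volume] fun κ => volterraSol μ ((1 - ν) * (2 - μ))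
      (psi α θ κ - (k : ℂ) ^ 2) (fourierT f κ) (fourierT g κ) (V κ) y := by
  have hvolt := hN.volterra_equation hα hα' hμ hμ' hν hν' hf hg hΦ hVm hVM hM hV hNh hNh'
  have hβ0 : 0 ≤ (1 - ν) * (2 - μ) := mul_nonneg (by linarith) (by linarith)
  have hβ1 : (1 - ν) * (2 - μ) < 1 := by nlinarith
  generalize (1 - ν) * (2 - μ) = β at *
  have hVl : ∀ κ, LocInt (V κ) := fun κ Y hY =>
    (hM Y hY).mono' (hVm.comp (by fun_prop : Measurable fun t : ℝ => (κ, t))).aestronglyMeasurable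
      (Eventually.of_forall fun t => hVM κ t)
  obtain ⟨S, hS⟩ : ∃ S : ℝ → ℝ → ℂ, S = fun κ => volterraSol μ β (psi α θ κ - (k : ℂ) ^ 2)
    (fourierT f κ) (fourierT g κ) (V κ) := ⟨_, rfl⟩
  have hSm : Measurable (fun p : ℝ × ℝ => S p.1 p.2) := by
    have := measurable_volterraSol (ω := fun κ => psi α θ κ - (k : ℂ) ^ 2) (a := fourierT f)
      (b := fourierT g) (V := V) hμ hβ1 (measurable_symbol α θ k)
      (continuous_fourierT hf).measurable (continuous_fourierT hg).measurable hVm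
    rw [hS]
    exact this
  have hSb : ∀ R Y, 0 ≤ R → 0 < Y → ∃ C, ∀ κ t, |κ| ≤ R → t ∈ Ioc 0 Y →
      ‖S κ t‖ ≤ C * t ^ (-β) := by
    rw [hS]
    exact fun R Y hR hY =>
      exists_norm_volterraSol_le_of_abs_le hα hμ hβ0 hβ1 θ k f g hVl hVM hM hR hY
  have hSc : ∀ κ, ContinuousOn (S κ) (Ioi 0) := by
    rw [hS]
    exact fun κ => continuousOn_volterraSol hμ hβ1 _ _ _ (hVl κ)
  have hprim : ∀ᵐ κ, ∀ y, 0 < y → rlIntegral 1 (Nh κ) y = rlIntegral 1 (S κ) y := by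
    rw [hS]
    filter_upwards [hvolt, hNh'.locInt_slice] with κ h1 h2 y hy
    exact rlIntegral_one_eq_volterraSol hμ hβ1 h2 (hVl κ) h1 hy
  change (fun κ => Nh κ y) =ᵐ[volume] fun κ => (fun κ => volterraSol μ β
    (psi α θ κ - (k : ℂ) ^ 2) (fourierT f κ) (fourierT g κ) (V κ)) κ y
  rw [← hS]
  refine ae_eq_of_forall_integral_mul_schwartz (hNh y hy).2.locallyIntegrable
    (locallyIntegrable_of_rpow_bound hSm hSb hy) fun φ hφ => ?_
  obtain ⟨hSφs, hc2⟩ := pairing_of_rpow_bound hβ0 hβ1 hSm hSc hSb φ hφ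
  have hNφs : StripInt (fun κ t => Nh κ t * φ κ) :=
    stripInt_mul_schwartz (fun Y hY => ⟨0, by simpa using hNh' Y hY⟩) φ
  obtain ⟨ψ, hψ⟩ := exists_schwartz_eq_fourierT φ
  have hc1 : ContinuousOn (fun t => ∫ κ, Nh κ t * φ κ) (Ioi 0) :=
    (hN.continuousOn_pairing ψ).congr fun t ht => by
      simp only
      rw [← (hNh t ht).1.pairing φ]; simp_rw [hψ]
  refine eq_of_rlIntegral_one_eq (u := fun t => ∫ κ, Nh κ t * φ κ)
    (v := fun t => ∫ κ, S κ t * φ κ) hNφs.locInt_integral hSφs.locInt_integral hc1 hc2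
    (fun z hz => ?_) hy
  rw [← (integral_rlIntegral_of_one_le (H := fun κ t => Nh κ t * φ κ) le_rfl hz (hNφs z hz)).2,
    ← (integral_rlIntegral_of_one_le (H := fun κ t => S κ t * φ κ) le_rfl hz (hSφs z hz)).2]
  simp_rw [rlIntegral_mul_const]
  apply integral_congr_ae
  filter_upwards [hprim] with κ hκ
  rw [hκ z hz]

end Solution

/-- A solution is the inverse Fourier transform of the sum of the three terms. -/
theorem FracHelmholtz.IsSolution.eq_solutionFormulaSum {α θ μ ν k : ℝ} {f g : ℝ → ℂ}
    {Φ N : ℝ → ℝ → ℂ} (hα : 0 ≤ α) (hα' : α ≤ 2) (hμ : 1 < μ)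
    (hμ' : μ ≤ 2) (hν : 0 ≤ ν) (hν' : ν ≤ 1) (hf : Integrable f) (hg : Integrable g)
    (hΦ : ∀ y : ℝ, 0 < y → Integrable (fun x => Φ x y)) (hΦ' : StripInt Φ)
    (hN : IsSolution α θ μ ν k f g Φ N) {y : ℝ} (hy : 0 < y) :
    Integrable (fun κ : ℝ =>
        ((y ^ (-((1 - ν) * (2 - μ))) : ℝ) : ℂ) * termF α θ μ ν k f y κ +
        ((y ^ (1 - (1 - ν) * (2 - μ)) : ℝ) : ℂ) * termG α θ μ ν k g y κ +
        termPhi α θ μ k Φ y κ) ∧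
      ∀ x : ℝ, N x y = solutionFormulaSum α θ μ ν k f g Φ x y := by
  obtain ⟨V, M, hVm, hVM, hM, hV⟩ := exists_measurable_fourierT hΦ'
  obtain ⟨Nh, hNh, hNh'⟩ := hN.fourier
  have h := hN.fourier_eq_volterraSol hα hα' hμ hμ' hν hν' hf hg hΦ hVm hVM hM hV hNh hNh' hy
  simp_rw [← terms_eq_volterraSol α θ μ ν k f g hV hy] at h
  refine ⟨(hNh y hy).2.congr h, fun x => ?_⟩
  rw [hN.eq_invFourierT hNh hy, invFourierT_congr_ae h]
  rfl

theorem solutionFormula_eq_sum {α θ μ ν k : ℝ} {f g : ℝ → ℂ} {Φ : ℝ → ℝ → ℂ} {y : ℝ}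
    (hF : Integrable (termF α θ μ ν k f y)) (hG : Integrable (termG α θ μ ν k g y))
    (hP : Integrable (termPhi α θ μ k Φ y)) (x : ℝ) :
    solutionFormulaSum α θ μ ν k f g Φ x y = solutionFormula α θ μ ν k f g Φ x y := by
  unfold solutionFormulaSum solutionFormula
  have h1 := hF.const_mul ((y ^ (-((1 - ν) * (2 - μ))) : ℝ) : ℂ)
  have h2 := hG.const_mul ((y ^ (1 - (1 - ν) * (2 - μ)) : ℝ) : ℂ)
  have h12 : Integrable (fun κ => ((y ^ (-((1 - ν) * (2 - μ))) : ℝ) : ℂ) * termF α θ μ ν k f y κ +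
    ((y ^ (1 - (1 - ν) * (2 - μ)) : ℝ) : ℂ) * termG α θ μ ν k g y κ) := h1.add h2
  rw [invFourierT_add h12 hP, invFourierT_add h1 h2, invFourierT_const_mul,
    invFourierT_const_mul]

/-! ### Inverse transforms of dominated families -/

/-- A measurable family `H(κ, y)`, continuous in `y > 0`, with a bound by an integrable function of
`κ` and an integrable power of `y` on every interval `(0, Y]`. -/
structure Dominated (H : ℝ → ℝ → ℂ) : Prop where
  measurable : Measurable (fun p : ℝ × ℝ => H p.1 p.2)
  continuousOn : ∀ κ, ContinuousOn (H κ) (Ioi 0)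
  bound : ∀ Y, 0 < Y → ∃ (B : ℝ → ℝ) (δ : ℝ), 0 ≤ δ ∧ δ < 1 ∧ Integrable B ∧
    ∀ κ, ∀ y ∈ Ioc 0 Y, ‖H κ y‖ ≤ B κ * y ^ (-δ)

theorem rpow_neg_le_rpow_neg {δ δ' y Y : ℝ} (h : δ ≤ δ') (hy : y ∈ Ioc 0 Y) :
    y ^ (-δ) ≤ Y ^ (δ' - δ) * y ^ (-δ') := by
  rw [show -δ = (δ' - δ) + -δ' by ring, Real.rpow_add hy.1]
  have := hy.1
  gcongr
  exact hy.2

/-- The exponent in the bound need not be nonnegative. -/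
theorem Dominated.of_bound {H : ℝ → ℝ → ℂ} (hm : Measurable (fun p : ℝ × ℝ => H p.1 p.2))
    (hc : ∀ κ, ContinuousOn (H κ) (Ioi 0))
    (hb : ∀ Y, 0 < Y → ∃ (B : ℝ → ℝ) (δ : ℝ), δ < 1 ∧ Integrable B ∧
      ∀ κ, ∀ y ∈ Ioc 0 Y, ‖H κ y‖ ≤ B κ * y ^ (-δ)) : Dominated H := by
  refine ⟨hm, hc, fun Y hY => ?_⟩
  obtain ⟨B, δ, hδ, hB, h⟩ := hb Y hY
  refine ⟨fun κ => |B κ| * Y ^ (max δ 0 - δ), max δ 0, le_max_right _ _, max_lt hδ one_pos,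
    hB.abs.mul_const _, fun κ y hy => ?_⟩
  have hy0 : 0 < y := hy.1
  refine (h κ y hy).trans ?_
  rw [mul_assoc]
  have := rpow_neg_le_rpow_neg (le_max_left δ 0) hy
  exact mul_le_mul (le_abs_self _) this (by positivity) (abs_nonneg _)

theorem Dominated.add {G H : ℝ → ℝ → ℂ} (hG : Dominated G) (hH : Dominated H) :
    Dominated (fun κ y => G κ y + H κ y) := by
  refine ⟨hG.measurable.add hH.measurable, fun κ => (hG.continuousOn κ).add (hH.continuousOn κ),
    fun Y hY => ?_⟩
  obtain ⟨B, δ, hδ0, hδ, hB, h⟩ := hG.bound Y hY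
  obtain ⟨B', δ', hδ0', hδ', hB', h'⟩ := hH.bound Y hY
  refine ⟨fun κ => |B κ| * Y ^ (max δ δ' - δ) + |B' κ| * Y ^ (max δ δ' - δ'), max δ δ',
    le_max_of_le_left hδ0, max_lt hδ hδ', (hB.abs.mul_const _).add (hB'.abs.mul_const _),
    fun κ y hy => ?_⟩
  have hy0 : 0 < y := hy.1
  refine (norm_add_le _ _).trans ?_
  rw [add_mul, mul_assoc, mul_assoc]
  gcongr
  · exact (h κ y hy).trans (mul_le_mul (le_abs_self _)
      (rpow_neg_le_rpow_neg (le_max_left δ δ') hy) (by positivity) (abs_nonneg _))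
  · exact (h' κ y hy).trans (mul_le_mul (le_abs_self _)
      (rpow_neg_le_rpow_neg (le_max_right δ δ') hy) (by positivity) (abs_nonneg _))

theorem Dominated.congr {G H : ℝ → ℝ → ℂ} (hG : Dominated G) (h : ∀ κ y, G κ y = H κ y) :
    Dominated H := by
  have : G = H := funext fun κ => funext fun y => h κ y
  rwa [← this]

theorem Dominated.measurable_slice {H : ℝ → ℝ → ℂ} (hH : Dominated H) (y : ℝ) : Measurable
    (fun κ => H κ y) :=
  hH.measurable.comp (by fun_prop : Measurable fun κ : ℝ => (κ, y))

theorem Dominated.measurable_right {H : ℝ → ℝ → ℂ} (hH : Dominated H) (κ : ℝ) : Measurable (H κ) :=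
  hH.measurable.comp (by fun_prop : Measurable fun y : ℝ => (κ, y))

theorem Dominated.integrable {H : ℝ → ℝ → ℂ} (hH : Dominated H) {y : ℝ} (hy : 0 < y) :
    Integrable (fun κ => H κ y) := by
  obtain ⟨B, δ, _, hδ, hB, h⟩ := hH.bound y hy
  exact (hB.mul_const _).mono' (hH.measurable_slice y).aestronglyMeasurable
    (Eventually.of_forall fun κ => h κ y ⟨hy, le_rfl⟩)

theorem Dominated.locInt {H : ℝ → ℝ → ℂ} (hH : Dominated H) (κ : ℝ) : LocInt (H κ) := by
  intro Y hY
  obtain ⟨B, δ, _, hδ, hB, h⟩ := hH.bound Y hY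
  refine ((integrableOn_rpow_Ioc (by linarith : -1 < -δ) Y hY).const_mul (B κ)).mono'
    (hH.measurable_right κ).aestronglyMeasurable ?_
  filter_upwards [ae_restrict_mem measurableSet_Ioc] with y hy using h κ y hy

theorem Dominated.convAt_powKer {H : ℝ → ℝ → ℂ} (hH : Dominated H) {ρ y : ℝ} (hρ : 0 < ρ)
    (hy : 0 < y) (κ : ℝ) :
    ConvAt (powKer ρ) (H κ) y := by
  obtain ⟨B, δ, _, hδ, hB, h⟩ := hH.bound y hy
  exact ConvAt.of_rpow hρ hδ (measurable_powKer ρ) (norm_powKer_le hρ)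
    (hH.measurable_right κ).aestronglyMeasurable (h κ)

theorem Dominated.stripInt {H : ℝ → ℝ → ℂ} (hH : Dominated H) : StripInt H := by
  intro Y hY
  obtain ⟨B, δ, _, hδ, hB, h⟩ := hH.bound Y hY
  rw [IntegrableOn, restrict_strip]
  have hi : Integrable (fun t : ℝ => t ^ (-δ)) (volume.restrict (Ioo 0 Y)) :=
    (integrableOn_rpow_Ioc (by linarith) Y hY).mono_set Ioo_subset_Ioc_self
  refine Integrable.mono' (hB.mul_prod hi) hH.measurable.aestronglyMeasurable ?_
  rw [← restrict_strip]
  filter_upwards [ae_restrict_mem (MeasurableSet.univ.prod measurableSet_Ioo)] with p hp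
  exact h p.1 p.2 ⟨hp.2.1, hp.2.2.le⟩

theorem Dominated.integral_norm_le {H : ℝ → ℝ → ℂ} (hH : Dominated H) {Y : ℝ} (hY : 0 < Y) :
    ∃ C δ : ℝ, 0 ≤ C ∧ 0 ≤ δ ∧ δ < 1 ∧ ∀ y ∈ Ioc 0 Y, ∫ κ, ‖H κ y‖ ≤ C * y ^ (-δ) := by
  obtain ⟨B, δ, hδ0, hδ, hB, h⟩ := hH.bound Y hY
  refine ⟨∫ κ, |B κ|, δ, integral_nonneg fun _ => abs_nonneg _, hδ0, hδ, fun y hy => ?_⟩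
  have hy0 : 0 < y := hy.1
  rw [← integral_mul_const]
  refine integral_mono (hH.integrable hy0).norm (hB.abs.mul_const _) fun κ => ?_
  refine (h κ y hy).trans ?_
  gcongr
  exact le_abs_self _

theorem Dominated.norm_invFourierT_le {H : ℝ → ℝ → ℂ} (hH : Dominated H) {Y : ℝ} (hY : 0 < Y) :
    ∃ C δ : ℝ, 0 ≤ C ∧ 0 ≤ δ ∧ δ < 1 ∧ ∀ x, ∀ y ∈ Ioc 0 Y,
      ‖invFourierT (fun κ => H κ y) x‖ ≤ C * y ^ (-δ) := by
  obtain ⟨C, δ, hC, hδ0, hδ, h⟩ := hH.integral_norm_le hY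
  refine ⟨1 / (2 * Real.pi) * C, δ, by positivity, hδ0, hδ, fun x y hy => ?_⟩
  refine (_root_.norm_invFourierT_le _ x).trans ?_
  rw [mul_assoc]
  gcongr
  exact h y hy

theorem Dominated.continuousOn_invFourierT {H : ℝ → ℝ → ℂ} (hH : Dominated H) :
    ContinuousOn (fun p : ℝ × ℝ => invFourierT (fun κ => H κ p.2) p.1) (univ ×ˢ Ioi 0) := by
  rintro ⟨x, z⟩ ⟨_, hz⟩
  have hz0 : (0 : ℝ) < z := hz
  apply ContinuousAt.continuousWithinAt
  obtain ⟨B, δ, hδ0, hδ, hB, h⟩ := hH.bound (z + 1) (by linarith)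
  have hn : (univ : Set ℝ) ×ˢ Icc (z / 2) (z + 1) ∈ 𝓝 (x, z) :=
    prod_mem_nhds univ_mem (Icc_half_mem_nhds hz0)
  refine ContinuousOn.continuousAt (s := univ ×ˢ Icc (z / 2) (z + 1)) ?_ hn
  unfold invFourierT
  refine ContinuousOn.mul continuousOn_const ?_
  apply continuousOn_of_dominated (bound := fun κ => |B κ| * (z / 2) ^ (-δ))
  · intro p _
    exact (hH.measurable_slice p.2).aestronglyMeasurable.mul
      (Continuous.aestronglyMeasurable (by fun_prop))
  · rintro p ⟨_, hp⟩
    have hp0 : 0 < p.2 := by linarith [hp.1]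
    refine Eventually.of_forall fun κ => ?_
    rw [norm_mul, norm_exp_neg_I_mul, mul_one]
    refine (h κ p.2 ⟨hp0, hp.2⟩).trans ?_
    exact mul_le_mul (le_abs_self _)
      (Real.rpow_le_rpow_of_nonpos (by linarith) hp.1 (by linarith)) (by positivity) (abs_nonneg _)
  · exact hB.abs.mul_const _
  · refine Eventually.of_forall fun κ => ContinuousOn.mul ?_ (Continuous.continuousOn (by fun_prop))
    exact (hH.continuousOn κ).comp continuousOn_snd
      fun p hp => lt_of_lt_of_le (by linarith : (0 : ℝ) < z / 2) hp.2.1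

theorem Dominated.continuousOn_invFourierT_right {H : ℝ → ℝ → ℂ} (hH : Dominated H) (x : ℝ) :
    ContinuousOn (fun y => invFourierT (fun κ => H κ y) x) (Ioi 0) :=
  hH.continuousOn_invFourierT.comp (by fun_prop : ContinuousOn (fun y : ℝ => (x, y)) _)
    fun _ hy => ⟨mem_univ _, hy⟩

theorem Dominated.locInt_invFourierT {H : ℝ → ℝ → ℂ} (hH : Dominated H) (x : ℝ) : LocInt
    (fun y => invFourierT (fun κ => H κ y) x) := by
  intro Y hY
  obtain ⟨C, δ, hC, hδ0, hδ, h⟩ := hH.norm_invFourierT_le hY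
  refine ((integrableOn_rpow_Ioc (by linarith : -1 < -δ) Y hY).const_mul C).mono'
    (((hH.continuousOn_invFourierT_right x).mono Ioc_subset_Ioi_self).aestronglyMeasurable
      measurableSet_Ioc) ?_
  filter_upwards [ae_restrict_mem measurableSet_Ioc] with y hy using h x y hy

/-- Fractional integrals in `y` commute with the inverse transform. -/
theorem Dominated.rlIntegral_invFourierT {H : ℝ → ℝ → ℂ} (hH : Dominated H) {ρ y : ℝ}
    (hρ : 0 ≤ ρ) (hy : 0 < y) :
    Integrable (fun κ => rlIntegral ρ (H κ) y) ∧ ∀ x,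
      rlIntegral ρ (fun t => invFourierT (fun κ => H κ t) x) y =
        invFourierT (fun κ => rlIntegral ρ (H κ) y) x := by
  rcases hρ.eq_or_lt with rfl | hρ
  · simp only [rlIntegral_zero]
    exact ⟨hH.integrable hy, fun _ => trivial⟩
  obtain ⟨C, δ, hC, hδ0, hδ, h⟩ := hH.integral_norm_le hy
  have hint : IntegrableOn (fun t => (y - t) ^ (ρ - 1) * ∫ κ, ‖H κ t‖) (Ioo 0 y) := by
    have hb := (integrableOn_beta (s := 0) (y := y) hρ (sub_pos.2 hδ)).mono_set
      (show Ioo 0 y ⊆ Ioc 0 y from Ioo_subset_Ioc_self)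
    refine (hb.const_mul C).mono' ?_ ?_
    · exact (Measurable.aestronglyMeasurable (by fun_prop)).mul
        (hH.stripInt.locInt_integral_norm hy).aestronglyMeasurable
    · filter_upwards [ae_restrict_mem measurableSet_Ioo] with t ht
      have h1 : 0 ≤ y - t := by linarith [ht.2]
      rw [norm_mul, Real.norm_of_nonneg (by positivity),
        Real.norm_of_nonneg (integral_nonneg fun _ => norm_nonneg _), sub_zero, sub_sub_cancel_left,
        mul_left_comm]
      gcongr
      exact h t ⟨ht.1, ht.2.le⟩
  refine ⟨(integral_rlIntegral hρ hy (hH.stripInt y hy) hint).1, fun x => ?_⟩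
  have hE : IntegrableOn (fun p : ℝ × ℝ => H p.1 p.2 *
      Complex.exp (-Complex.I * ((p.1 * x : ℝ) : ℂ))) (univ ×ˢ Ioo 0 y) :=
    (hH.stripInt y hy).mul_bdd (c := 1) (Continuous.aestronglyMeasurable (by fun_prop))
      (Eventually.of_forall fun p => (norm_exp_neg_I_mul _).le)
  have h2 := (integral_rlIntegral (H := fun κ t => H κ t *
    Complex.exp (-Complex.I * ((κ * x : ℝ) : ℂ))) hρ hy hE (by
      simp_rw [norm_mul, norm_exp_neg_I_mul, mul_one]; exact hint)).2
  simp_rw [rlIntegral_mul_const] at h2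
  unfold invFourierT
  rw [rlIntegral_const_mul, h2]

/-! ### Rapidly decaying data -/

/-- A measurable function which is integrable against `exp(c |κ|^s)` for every `c > 0`. -/
def RapidDecay (s : ℝ) (a : ℝ → ℂ) : Prop :=
  Measurable a ∧ ∀ c : ℝ, 0 < c → Integrable (fun κ => Real.exp (c * |κ| ^ s) * ‖a κ‖)

theorem norm_symbol_le_exp {α μ : ℝ} (hμ : 1 ≤ μ) (hμ' : μ ≤ 2) (θ k κ : ℝ) :
    ‖psi α θ κ - (k : ℂ) ^ 2‖ ≤ (1 + k ^ 2) * Real.exp (2 * |κ| ^ (α / μ)) := by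
  have hs : 0 ≤ |κ| ^ (α / μ) := by positivity
  have h1 : |κ| ^ α = (|κ| ^ (α / μ)) ^ μ := by
    rw [← Real.rpow_mul (abs_nonneg _), div_mul_cancel₀ _ (by positivity)]
  have h2 : (|κ| ^ (α / μ)) ^ μ ≤ Real.exp (2 * |κ| ^ (α / μ)) := by
    set s := |κ| ^ (α / μ)
    calc s ^ μ ≤ (1 + s) ^ μ := by gcongr; linarith
      _ ≤ (1 + s) ^ (2 : ℝ) := Real.rpow_le_rpow_of_exponent_le (by linarith) hμ'
      _ = (1 + s) ^ 2 := Real.rpow_two _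
      _ ≤ (Real.exp s) ^ 2 := by gcongr; linarith [Real.add_one_le_exp s]
      _ = _ := by rw [← Real.exp_nat_mul]; norm_num
  have h3 : 1 ≤ Real.exp (2 * |κ| ^ (α / μ)) := Real.one_le_exp (by positivity)
  calc ‖psi α θ κ - (k : ℂ) ^ 2‖ ≤ ‖psi α θ κ‖ + ‖(k : ℂ) ^ 2‖ := norm_sub_le _ _
    _ = |κ| ^ α + k ^ 2 := by rw [norm_psi]; simp
    _ ≤ Real.exp (2 * |κ| ^ (α / μ)) + k ^ 2 * Real.exp (2 * |κ| ^ (α / μ)) := by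
      rw [h1]
      exact add_le_add h2 (le_mul_of_one_le_right (by positivity) h3)
    _ = _ := by ring

theorem RapidDecay.symbol_mul {α μ : ℝ} (hμ : 1 ≤ μ) (hμ' : μ ≤ 2) (θ k : ℝ) {a : ℝ → ℂ}
    (ha : RapidDecay (α / μ) a) :
    RapidDecay (α / μ) (fun κ => (psi α θ κ - (k : ℂ) ^ 2) * a κ) := by
  have hm : Measurable (fun κ => (psi α θ κ - (k : ℂ) ^ 2) * a κ) :=
    (measurable_symbol α θ k).mul ha.1
  refine ⟨hm, fun c hc => ?_⟩
  refine ((ha.2 (c + 2) (by linarith)).const_mul (1 + k ^ 2)).mono' ?_ ?_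
  · exact (Measurable.mul (by fun_prop) hm.norm).aestronglyMeasurable
  · refine Eventually.of_forall fun κ => ?_
    rw [Real.norm_of_nonneg (by positivity), norm_mul, add_mul c 2, Real.exp_add]
    calc Real.exp (c * |κ| ^ (α / μ)) * (‖psi α θ κ - (k : ℂ) ^ 2‖ * ‖a κ‖)
        ≤ Real.exp (c * |κ| ^ (α / μ)) *
          ((1 + k ^ 2) * Real.exp (2 * |κ| ^ (α / μ)) * ‖a κ‖) := by
          gcongr
          exact norm_symbol_le_exp hμ hμ' θ k κ
      _ = _ := by ring

/-- Growth of the Mittag-Leffler kernels in the frequency. -/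
theorem exists_norm_mlKer_symbol_le {α μ b Y : ℝ} (hμ : 1 ≤ μ) (hb : 0 < b) (θ k : ℝ) :
    ∃ C : ℝ, 0 ≤ C ∧ ∀ κ, ∀ t ∈ Ioc 0 Y, ‖mlKer μ b (psi α θ κ - (k : ℂ) ^ 2) t‖ ≤
      C * Real.exp (4 * Y * |κ| ^ (α / μ)) * t ^ (b - 1) := by
  have hΓ := Real.Gamma_pos_of_pos hb
  refine ⟨(1 + (Real.Gamma b)⁻¹) * 2 * Real.exp (4 + 4 * (|k| ^ (2 / μ) * Y)), by positivity,
    fun κ t ht => ?_⟩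
  refine (norm_mlKer_le hμ hb (by positivity) (norm_psi_sub_le hμ θ k κ) t ht).trans (le_of_eq ?_)
  rw [mul_assoc _ (Real.exp _) (Real.exp _), ← Real.exp_add]
  congr 3
  ring

theorem dominated_mul_mlKer {α μ b : ℝ} (hμ : 1 ≤ μ) (hb : 0 < b) (θ k : ℝ) {a : ℝ → ℂ}
    (ha : RapidDecay (α / μ) a) :
    Dominated (fun κ y => a κ * mlKer μ b (psi α θ κ - (k : ℂ) ^ 2) y) := by
  refine Dominated.of_bound ?_ ?_ ?_
  · exact (ha.1.comp measurable_fst).mul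
      (measurable_mlKer hμ hb ((measurable_symbol α θ k).comp measurable_fst) measurable_snd)
  · exact fun κ => continuousOn_const.mul (continuousOn_mlKer hμ hb _)
  · intro Y hY
    obtain ⟨C, hC0, hC⟩ := exists_norm_mlKer_symbol_le (α := α) hμ hb θ k
    refine ⟨fun κ => C * (Real.exp (4 * Y * |κ| ^ (α / μ)) * ‖a κ‖), 1 - b, by linarith,
      (ha.2 _ (by linarith)).const_mul C, fun κ y hy => ?_⟩
    rw [norm_mul, neg_sub]
    calc ‖a κ‖ * ‖mlKer μ b (psi α θ κ - (k : ℂ) ^ 2) y‖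
        ≤ ‖a κ‖ * (C * Real.exp (4 * Y * |κ| ^ (α / μ)) * y ^ (b - 1)) := by
          gcongr; exact hC κ y hy
      _ = _ := by ring

/-- The regularity and decay of the source: measurable, continuous in `y > 0`, and bounded by
`A(κ) y^{-δ}` with `A` integrable against every `exp(c |κ|^s)`. -/
structure SourceDecay (s : ℝ) (χ : ℝ → ℝ → ℂ) : Prop where
  measurable : Measurable (fun p : ℝ × ℝ => χ p.1 p.2)
  continuousOn : ∀ κ, ContinuousOn (χ κ) (Ioi 0)
  bound : ∀ c Y : ℝ, 0 < c → 0 < Y → ∃ (A : ℝ → ℝ) (δ : ℝ), δ < 1 ∧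
    Integrable (fun κ : ℝ => Real.exp (c * |κ| ^ s) * A κ) ∧
    ∀ κ : ℝ, ∀ y ∈ Ioc 0 Y, ‖χ κ y‖ ≤ A κ * y ^ (-δ)

theorem SourceDecay.dominated {s : ℝ} {χ : ℝ → ℝ → ℂ} (hχ : SourceDecay s χ) : Dominated χ := by
  refine Dominated.of_bound hχ.measurable hχ.continuousOn fun Y hY => ?_
  obtain ⟨A, δ, hδ, hA, h⟩ := hχ.bound 1 Y one_pos hY
  refine ⟨fun κ => |Real.exp (1 * |κ| ^ s) * A κ|, δ, hδ, hA.abs, fun κ y hy => ?_⟩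
  have hy0 : 0 < y := hy.1
  refine (h κ y hy).trans ?_
  gcongr
  simp only
  rw [abs_mul, abs_of_pos (Real.exp_pos _)]
  exact (le_abs_self _).trans (le_mul_of_one_le_left (abs_nonneg _)
    (Real.one_le_exp (by positivity)))

theorem dominated_mul_conv {α μ b K : ℝ} (hμ : 1 ≤ μ) (hb : 1 < b) (θ k : ℝ) {c : ℝ → ℂ}
    (hc : Measurable c) (hK : 0 ≤ K) (hcK : ∀ κ, ‖c κ‖ ≤ K * Real.exp (2 * |κ| ^ (α / μ)))
    {χ : ℝ → ℝ → ℂ} (hχ : SourceDecay (α / μ) χ) :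
    Dominated (fun κ y => c κ * causalConv (mlKer μ b (psi α θ κ - (k : ℂ) ^ 2)) (χ κ) y) := by
  have hb0 : 0 < b := by linarith
  refine Dominated.of_bound ?_ ?_ ?_
  · exact (hc.comp measurable_fst).mul (measurable_causalConv
      (K := fun κ => mlKer μ b (psi α θ κ - (k : ℂ) ^ 2))
      (measurable_mlKer hμ hb0 ((measurable_symbol α θ k).comp measurable_fst) measurable_snd)
      hχ.measurable)
  · exact fun κ => continuousOn_const.mul (continuousOn_causalConv
      (continuous_mlKer hμ hb.le _).continuousOn (mlKer_zero hb _) (hχ.dominated.locInt κ))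
  · intro Y hY
    obtain ⟨C, hC0, hC⟩ := exists_norm_mlKer_symbol_le (α := α) hμ hb0 θ k
    obtain ⟨A, δ, hδ, hA, h⟩ := hχ.bound (4 * Y + 2) Y (by linarith) hY
    set J := ∫ t in Ioc 0 Y, t ^ (-δ) with hJ
    have hJi := integrableOn_rpow_Ioc (by linarith : -1 < -δ) Y hY
    have hJ0 : 0 ≤ J := setIntegral_nonneg measurableSet_Ioc fun t ht => by
      have := ht.1; positivity
    refine ⟨fun κ => K * C * Y ^ (b - 1) * J * |Real.exp ((4 * Y + 2) * |κ| ^ (α / μ)) * A κ|, 0,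
      one_pos, hA.abs.const_mul _, fun κ y hy => ?_⟩
    rw [neg_zero, Real.rpow_zero, mul_one, norm_mul]
    have hχi : ∫ t in Ioc 0 Y, ‖χ κ t‖ ≤ |A κ| * J := by
      rw [hJ, ← integral_const_mul]
      refine setIntegral_mono_on (hχ.dominated.locInt κ Y hY).norm (hJi.const_mul _)
        measurableSet_Ioc fun t ht => (h κ t ht).trans ?_
      have := ht.1
      gcongr
      exact le_abs_self _
    have h1 : ‖causalConv (mlKer μ b (psi α θ κ - (k : ℂ) ^ 2)) (χ κ) y‖ ≤
        C * Real.exp (4 * Y * |κ| ^ (α / μ)) * Y ^ (b - 1) * (|A κ| * J) := by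
      refine (norm_causalConv_le (C := C * Real.exp (4 * Y * |κ| ^ (α / μ)) * Y ^ (b - 1))
        (by positivity) (fun t ht => ?_) (hχ.dominated.locInt κ Y hY) hy.2).trans (by gcongr)
      refine (hC κ t ⟨ht.1, ht.2.le⟩).trans ?_
      gcongr
      · exact ht.1.le
      · exact ht.2.le
    simp only
    rw [abs_mul, abs_of_pos (Real.exp_pos _), add_mul, Real.exp_add]
    calc ‖c κ‖ * ‖causalConv (mlKer μ b (psi α θ κ - (k : ℂ) ^ 2)) (χ κ) y‖
        ≤ (K * Real.exp (2 * |κ| ^ (α / μ))) *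
          (C * Real.exp (4 * Y * |κ| ^ (α / μ)) * Y ^ (b - 1) * (|A κ| * J)) := by
          gcongr
          exact hcK κ
      _ = _ := by ring

/-! ### The formula for decaying data, at a fixed frequency -/

/-- The combination `a e_c + b e_{c+1} + e_{c+1} * v` of Mittag-Leffler kernels, where
`e_c(t) = t^{c-1} E_{μ,c}(ω t^μ)`.  Fractional integration of order `d` replaces `c` by `c + d`. -/
noncomputable def mlSum (μ c : ℝ) (ω a b : ℂ) (v : ℝ → ℂ) (y : ℝ) : ℂ :=
  a * mlKer μ c ω y + b * mlKer μ (c + 1) ω y + causalConv (mlKer μ (c + 1) ω) v y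

theorem rlIntegral_mlSum {μ c d y : ℝ} (hμ : 1 ≤ μ) (hd : 0 ≤ d) (hc : 0 < c) (hy : 0 < y)
    (ω a b : ℂ) {v : ℝ → ℂ} (hv : LocInt v) :
    rlIntegral d (mlSum μ c ω a b v) y = mlSum μ (d + c) ω a b v y := by
  have h := rlIntegral_mlKer_sum hμ hd hc (by linarith : 0 < c + 1) (by linarith : 1 < c + 1) hy
    ω a b hv
  rw [← add_assoc] at h
  exact h

theorem convAt_powKer_mlSum {μ c d y : ℝ} (hμ : 1 ≤ μ) (hd : 0 < d) (hc : 0 < c) (hy : 0 < y)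
    (ω a b : ℂ) {v : ℝ → ℂ} (hv : LocInt v) : ConvAt (powKer d) (mlSum μ c ω a b v) y := by
  exact (((convAt_powKer_mlKer hμ hd hc ω).const_mul a).add
    ((convAt_powKer_mlKer hμ hd (by linarith : 0 < c + 1) ω).const_mul b)).add
    (convAt_powKer_causalConv_mlKer hμ hd (by linarith : 1 < c + 1) hy ω hv)

theorem mlSum_one {μ y : ℝ} (hμ : 1 ≤ μ) (hy : 0 < y) (ω a b : ℂ) {v : ℝ → ℂ} (hv : LocInt v) :
    mlSum μ 1 ω a b v y = a + y * b + rlIntegral 2 v y + ω * mlSum μ (1 + μ) ω a b v y := by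
  have h1 : powKer 1 y = 1 := by simp [powKer]
  have h2 : powKer 2 y = y := by simp [powKer, show (2 : ℝ) - 1 = 1 by norm_num]
  have e : (1 : ℝ) + 1 = 2 := by norm_num
  unfold mlSum
  rw [e, mlKer_eq_powKer_add hμ one_pos ω hy, mlKer_eq_powKer_add hμ two_pos ω hy, h1, h2,
    causalConv_mlKer_eq hμ one_le_two hy ω hv, rlIntegral_eq_causalConv two_pos _ hy.le,
    show 1 + μ + 1 = 2 + μ by ring]
  ring

/-- The function whose twofold integral, added to `a + y b`, is `mlSum μ 1`. -/
noncomputable def mlSumDeriv (μ : ℝ) (ω a b : ℂ) (v : ℝ → ℂ) (y : ℝ) : ℂ :=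
  v y + ω * mlSum μ (μ - 1) ω a b v y

theorem mlSum_one_eq {μ y : ℝ} (hμ : 1 < μ) (hy : 0 < y) (ω a b : ℂ) {v : ℝ → ℂ} (hv : LocInt v) :
    mlSum μ 1 ω a b v y = a + y * b + rlIntegral 2 (mlSumDeriv μ ω a b v) y := by
  unfold mlSumDeriv
  rw [mlSum_one hμ.le hy ω a b hv, rlIntegral_add two_pos hy.le (convAt_powKer one_le_two hy hv)
    ((convAt_powKer_mlSum hμ.le two_pos (by linarith) hy ω a b hv).const_mul ω),
    rlIntegral_const_mul, rlIntegral_mlSum hμ.le zero_le_two (by linarith) hy ω a b hv,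
    show 2 + (μ - 1) = 1 + μ by ring, add_assoc]

theorem rlIntegral_mlSumDeriv {μ γ y : ℝ} (hμ : 1 < μ) (hγ : 0 ≤ γ) (hy : 0 < y) (ω a b : ℂ)
    {v : ℝ → ℂ} (hv : LocInt v) (hv' : 0 < γ → ConvAt (powKer γ) v y) :
    rlIntegral γ (mlSumDeriv μ ω a b v) y =
      rlIntegral γ v y + ω * mlSum μ (γ + (μ - 1)) ω a b v y := by
  rcases hγ.eq_or_lt with rfl | h
  · simp only [rlIntegral_zero, zero_add, mlSumDeriv]
  unfold mlSumDeriv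
  rw [rlIntegral_add h hy.le (hv' h)
    ((convAt_powKer_mlSum hμ.le h (by linarith) hy ω a b hv).const_mul ω),
    rlIntegral_const_mul, rlIntegral_mlSum hμ.le hγ (by linarith) hy ω a b hv]

/-- A source which is a fractional integral is absorbed by the index of the kernel. -/
theorem volterraSol_rlIntegral {μ β γ y : ℝ} (hμ : 1 ≤ μ) (hγ : 0 ≤ γ) (hβγ : γ + μ = 2 - β)
    (hy : 0 < y) (ω a b : ℂ) {v : ℝ → ℂ} (hv : LocInt v) :
    volterraSol μ β ω a b (rlIntegral γ v) y = mlSum μ (1 - β) ω a b v y := by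
  unfold volterraSol mlSum
  rw [show 1 - β + 1 = 2 - β by ring]
  congr 1
  rcases hγ.eq_or_lt with rfl | h
  · rw [rlIntegral_zero, ← hβγ, zero_add]
  obtain ⟨r, hr, hω⟩ := exists_norm_le_rpow hμ ω
  have hμ0 : 0 < μ := by linarith
  rw [causalConv_congr (u' := causalConv (powKer γ) v) (fun _ _ => rfl)
    (Eventually.of_forall fun t ht => rlIntegral_eq_causalConv h v ht.1.le),
    causalConv_assoc hμ0 h (measurable_mlKer_const hμ hμ0 _) (measurable_powKer γ)
    (norm_mlKer_le hμ hμ0 hr hω) (norm_powKer_le h) (hv y hy).aestronglyMeasurable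
    (integrableOn_rpow_mul (by linarith) (hv y hy))]
  refine causalConv_congr (fun t ht => ?_) (Eventually.of_forall fun _ _ => rfl)
  rw [causalConv_comm, powKer_conv_mlKer hμ h hμ0 ht.1, hβγ]

/-! ### The formula for decaying data as a solution -/

section Decay

variable {α μ : ℝ} {a b : ℝ → ℂ} {χ : ℝ → ℝ → ℂ}

theorem dominated_mlSum {c : ℝ} (hμ : 1 ≤ μ) (hc : 0 < c) (θ k : ℝ) (ha : RapidDecay (α / μ) a)
    (hb : RapidDecay (α / μ) b) (hχ : SourceDecay (α / μ) χ) :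
    Dominated (fun κ => mlSum μ c (psi α θ κ - (k : ℂ) ^ 2) (a κ) (b κ) (χ κ)) := by
  refine ((dominated_mul_mlKer hμ hc θ k ha).add
    (dominated_mul_mlKer hμ (by linarith : 0 < c + 1) θ k hb)).add ?_
  refine (dominated_mul_conv hμ (by linarith : 1 < c + 1) θ k (c := fun _ => 1) measurable_const
    zero_le_one (fun κ => ?_) hχ).congr fun κ y => one_mul _
  rw [norm_one, one_mul]
  exact Real.one_le_exp (by positivity)

theorem dominated_symbol_mul_mlSum {c : ℝ} (hμ : 1 ≤ μ) (hμ' : μ ≤ 2) (hc : 0 < c) (θ k : ℝ)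
    (ha : RapidDecay (α / μ) a) (hb : RapidDecay (α / μ) b) (hχ : SourceDecay (α / μ) χ) :
    Dominated (fun κ y => (psi α θ κ - (k : ℂ) ^ 2) *
      mlSum μ c (psi α θ κ - (k : ℂ) ^ 2) (a κ) (b κ) (χ κ) y) := by
  refine (((dominated_mul_mlKer hμ hc θ k (ha.symbol_mul hμ hμ' θ k)).add
    (dominated_mul_mlKer hμ (by linarith : 0 < c + 1) θ k (hb.symbol_mul hμ hμ' θ k))).add
    (dominated_mul_conv hμ (by linarith : 1 < c + 1) θ k (measurable_symbol α θ k)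
      (by positivity) (norm_symbol_le_exp hμ hμ' θ k) hχ)).congr fun κ y => ?_
  unfold mlSum
  ring

theorem dominated_mlSumDeriv (hμ : 1 < μ) (hμ' : μ ≤ 2) (θ k : ℝ)
    (ha : RapidDecay (α / μ) a) (hb : RapidDecay (α / μ) b) (hχ : SourceDecay (α / μ) χ) :
    Dominated (fun κ => mlSumDeriv μ (psi α θ κ - (k : ℂ) ^ 2) (a κ) (b κ) (χ κ)) :=
  hχ.dominated.add (dominated_symbol_mul_mlSum hμ.le hμ' (by linarith) θ k ha hb hχ)

theorem RapidDecay.integrable {s : ℝ} (ha : RapidDecay s a) : Integrable a := by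
  refine (ha.2 1 one_pos).mono' ha.1.aestronglyMeasurable (Eventually.of_forall fun κ => ?_)
  exact le_mul_of_one_le_left (norm_nonneg _) (Real.one_le_exp (by positivity))

/-- The Fourier transform of an integrable function is measurable, so the decay hypotheses on the
data are of the form used here. -/
theorem FracHelmholtz.AdmissibleData.exists_source {ν : ℝ} {f g : ℝ → ℂ} {Φ : ℝ → ℝ → ℂ}
    (h : AdmissibleData α μ ν f g Φ) (hf : Integrable f) (hg : Integrable g) :
    RapidDecay (α / μ) (fourierT f) ∧ RapidDecay (α / μ) (fourierT g) ∧
      ∃ χ : ℝ → ℝ → ℂ, SourceDecay (α / μ) χ ∧ ∀ κ y : ℝ, 0 < y →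
        fourierT (fun x => Φ x y) κ = rlIntegral (ν * (2 - μ)) (χ κ) y := by
  have aux : ∀ {u : ℝ → ℂ}, Integrable u → (∀ c : ℝ, 0 < c →
      Integrable (fun κ : ℝ => (Real.exp (c * |κ| ^ (α / μ)) : ℂ) * fourierT u κ)) →
      RapidDecay (α / μ) (fourierT u) := fun hu hd =>
    ⟨(continuous_fourierT hu).measurable, fun c hc => (hd c hc).norm.congr
      (Eventually.of_forall fun κ => by
        simp only [norm_mul, Complex.norm_real, Real.norm_of_nonneg (Real.exp_pos _).le])⟩
  obtain ⟨χ, h1, h2, h3, h4⟩ := h.source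
  exact ⟨aux hf h.decay_f, aux hg h.decay_g, χ, ⟨h1, h2, h4⟩, h3⟩

variable {ν θ k : ℝ} {f g : ℝ → ℂ} {Φ : ℝ → ℝ → ℂ}

theorem terms_eq_mlSum (hμ : 1 < μ) (hμ' : μ ≤ 2) (hν : 0 ≤ ν) (hχ : SourceDecay (α / μ) χ)
    (hΦχ : ∀ κ y : ℝ, 0 < y → fourierT (fun x => Φ x y) κ = rlIntegral (ν * (2 - μ)) (χ κ) y)
    {y : ℝ} (hy : 0 < y) (κ : ℝ) :
    ((y ^ (-((1 - ν) * (2 - μ))) : ℝ) : ℂ) * termF α θ μ ν k f y κ +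
      ((y ^ (1 - (1 - ν) * (2 - μ)) : ℝ) : ℂ) * termG α θ μ ν k g y κ + termPhi α θ μ k Φ y κ =
    mlSum μ (1 - (1 - ν) * (2 - μ)) (psi α θ κ - (k : ℂ) ^ 2) (fourierT f κ) (fourierT g κ)
      (χ κ) y := by
  rw [terms_eq_volterraSol α θ μ ν k f g (V := fun κ => rlIntegral (ν * (2 - μ)) (χ κ))
    (Eventually.of_forall fun t ht κ => hΦχ κ t ht) hy]
  exact volterraSol_rlIntegral hμ.le (mul_nonneg hν (by linarith)) (by ring) hy _ _ _
    (hχ.dominated.locInt κ)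

theorem beta_lt_one (hμ : 1 < μ) (hμ' : μ ≤ 2) (hν : 0 ≤ ν) : (1 - ν) * (2 - μ) < 1 := by
  nlinarith

theorem integrable_terms (hμ : 1 < μ) (hμ' : μ ≤ 2) (hν : 0 ≤ ν)
    (hf : RapidDecay (α / μ) (fourierT f))
    (hg : RapidDecay (α / μ) (fourierT g)) (hχ : SourceDecay (α / μ) χ)
    (hΦχ : ∀ κ y : ℝ, 0 < y → fourierT (fun x => Φ x y) κ = rlIntegral (ν * (2 - μ)) (χ κ) y)
    {y : ℝ} (hy : 0 < y) : Integrable (termF α θ μ ν k f y) ∧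
      Integrable (termG α θ μ ν k g y) ∧ Integrable (termPhi α θ μ k Φ y) := by
  have hβ := beta_lt_one hμ hμ' hν
  have aux : ∀ {c : ℝ} {u : ℝ → ℂ}, 0 < c → RapidDecay (α / μ) (fourierT u) → Integrable (fun κ =>
      mittagLeffler μ c (((y ^ μ : ℝ) : ℂ) * (psi α θ κ - (k : ℂ) ^ 2)) * fourierT u κ) := by
    intro c u hc hu
    have h := ((dominated_mul_mlKer hμ.le hc θ k hu).integrable hy).const_mul
      (((y ^ (c - 1))⁻¹ : ℝ) : ℂ)
    refine h.congr (Eventually.of_forall fun κ => ?_)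
    have h0 : ((y ^ (c - 1) : ℝ) : ℂ) ≠ 0 := by
      exact_mod_cast (Real.rpow_pos_of_pos hy _).ne'
    simp only [mlKer, Complex.ofReal_inv]
    rw [mul_comm (psi α θ κ - (k : ℂ) ^ 2)]
    field_simp
  refine ⟨aux (by linarith) hf, aux (by linarith) hg, ?_⟩
  -- the source term is the full integrand for the data `f = g = 0`
  have h0 : RapidDecay (α / μ) (fun _ => (0 : ℂ)) := ⟨measurable_const, fun c _ => by simp⟩
  have hz : fourierT (fun _ => 0) = fun _ => 0 := by ext κ; simp [fourierT]
  refine ((dominated_mlSum hμ.le (by linarith : 0 < 1 - (1 - ν) * (2 - μ)) θ k h0 h0 hχ).integrable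
    hy).congr (Eventually.of_forall fun κ => ?_)
  have := terms_eq_mlSum (θ := θ) (k := k) (f := fun _ => 0) (g := fun _ => 0) hμ hμ' hν hχ hΦχ hy κ
  simp only [termF, termG, hz, mul_zero, zero_add] at this
  exact this.symm

theorem solutionFormula_eq_invFourierT (hμ : 1 < μ) (hμ' : μ ≤ 2) (hν : 0 ≤ ν)
    (hf : RapidDecay (α / μ) (fourierT f)) (hg : RapidDecay (α / μ) (fourierT g))
    (hχ : SourceDecay (α / μ) χ)
    (hΦχ : ∀ κ y : ℝ, 0 < y → fourierT (fun x => Φ x y) κ = rlIntegral (ν * (2 - μ)) (χ κ) y)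
    {y : ℝ} (hy : 0 < y) (x : ℝ) : solutionFormula α θ μ ν k f g Φ x y =
      invFourierT (fun κ => mlSum μ (1 - (1 - ν) * (2 - μ)) (psi α θ κ - (k : ℂ) ^ 2)
        (fourierT f κ) (fourierT g κ) (χ κ) y) x := by
  obtain ⟨h1, h2, h3⟩ := integrable_terms (θ := θ) (k := k) hμ hμ' hν hf hg hχ hΦχ hy
  rw [← solutionFormula_eq_sum h1 h2 h3]
  unfold solutionFormulaSum
  simp_rw [terms_eq_mlSum (θ := θ) (k := k) hμ hμ' hν hχ hΦχ hy]

/-- The fractional integral which the Hilfer derivative differentiates twice, as an explicit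
twofold integral. -/
theorem rlIntegral_solutionFormula (hμ : 1 < μ) (hμ' : μ ≤ 2) (hν : 0 ≤ ν) (hν' : ν ≤ 1)
    (hf : RapidDecay (α / μ) (fourierT f)) (hg : RapidDecay (α / μ) (fourierT g))
    (hχ : SourceDecay (α / μ) χ)
    (hΦχ : ∀ κ y : ℝ, 0 < y → fourierT (fun x => Φ x y) κ = rlIntegral (ν * (2 - μ)) (χ κ) y)
    (x : ℝ) {y : ℝ} (hy : 0 < y) :
    rlIntegral ((1 - ν) * (2 - μ)) (solutionFormula α θ μ ν k f g Φ x) y =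
      invFourierT (fourierT f) x + y * invFourierT (fourierT g) x +
        rlIntegral 2 (fun t => invFourierT (fun κ => mlSumDeriv μ (psi α θ κ - (k : ℂ) ^ 2)
          (fourierT f κ) (fourierT g κ) (χ κ) t) x) y := by
  have hβ := beta_lt_one hμ hμ' hν
  have hβ0 : 0 ≤ (1 - ν) * (2 - μ) := mul_nonneg (by linarith) (by linarith)
  have hS := dominated_mlSum hμ.le (by linarith : 0 < 1 - (1 - ν) * (2 - μ)) θ k hf hg hχ
  have hP := dominated_mlSumDeriv hμ hμ' θ k hf hg hχ
  have hN := fun t (ht : 0 < t) =>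
    solutionFormula_eq_invFourierT (θ := θ) (k := k) hμ hμ' hν hf hg hχ hΦχ ht x
  have e1 : rlIntegral ((1 - ν) * (2 - μ)) (solutionFormula α θ μ ν k f g Φ x) y =
      rlIntegral ((1 - ν) * (2 - μ)) (fun t => invFourierT (fun κ =>
        mlSum μ (1 - (1 - ν) * (2 - μ)) (psi α θ κ - (k : ℂ) ^ 2)
        (fourierT f κ) (fourierT g κ) (χ κ) t) x) y := by
    rcases hβ0.eq_or_lt with h | h
    · rw [← h, rlIntegral_zero, rlIntegral_zero, h]
      exact hN y hy
    · exact rlIntegral_congr_ae h hy.le (Eventually.of_forall fun t ht => hN t ht.1)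
  obtain ⟨hi, h2⟩ := hP.rlIntegral_invFourierT zero_le_two hy
  have hfg : Integrable (fun κ => fourierT f κ + y * fourierT g κ) :=
    hf.integrable.add (hg.integrable.const_mul _)
  rw [e1, (hS.rlIntegral_invFourierT hβ0 hy).2, h2, ← invFourierT_const_mul,
    ← invFourierT_add hf.integrable (hg.integrable.const_mul _), ← invFourierT_add hfg hi]
  congr 1
  ext κ
  rw [rlIntegral_mlSum hμ.le hβ0 (by linarith) hy _ _ _ (hχ.dominated.locInt κ),
    add_sub_cancel, mlSum_one_eq hμ hy _ _ _ (hχ.dominated.locInt κ)]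

/-- For data with rapidly decaying transforms the formula defines a solution. -/
theorem FracHelmholtz.AdmissibleData.isSolution (h : AdmissibleData α μ ν f g Φ) (hμ : 1 < μ)
    (hμ' : μ ≤ 2) (hν : 0 ≤ ν) (hν' : ν ≤ 1) (hf : Integrable f) (hg : Integrable g)
    (hΦ : ∀ y : ℝ, 0 < y → Integrable (fun x => Φ x y)) :
    IsSolution α θ μ ν k f g Φ (solutionFormula α θ μ ν k f g Φ) := by
  obtain ⟨hfd, hgd, χ, hχ, hΦχ⟩ := h.exists_source hf hg
  have hβ := beta_lt_one hμ hμ' hν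
  have hβ0 : 0 ≤ (1 - ν) * (2 - μ) := mul_nonneg (by linarith) (by linarith)
  have hγ0 : 0 ≤ ν * (2 - μ) := mul_nonneg hν (by linarith)
  have hc : 0 < 1 - (1 - ν) * (2 - μ) := by linarith
  set S : ℝ → ℝ → ℂ := fun κ => mlSum μ (1 - (1 - ν) * (2 - μ)) (psi α θ κ - (k : ℂ) ^ 2)
    (fourierT f κ) (fourierT g κ) (χ κ) with hSdef
  set P : ℝ → ℝ → ℂ := fun κ => mlSumDeriv μ (psi α θ κ - (k : ℂ) ^ 2)
    (fourierT f κ) (fourierT g κ) (χ κ) with hPdef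
  have hS : Dominated S := dominated_mlSum hμ.le hc θ k hfd hgd hχ
  have hωS : Dominated (fun κ y => (psi α θ κ - (k : ℂ) ^ 2) * S κ y) :=
    dominated_symbol_mul_mlSum hμ.le hμ' hc θ k hfd hgd hχ
  have hP : Dominated P := dominated_mlSumDeriv hμ hμ' θ k hfd hgd hχ
  have hN : ∀ x y : ℝ, 0 < y → solutionFormula α θ μ ν k f g Φ x y =
      invFourierT (fun κ => S κ y) x := fun x y hy =>
    solutionFormula_eq_invFourierT hμ hμ' hν hfd hgd hχ hΦχ hy x
  have hNy : ∀ y : ℝ, 0 < y → (fun x => solutionFormula α θ μ ν k f g Φ x y) =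
      invFourierT (fun κ => S κ y) := fun y hy => funext fun x => hN x y hy
  have hU := fun x => taylor_converse (hP.locInt_invFourierT x) (hP.continuousOn_invFourierT_right x)
    (fun y hy => rlIntegral_solutionFormula hμ hμ' hν hν' hfd hgd hχ hΦχ x hy)
  refine ⟨?_, ?_, ⟨S, ?_, hS.stripInt⟩, ?_, ?_, ?_, ?_, ?_, ?_, ?_⟩
  · exact hS.continuousOn_invFourierT.congr fun p hp => hN p.1 p.2 hp.2
  · intro a b ha
    obtain ⟨C, δ, hC, hδ0, hδ, hb⟩ := hS.norm_invFourierT_le (lt_max_of_lt_left ha : 0 < max a b)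
    refine ⟨C * a ^ (-δ), fun x y hy => ?_⟩
    have hy0 : 0 < y := ha.trans_le hy.1
    rw [hN x y hy0]
    refine (hb x y ⟨hy0, hy.2.trans (le_max_right a b)⟩).trans ?_
    exact mul_le_mul_of_nonneg_left
      (Real.rpow_le_rpow_of_nonpos ha hy.1 (by linarith)) hC
  · intro y hy
    rw [hNy y hy]
    exact ⟨hasFourierT_invFourierT (hS.integrable hy), hS.integrable hy⟩
  · exact Eventually.of_forall fun x y hy => ⟨((hU x).1 y hy).1, ((hU x).1 y hy).2.1⟩
  · intro Y hY
    refine ⟨2, ?_⟩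
    obtain ⟨C, δ, hC, hδ0, hδ, hb⟩ := hP.norm_invFourierT_le hY
    have hs : MeasurableSet ((univ : Set ℝ) ×ˢ Ioo (0 : ℝ) Y) :=
      MeasurableSet.univ.prod measurableSet_Ioo
    have hi : Integrable (fun t : ℝ => C * t ^ (-δ)) (volume.restrict (Ioo 0 Y)) :=
      ((integrableOn_rpow_Ioc (by linarith) Y hY).mono_set Ioo_subset_Ioc_self).const_mul C
    have hg := integrable_weight_two.mul_prod hi
    rw [← restrict_strip] at hg
    refine IntegrableOn.congr_fun (f := fun p : ℝ × ℝ => (((1 + |p.1|) ^ 2)⁻¹ : ℝ) •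
      invFourierT (fun κ => P κ p.2) p.1) ?_ (fun p hp => ?_) hs
    · refine Integrable.mono' hg ?_ ?_
      · have hw : Measurable (fun p : ℝ × ℝ => ((1 + |p.1|) ^ 2)⁻¹) := by fun_prop
        refine hw.aestronglyMeasurable.smul ?_
        exact (hP.continuousOn_invFourierT.mono
          (prod_mono_right Ioo_subset_Ioi_self)).aestronglyMeasurable hs
      · filter_upwards [ae_restrict_mem hs] with p hp
        rw [norm_smul, Real.norm_of_nonneg (by positivity)]
        gcongr
        exact hb p.1 p.2 ⟨hp.2.1, hp.2.2.le⟩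
    · simp only
      rw [((hU p.1).1 p.2 hp.2.1).2.2]
  · have hψS : ∀ y : ℝ, 0 < y → Integrable (fun κ => -psi α θ κ * S κ y) := fun y hy => by
      refine ((hωS.integrable hy).neg.sub ((hS.integrable hy).const_mul ((k : ℂ) ^ 2))).congr
        (Eventually.of_forall fun κ => ?_)
      simp only [Pi.sub_apply, Pi.neg_apply]
      ring
    refine ⟨fun x y => invFourierT (fun κ => -psi α θ κ * S κ y) x, fun y hy => ?_,
      fun y hy => ?_⟩
    · rw [hNy y hy]
      exact ⟨fun κ => S κ y, hasFourierT_invFourierT (hS.integrable hy),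
        hasFourierT_invFourierT (hψS y hy)⟩
    · obtain ⟨hPi, hPe⟩ := hP.rlIntegral_invFourierT hγ0 hy
      -- on the Fourier side the left-hand side of the equation is the transform of the source
      have hsum : ∀ κ, -psi α θ κ * S κ y + rlIntegral (ν * (2 - μ)) (P κ) y +
          (k : ℂ) ^ 2 * S κ y = fourierT (fun x => Φ x y) κ := fun κ => by
        rw [hΦχ κ y hy, hPdef]
        simp only
        rw [rlIntegral_mlSumDeriv hμ hγ0 hy _ _ _ (hχ.dominated.locInt κ)
          (fun h => hχ.dominated.convAt_powKer h hy κ),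
          show ν * (2 - μ) + (μ - 1) = 1 - (1 - ν) * (2 - μ) by ring]
        simp only [hSdef]
        ring
      have h1 : Integrable (fun κ => -psi α θ κ * S κ y + rlIntegral (ν * (2 - μ)) (P κ) y) :=
        (hψS y hy).add hPi
      have h2 := (hS.integrable hy).const_mul ((k : ℂ) ^ 2)
      have hΦi : Integrable (fourierT (fun x => Φ x y)) :=
        (h1.add h2).congr (Eventually.of_forall hsum)
      filter_upwards [invFourierT_fourierT_ae (hΦ y hy) hΦi] with x hx
      have hil : hilferDeriv μ ν (solutionFormula α θ μ ν k f g Φ x) y =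
          invFourierT (fun κ => rlIntegral (ν * (2 - μ)) (P κ) y) x := by
        rw [hilferDeriv_eq hμ hμ', ← hPe x]
        rcases hγ0.eq_or_lt with h | h
        · rw [← h, rlIntegral_zero, rlIntegral_zero]
          exact ((hU x).1 y hy).2.2
        · exact rlIntegral_congr_ae h hy.le
            (Eventually.of_forall fun t ht => ((hU x).1 t ht.1).2.2)
      rw [hil, hN x y hy, ← invFourierT_const_mul, ← invFourierT_add (hψS y hy) hPi,
        ← invFourierT_add h1 h2, ← hx]
      exact congrArg (fun h => invFourierT h x) (funext hsum)
  · filter_upwards [invFourierT_fourierT_ae hf hfd.integrable] with x hx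
    exact hx ▸ (hU x).2.1
  · filter_upwards [invFourierT_fourierT_ae hg hgd.integrable] with x hx
    exact hx ▸ (hU x).2.2
  · intro y hy
    rw [hNy y hy]
    exact (tendsto_invFourierT _).mono_left atTop_le_cocompact
  · intro y hy
    rw [hNy y hy]
    exact (tendsto_invFourierT _).mono_left atBot_le_cocompact

end Decay

theorem theorem2 (α θ μ ν k : ℝ) (hα : 1 < α) (hα' : α ≤ 2) (hθ : |θ| ≤ min α (2 - α))
    (hμ : 1 < μ) (hμ' : μ ≤ 2) (hν : 0 ≤ ν) (hν' : ν ≤ 1)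
    (f g : ℝ → ℂ) (Φ : ℝ → ℝ → ℂ) (hf : Integrable f) (hg : Integrable g)
    (hΦ : ∀ y : ℝ, 0 < y → Integrable (fun x => Φ x y))
    (hΦ' : ∀ Y : ℝ, 0 < Y → IntegrableOn (fun p : ℝ × ℝ => Φ p.1 p.2) (univ ×ˢ Ioo 0 Y)) :
    -- every solution is given by the formula
    (∀ N : ℝ → ℝ → ℂ, IsSolution α θ μ ν k f g Φ N → ∀ y : ℝ, 0 < y →
      Integrable (fun κ : ℝ =>
        ((y ^ (-((1 - ν) * (2 - μ))) : ℝ) : ℂ) * termF α θ μ ν k f y κ +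
        ((y ^ (1 - (1 - ν) * (2 - μ)) : ℝ) : ℂ) * termG α θ μ ν k g y κ +
        termPhi α θ μ k Φ y κ) ∧
      (∀ x : ℝ, N x y = solutionFormulaSum α θ μ ν k f g Φ x y) ∧
      (Integrable (termF α θ μ ν k f y) → Integrable (termG α θ μ ν k g y) →
        Integrable (termPhi α θ μ k Φ y) →
        ∀ x : ℝ, N x y = solutionFormula α θ μ ν k f g Φ x y)) ∧
    -- for admissible data, the integrals converge and the formula is a solution
    (AdmissibleData α μ ν f g Φ →
      (∀ y : ℝ, 0 < y → Integrable (termF α θ μ ν k f y) ∧ Integrable (termG α θ μ ν k g y) ∧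
        Integrable (termPhi α θ μ k Φ y)) ∧
      IsSolution α θ μ ν k f g Φ (solutionFormula α θ μ ν k f g Φ)) := by
  have h : ∀ N : ℝ → ℝ → ℂ, IsSolution α θ μ ν k f g Φ N → ∀ y : ℝ, 0 < y → _ := fun N hN y hy =>
    hN.eq_solutionFormulaSum (by linarith) hα' hμ hμ' hν hν' hf hg hΦ hΦ' hy
  refine ⟨fun N hN y hy => ⟨(h N hN y hy).1, (h N hN y hy).2, fun hF hG hP x => ?_⟩,
    fun hd => ⟨fun y hy => ?_, hd.isSolution hμ hμ' hν hν' hf hg hΦ⟩⟩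
  · rw [(h N hN y hy).2 x, solutionFormula_eq_sum hF hG hP]
  · obtain ⟨hfd, hgd, χ, hχ, hΦχ⟩ := hd.exists_source hf hg
    exact integrable_terms hμ hμ' hν hfd hgd hχ hΦχ hy
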